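/- Let $|a|<m$ and consider the Kerr spacetime in ingoing Eddington–Finkelstein coordinates $(\underline u,r,\theta,\varphi)$, $$\mathbf g=-\Big(1-\frac{2mr}{|q|^2}\Big)d\underline u^2+2\,dr\,d\underline u-2a\sin^2\theta\,dr\,d\varphi-\frac{4mra\sin^2\theta}{|q|^2}d\underline u\,d\varphi+|q|^2d\theta^2+\frac{\Sigma(r,\theta)^2\sin^2\theta}{|q|^2}d\varphi^2,$$ where $|q|^2=r^2+a^2\cos^2\theta$, $\Delta(r)=r^2-2mr+a^2$, $\Sigma(r,\theta)^2=(r^2+a^2)^2-a^2\sin^2\theta\,\Delta(r)$, extended smoothly to the axis $\theta\in\{0,\pi\}$. Put $r_\pm=m\pm\sqrt{m^2-a^2}$ and $\kappa=\frac{r_+-r_-}{2mr_+}$. For $r>r_-$ and $0<\theta<\pi/2$ let $\theta_*=\theta_*(r,\theta)\in[\theta,\pi/2)$ be the unique solution of $$\int_{\theta_*}^{\theta}\frac{d\theta'}{\sqrt{\sin^2\theta_*-\sin^2\theta'}}+\operatorname{sgn}(r-r_+)\int_{r_+}^{r}\frac{|a|\,dr'}{\Sigma(r',\theta_*)}=0,$$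 and let $\theta_*(r,\theta)=\theta$ for $\theta\in\{0,\pi/2\}$. For $\theta\in[0,\pi/2]$ let $$f_*(r,\theta)=\int_r^{r_+}\frac{r'^2+a^2-\Sigma(r',\theta_*)}{\Delta(r')}\,dr'-\operatorname{sgn}(r-r_+)\int_{\theta_*}^{\theta}|a|\sqrt{\sin^2\theta_*-\sin^2\theta'}\,d\theta',$$ and extend by $f_*(r,\theta)=f_*(r,\pi-\theta)$ for $\theta\in(\pi/2,\pi]$. The Pretorius–Israel incoming optical function is $\widetilde{\underline u}_0=\underline u+f_*(r,\theta)$. Let $$r_*=f(r)+f_*(r,\theta),\qquad f(r)=r+\frac{2mr_+}{r_+-r_-}\ln|r-r_+|-\frac{2mr_-}{r_+-r_-}\ln|r-r_-|+c,$$ with an arbitrary constant $c\in\mathbb R$ (so $f'=(r^2+a^2)/\Delta$), and let $$\tilde r=r_++\operatorname{sgn}(r-r_+)\,e^{\kappa r_*}.$$ Consider the 2-spheres $\{\widetilde{\underline u}_0=\text{const}\}\cap\{\tilde r=\text{const}\}$, with the adapted null frame $(\tilde e_1,\tilde e_2,\tilde e_3,\tilde e_4)$: $\tilde e_1,\tilde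 e_2$ are orthonormal and tangent to the spheres, $\tilde e_3=-\mathbf D\widetilde{\underline u}_0$ (the metric gradient) and $\tilde e_4$ are null and orthogonal to the spheres, and $\mathbf g(\tilde e_3,\tilde e_4)=-2$. Their null expansions are $\operatorname{tr}\tilde\chi_0=\sum_{b=1,2}\mathbf g(\mathbf D_{\tilde e_b}\tilde e_4,\tilde e_b)$ and $\operatorname{tr}\tilde{\underline\chi}_0=\sum_{b=1,2}\mathbf g(\mathbf D_{\tilde e_b}\tilde e_3,\tilde e_b)$. Then for every $r_0>r_+$ there are constants $C_{r_0}\ge1$ and $c_{r_0}>0$ (depending only on $r_0,a,m$ and the normalization constant $c$) and a function $F(r,\theta)$ such that at every point with $m\le r\le r_0$ and $\theta\in[0,\pi]$ such a frame exists locally (as a $C^1$ frame), and every such frame satisfies $$\operatorname{tr}\tilde\chi_0=F(r,\theta)\,(\tilde r-r_+),\qquad C_{r_0}^{-1}\le F(r,\theta)\le C_{r_0},\qquad \operatorname{tr}\tilde{\underline\chi}_0\le-c_{r_0}.$$ -/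

import Mathlib

open Set Filter Topology
open scoped ContDiff Matrix

noncomputable section

/-! ## Lorentzian geometry in a coordinate chart

Points and tangent vectors are coordinate vectors `Fin 4 → ℝ`; a metric is a matrix-valued function
of the point. -/

/-- Coordinate vectors. -/
abbrev Coord : Type := Fin 4 → ℝ

/-- A metric in a chart: the matrix of components at each point. -/
abbrev ChartMetric : Type := Coord → Matrix (Fin 4) (Fin 4) ℝ

/-- The value `g_x(v, w)`. -/
def ChartMetric.inner (g : ChartMetric) (x v w : Coord) : ℝ := v ⬝ᵥ (g x *ᵥ w)

/-- The derivative at `x` in direction `z` of `g(v, w)` for constant coordinate vectors `v, w`. -/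
def ChartMetric.dInner (g : ChartMetric) (x z v w : Coord) : ℝ :=
  fderiv ℝ (fun y => g.inner y v w) x z

/-- `g(D_v Y, w)` at `x`, for the Levi-Civita connection `D` of `g`: the coordinate derivative of the
vector field `Y` plus the Christoffel symbols of the first kind,
`Γ(v, Y; w) = (∂_v g(Y, w) + ∂_Y g(v, w) - ∂_w g(v, Y)) / 2`. -/
def ChartMetric.innerCov (g : ChartMetric) (Y : Coord → Coord) (x v w : Coord) : ℝ :=
  g.inner x (fderiv ℝ Y x v) w +
    (g.dInner x v (Y x) w + g.dInner x (Y x) v w - g.dInner x w v (Y x)) / 2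

/-- The vector fields `e₁, e₂, e₃, e₄` form, near the point `p`, the null frame adapted to the
2-surfaces `{U = const} ∩ {R = const}` with `e₃ = -D U` (the metric gradient):
`e₁, e₂` are an orthonormal frame of the tangent planes of these surfaces, and `e₃, e₄` are null
vector fields orthogonal to the surfaces with `g(e₃, e₄) = -2`. -/
structure IsAdaptedNullFrame (g : ChartMetric) (U R : Coord → ℝ) (p : Coord)
    (e₁ e₂ e₃ e₄ : Coord → Coord) : Prop where
  smooth₁ : ContDiffAt ℝ 1 e₁ p
  smooth₂ : ContDiffAt ℝ 1 e₂ p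
  smooth₃ : ContDiffAt ℝ 1 e₃ p
  smooth₄ : ContDiffAt ℝ 1 e₄ p
  differentiable : ∀ᶠ x in 𝓝 p, DifferentiableAt ℝ U x ∧ DifferentiableAt ℝ R x
  e₃_eq : ∀ᶠ x in 𝓝 p, ∀ v, g.inner x (e₃ x) v = -fderiv ℝ U x v
  tangent : ∀ᶠ x in 𝓝 p,
    fderiv ℝ U x (e₁ x) = 0 ∧ fderiv ℝ R x (e₁ x) = 0 ∧
    fderiv ℝ U x (e₂ x) = 0 ∧ fderiv ℝ R x (e₂ x) = 0
  orthonormal : ∀ᶠ x in 𝓝 p,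
    g.inner x (e₁ x) (e₁ x) = 1 ∧ g.inner x (e₂ x) (e₂ x) = 1 ∧ g.inner x (e₁ x) (e₂ x) = 0
  orthogonal : ∀ᶠ x in 𝓝 p,
    g.inner x (e₁ x) (e₃ x) = 0 ∧ g.inner x (e₁ x) (e₄ x) = 0 ∧
    g.inner x (e₂ x) (e₃ x) = 0 ∧ g.inner x (e₂ x) (e₄ x) = 0
  null : ∀ᶠ x in 𝓝 p,
    g.inner x (e₃ x) (e₃ x) = 0 ∧ g.inner x (e₄ x) (e₄ x) = 0 ∧ g.inner x (e₃ x) (e₄ x) = -2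

/-- The null expansion `∑ₐ g(D_{eₐ} L, eₐ)` at `p` of the vector field `L`. With `L = e₄` this is the
outgoing expansion `tr χ`, with `L = e₃` the incoming expansion `tr χ̲`. -/
def nullExpansion (g : ChartMetric) (e₁ e₂ L : Coord → Coord) (p : Coord) : ℝ :=
  g.innerCov L p (e₁ p) (e₁ p) + g.innerCov L p (e₂ p) (e₂ p)

/-- At `p`, the 2-surface `{U = U(p)} ∩ {R = R(p)}` has outgoing expansion `k` and incoming expansion
`kb`: an adapted null frame exists, and every adapted null frame gives these values. -/
def HasNullExpansions (g : ChartMetric) (U R : Coord → ℝ) (p : Coord) (k kb : ℝ) : Prop :=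
  (∃ e₁ e₂ e₃ e₄, IsAdaptedNullFrame g U R p e₁ e₂ e₃ e₄) ∧
  ∀ e₁ e₂ e₃ e₄, IsAdaptedNullFrame g U R p e₁ e₂ e₃ e₄ →
    nullExpansion g e₁ e₂ e₄ p = k ∧ nullExpansion g e₁ e₂ e₃ p = kb

/-! ## The Kerr metric -/

/-- `r₊ = m + √(m² - a²)`. -/
def rPlus (a m : ℝ) : ℝ := m + √(m ^ 2 - a ^ 2)

/-- `r₋ = m - √(m² - a²)`. -/
def rMinus (a m : ℝ) : ℝ := m - √(m ^ 2 - a ^ 2)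

/-- `Δ = r² - 2mr + a²`. -/
def kerrDelta (a m r : ℝ) : ℝ := r ^ 2 - 2 * m * r + a ^ 2

/-- `Σ(r, θ) = √((r² + a²)² - a² sin² θ Δ)`. -/
def kerrSigma (a m r θ : ℝ) : ℝ :=
  √((r ^ 2 + a ^ 2) ^ 2 - a ^ 2 * Real.sin θ ^ 2 * kerrDelta a m r)

/-- `|q|² = r² + a² cos² θ`. -/
def kerrQ (a r θ : ℝ) : ℝ := r ^ 2 + a ^ 2 * Real.cos θ ^ 2

/-- The Kerr metric in ingoing Eddington–Finkelstein coordinates `(u̲, r, θ, φ)`: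
`-(1 - 2mr/|q|²) du̲² + 2 dr du̲ - 2a sin²θ dr dφ - (4mra sin²θ/|q|²) du̲ dφ + |q|² dθ²
  + (Σ² sin²θ/|q|²) dφ²`.
These coordinates cover the spacetime except for the axis `θ ∈ {0, π}`, on both sides of the event
horizon `r = r₊`. -/
def kerrEF (a m : ℝ) : ChartMetric := fun x =>
  let r := x 1
  let θ := x 2
  let Q := kerrQ a r θ
  let s := Real.sin θ ^ 2
  !![-(1 - 2 * m * r / Q),     1,      0, -(2 * m * r * a * s / Q);
     1,                        0,      0, -(a * s);
     0,                        0,      Q, 0;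
     -(2 * m * r * a * s / Q), -(a * s), 0, kerrSigma a m r θ ^ 2 * s / Q]

/-- The same Kerr metric in the coordinates `(u̲, r, x, y)`, `x = sin θ cos φ`, `y = sin θ sin φ`,
`x² + y² < 1`, which are regular on the axis `x = y = 0`; the formula is the same for the two
hemispheres `θ < π/2` and `θ > π/2`. With `s = x² + y²`, `ω = x dy - y dx = sin²θ dφ` and
`|q|² = r² + a² (1 - s)` it reads
`-(1 - 2mr/|q|²) du̲² + 2 dr du̲ - 2a dr ω - (4mra/|q|²) du̲ ω
  + |q|² (dx² + dy² + (x dx + y dy)²/(1 - s)) + (a² (|q|² + 2mr)/|q|²) ω²`. -/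
def kerrAxis (a m : ℝ) : ChartMetric := fun z =>
  let r := z 1
  let x := z 2
  let y := z 3
  let s := x ^ 2 + y ^ 2
  let Q := r ^ 2 + a ^ 2 * (1 - s)
  let A := 2 * m * r * a / Q
  let B := a ^ 2 * (Q + 2 * m * r) / Q
  !![-(1 - 2 * m * r / Q), 1,        A * y,  -(A * x);
     1,                    0,        a * y,  -(a * x);
     A * y,                a * y,    Q * (1 + x ^ 2 / (1 - s)) + B * y ^ 2,
                                       Q * (x * y / (1 - s)) - B * (x * y);
     -(A * x),             -(a * x), Q * (x * y / (1 - s)) - B * (x * y),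
                                       Q * (1 + y ^ 2 / (1 - s)) + B * x ^ 2]

/-! ## The Pretorius–Israel optical function -/

/-- The function whose zero `τ` defines `θ_*`:
`∫_τ^θ dθ' / √(sin² τ - sin² θ') + sgn(r - r₊) ∫_{r₊}^r |a| dr' / Σ(r', τ)`
(multiplied by `|a|` so that the case `a = 0`, in which `θ_* = θ`, is included). -/
def piFun (a m r θ τ : ℝ) : ℝ :=
  (∫ t in τ..θ, 1 / √(Real.sin τ ^ 2 - Real.sin t ^ 2)) +
    Real.sign (r - rPlus a m) * ∫ s in (rPlus a m)..r, |a| / kerrSigma a m s τ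

/-- `θ_*(r, θ)` for `θ ∈ [0, π/2]`: for `0 < θ < π/2` the zero `τ ∈ [θ, π/2)` of `piFun`
(which exists and is unique for `r > r₋`), and `θ_* = θ` at `θ = 0` and `θ = π/2`. -/
def thetaStar (a m r θ : ℝ) : ℝ :=
  open Classical in
  if h : θ ∈ Ioo 0 (Real.pi / 2) ∧ ∃ τ ∈ Ico θ (Real.pi / 2), piFun a m r θ τ = 0
  then h.2.choose else θ

/-- `ρ(r, θ, τ) = ∫_r^{r₊} (r'² + a² - Σ')/Δ' dr' - sgn(r - r₊) ∫_τ^θ |a| √(sin² τ - sin² θ') dθ'`,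
where `Σ' = Σ(r', τ)` and `(r'² + a² - Σ')/Δ' = a² sin² τ / (r'² + a² + Σ')`. -/
def piRho (a m r θ τ : ℝ) : ℝ :=
  (∫ s in r..(rPlus a m), a ^ 2 * Real.sin τ ^ 2 / (s ^ 2 + a ^ 2 + kerrSigma a m s τ)) -
    Real.sign (r - rPlus a m) * ∫ t in τ..θ, |a| * √(Real.sin τ ^ 2 - Real.sin t ^ 2)

/-- `f_*(r, θ) = ρ(r, θ, θ_*(r, θ))` for `θ ∈ [0, π/2]`, extended to `[0, π]` by reflection in the
equatorial plane `θ ↦ π - θ`. -/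
def fStar (a m r θ : ℝ) : ℝ :=
  let ϑ := min θ (Real.pi - θ)
  piRho a m r ϑ (thetaStar a m r ϑ)

/-- `f(r)` with `f' = (r² + a²)/Δ`; `k` is the constant of integration. -/
def kerrTortoise (a m k r : ℝ) : ℝ :=
  r + 2 * m * rPlus a m / (rPlus a m - rMinus a m) * Real.log |r - rPlus a m|
    - 2 * m * rMinus a m / (rPlus a m - rMinus a m) * Real.log |r - rMinus a m| + k

/-- `r_*(r, θ) = f(r) + f_*(r, θ)`. -/
def rStar (a m k r θ : ℝ) : ℝ := kerrTortoise a m k r + fStar a m r θ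

/-- `κ = (r₊ - r₋) / (2 m r₊)`. -/
def kerrKappa (a m : ℝ) : ℝ := (rPlus a m - rMinus a m) / (2 * m * rPlus a m)

/-- `r̃ = r₊ + e^{κ r_*}`, where `e^{κ r_*}` carries the sign of `r - r₊`, so that
`r̃ = r₊ + g(r, θ) (r - r₊)` with `g > 0` regular across the horizon. -/
def rTilde (a m k r θ : ℝ) : ℝ :=
  rPlus a m + Real.sign (r - rPlus a m) * Real.exp (kerrKappa a m * rStar a m k r θ)

/-- The incoming optical function `ũ̲₀ = t + r_* = u̲ + f_*(r, θ)`. -/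
def ubZero (a m u r θ : ℝ) : ℝ := u + fStar a m r θ

/-- The polar angle `θ` in the axis coordinates `(u̲, r, x, y)` of the hemisphere `θ < π/2`. -/
def northTheta (z : Coord) : ℝ := Real.arcsin √(z 2 ^ 2 + z 3 ^ 2)

/-- The polar angle `θ` in the axis coordinates `(u̲, r, x, y)` of the hemisphere `θ > π/2`. -/
def southTheta (z : Coord) : ℝ := Real.pi - Real.arcsin √(z 2 ^ 2 + z 3 ^ 2)

/-- At every point of the Kerr spacetime with radius `r` and polar angle `θ ∈ [0, π]`, the 2-sphere
of constant `ũ̲₀` and constant `r̃` through that point has outgoing expansion `k` and incoming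
expansion `kb` there (with respect to the adapted null frame with `e₃ = -D ũ̲₀`). Off the axis this
is expressed in Eddington–Finkelstein coordinates, on the axis in the axis coordinates. -/
def KerrSphereExpansions (a m c r θ k kb : ℝ) : Prop :=
  ∀ u : ℝ,
    (θ ∈ Ioo 0 Real.pi → ∀ φ : ℝ,
      HasNullExpansions (kerrEF a m) (fun x => ubZero a m (x 0) (x 1) (x 2))
        (fun x => rTilde a m c (x 1) (x 2)) ![u, r, θ, φ] k kb) ∧
    (θ = 0 →
      HasNullExpansions (kerrAxis a m) (fun z => ubZero a m (z 0) (z 1) (northTheta z))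
        (fun z => rTilde a m c (z 1) (northTheta z)) ![u, r, 0, 0] k kb) ∧
    (θ = Real.pi →
      HasNullExpansions (kerrAxis a m) (fun z => ubZero a m (z 0) (z 1) (southTheta z))
        (fun z => rTilde a m c (z 1) (southTheta z)) ![u, r, 0, 0] k kb)

end

/-!
The spheres are described by the optical function `U = u̲ + f_*`, and everything rests on a
description of `f_*` that is regular at the axis, at the equator and at the horizon. The angle `θ_*`
is not a good unknown there. It is replaced by `W` with

  `sin² θ_* = κ(ς, W) = ς (1 + (1 - ς) W²)`, `ς = sin² θ`,

where `W` carries the sign of `r - r₊`. The substitution `sin² t = ς (1 + (1 - ς) W² (1 - w²))` turns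
the angular integrals into integrals over `[0, 1]` that are smooth in `(ς, W)` (`ellH`, `ellK`), and
the equation for `θ_*` becomes `H(ς, W) = h(r, κ(ς, W))` (`IsSol`), with `h(r, κ)` the radial
integral `∫_{r₊}^r |a| / Σ` (`radH`). Explicit bounds on the integrals give a solution
(`exists_isSol`) and show that the `W`-derivative `solW` of `H - h` is positive there. Hence the
solution is unique (`IsSol.unique`), and it is a `C¹` function of `(r, ς)` by the implicit function
theorem, also across the horizon.

In these variables `f_* = A(r, κ) + |a| K(ς, W)` (`fStar_eq`). The derivative of the right side with
respect to `W` at fixed `(r, ς)` is a multiple of `H - h`, so it vanishes, and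
`∂_r f_* = -a² κ / (r² + a² + Σ(r, θ_*))`, `∂_ς f_* = -|a| W / 2` are again `C¹` and satisfy the eikonal
equation (`IsSol.exists_localOptical`).

The null fields `L₃ = -D U` and `L₄` and tangent fields of the spheres can therefore be written down
explicitly as `C¹` vector fields. This determines the expansions, because an adapted frame is unique
up to a rotation of the tangent plane (`hasNullExpansions_of_fields`). Off the axis the
`(r, θ)`-components of both null fields are multiples `λ (r² + a² + Δ ∂_r f_*, ∂_θ f_*)` of one vector,
and in the expansion only the factor `λ` and not its derivatives enters (`kerrEF_expansion`):

  `tr χ = Δ B / Σ(r, θ)²`, `tr χ̲ = -B / |q|²`, `B = |q|² □ U`.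

On the axis the same fields, written in the coordinates `x`, `y`, give the same formulas. In
`B` (`expB`) the derivative `∂_r Σ(r, κ)` at `κ = sin² θ_*` dominates the other terms, so that `B > 0`
for `r ≥ m` (`IsSol.expB_pos`).

Finally `r̃ - r₊ = (r - r₊) E` with a positive continuous factor `E` (`rTilde_eq`), while
`Δ = (r - r₊) (r - r₋)`. So `tr χ = F (r̃ - r₊)` with `F = (r - r₋) B / (E Σ²)` (`expansionFactor`), and
the uniform bounds hold because `F` and `B / |q|²` are continuous and positive on the compact set
`[m, r₀] × [0, π]`.
-/

noncomputable section

namespace PretoriusIsrael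

/-! ### Integrals depending on parameters -/

/-- Differentiation under the integral sign: if the integrand is jointly `C¹` at every point of
`{p} × [a, b]`, then the integral is `C¹` at `p`. -/
theorem contDiffAt_integral_param {φ : ℝ × ℝ → ℝ → ℝ} {a b : ℝ} {p : ℝ × ℝ}
    (h : ∀ t ∈ uIcc a b, ContDiffAt ℝ 1 (Function.uncurry φ) (p, t)) :
    ContDiffAt ℝ 1 (fun q => ∫ t in a..b, φ q t) p ∧
      ∀ v, fderiv ℝ (fun q => ∫ t in a..b, φ q t) p v =
        ∫ t in a..b, fderiv ℝ (fun q => φ q t) p v := by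
  set S : Set ((ℝ × ℝ) × ℝ) := {z | ContDiffAt ℝ 1 (Function.uncurry φ) z} with hS
  have hSo : IsOpen S := by
    rw [isOpen_iff_mem_nhds]
    intro z hz
    exact ContDiffAt.eventually hz (by simp)
  -- by compactness of `[a, b]` the integrand is `C¹` on `u × v` with `u` a neighbourhood of `p`, so
  -- that its derivative is bounded on `closedBall p ε × [a, b]`
  obtain ⟨u, v, hu, hv, hpu, habv, huv⟩ := generalized_tube_lemma (s := {p}) (t := uIcc a b)
    isCompact_singleton isCompact_uIcc hSo (by
      rintro ⟨q, t⟩ ⟨hq, ht⟩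
      rw [mem_singleton_iff] at hq
      subst hq
      exact h t ht)
  obtain ⟨ε, hε, hball⟩ := Metric.nhds_basis_closedBall.mem_iff.1 (hu.mem_nhds (hpu rfl))
  set D : ℝ × ℝ → ℝ → (ℝ × ℝ →L[ℝ] ℝ) := fun q t =>
    (fderiv ℝ (Function.uncurry φ) (q, t)).comp (ContinuousLinearMap.inl ℝ (ℝ × ℝ) ℝ) with hD
  have hDc : ContinuousOn (Function.uncurry D) S := by
    intro z hz
    have hz' : ContDiffAt ℝ 1 (Function.uncurry φ) z := hz
    have h1 : ContinuousAt (fderiv ℝ (Function.uncurry φ)) z :=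
      (hz'.fderiv_right (m := 0) (by simp)).continuousAt
    have : ContinuousAt (Function.uncurry D) z :=
      (h1.clm_comp continuousAt_const)
    exact this.continuousWithinAt
  have hφc : ContinuousOn (Function.uncurry φ) S := fun z hz =>
    (show ContDiffAt ℝ 1 (Function.uncurry φ) z from hz).continuousAt.continuousWithinAt
  have hKS : Metric.closedBall p ε ×ˢ uIcc a b ⊆ S := fun z hz => huv ⟨hball hz.1, habv hz.2⟩
  have hder : ∀ q ∈ Metric.closedBall p ε, ∀ t ∈ uIcc a b,
      HasFDerivAt (fun q => φ q t) (D q t) q := by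
    intro q hq t ht
    have h1 : HasFDerivAt (Function.uncurry φ) (fderiv ℝ (Function.uncurry φ) (q, t)) (q, t) :=
      ((show ContDiffAt ℝ 1 (Function.uncurry φ) (q, t) from hKS ⟨hq, ht⟩).differentiableAt
        one_ne_zero).hasFDerivAt
    have h2 : HasFDerivAt (fun q : ℝ × ℝ => (q, t)) (ContinuousLinearMap.inl ℝ (ℝ × ℝ) ℝ) q :=
      hasFDerivAt_prodMk_left q t
    exact h1.comp q h2
  obtain ⟨B, hB⟩ := ((isCompact_closedBall p ε).prod (isCompact_uIcc (a := a) (b := b))).exists_bound_of_continuousOn (hDc.mono hKS)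
  have hφt : ∀ q ∈ Metric.closedBall p ε, ContinuousOn (φ q) (uIcc a b) := by
    intro q hq
    exact hφc.comp (f := fun t => (q, t)) (by fun_prop) (fun t ht => hKS ⟨hq, ht⟩)
  have hDt : ∀ q ∈ Metric.closedBall p ε, ContinuousOn (D q) (uIcc a b) := by
    intro q hq
    exact hDc.comp (f := fun t => (q, t)) (by fun_prop) (fun t ht => hKS ⟨hq, ht⟩)
  have hF : ∀ q ∈ Metric.ball p ε,
      HasFDerivAt (fun q => ∫ t in a..b, φ q t) (∫ t in a..b, D q t) q := by
    intro q hq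
    have hqn : Metric.ball p ε ∈ 𝓝 q := Metric.isOpen_ball.mem_nhds hq
    refine intervalIntegral.hasFDerivAt_integral_of_dominated_of_fderiv_le
      (μ := MeasureTheory.volume) (F := φ) (F' := D) (bound := fun _ => B) hqn ?_ ?_ ?_ ?_ ?_ ?_
    · filter_upwards [hqn] with y hy
      exact ((hφt y (Metric.ball_subset_closedBall hy)).mono
        uIoc_subset_uIcc).aestronglyMeasurable measurableSet_uIoc
    · exact (hφt q (Metric.ball_subset_closedBall hq)).intervalIntegrable
    · exact ((hDt q (Metric.ball_subset_closedBall hq)).mono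
        uIoc_subset_uIcc).aestronglyMeasurable measurableSet_uIoc
    · refine Eventually.of_forall fun t ht y hy => ?_
      exact hB (y, t) ⟨Metric.ball_subset_closedBall hy, uIoc_subset_uIcc ht⟩
    · exact intervalIntegrable_const
    · refine Eventually.of_forall fun t ht y hy => ?_
      exact hder y (Metric.ball_subset_closedBall hy) t (uIoc_subset_uIcc ht)
  have hpb : p ∈ Metric.ball p ε := Metric.mem_ball_self hε
  refine ⟨?_, fun v => ?_⟩
  · rw [contDiffAt_one_iff]
    refine ⟨fun q => ∫ t in a..b, D q t, Metric.ball p ε, Metric.isOpen_ball.mem_nhds hpb, ?_, hF⟩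
    intro q hq
    refine ContinuousAt.continuousWithinAt ?_
    have hqn : Metric.ball p ε ∈ 𝓝 q := Metric.isOpen_ball.mem_nhds hq
    refine intervalIntegral.continuousAt_of_dominated_interval (bound := fun _ => B) ?_ ?_ ?_ ?_
    · filter_upwards [hqn] with y hy
      exact ((hDt y (Metric.ball_subset_closedBall hy)).mono
        uIoc_subset_uIcc).aestronglyMeasurable measurableSet_uIoc
    · filter_upwards [hqn] with y hy
      refine Eventually.of_forall fun t ht => ?_
      exact hB (y, t) ⟨Metric.ball_subset_closedBall hy, uIoc_subset_uIcc ht⟩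
    · exact intervalIntegrable_const
    · refine Eventually.of_forall fun t ht => ?_
      have hz : (q, t) ∈ S := hKS ⟨Metric.ball_subset_closedBall hq, uIoc_subset_uIcc ht⟩
      have h1 : ContinuousAt (Function.uncurry D) (q, t) := hDc.continuousAt (hSo.mem_nhds hz)
      exact ContinuousAt.comp (f := fun y : ℝ × ℝ => (y, t)) (g := Function.uncurry D) h1
        (by fun_prop)
  · rw [(hF p hpb).fderiv]
    have hint : IntervalIntegrable (D p) MeasureTheory.volume a b :=
      (hDt p (Metric.ball_subset_closedBall hpb)).intervalIntegrable
    rw [ContinuousLinearMap.intervalIntegral_apply hint]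
    refine intervalIntegral.integral_congr fun t ht => ?_
    simp only [(hder p (Metric.ball_subset_closedBall hpb) t ht).fderiv]

/-- The linear form `(x, y) ↦ a x + b y`: the derivative of a function of two variables whose
partial derivatives are `a` and `b`. -/
def linForm (a b : ℝ) : ℝ × ℝ →L[ℝ] ℝ :=
  a • ContinuousLinearMap.fst ℝ ℝ ℝ + b • ContinuousLinearMap.snd ℝ ℝ ℝ

@[simp] theorem linForm_apply (a b : ℝ) (v : ℝ × ℝ) : linForm a b v = a * v.1 + b * v.2 := by
  simp [linForm]

theorem fderiv_eq_of_slice_fst {f : ℝ × ℝ → ℝ} {x y d : ℝ} (hf : DifferentiableAt ℝ f (x, y))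
    (h : HasDerivAt (fun s => f (s, y)) d x) : fderiv ℝ f (x, y) (1, 0) = d :=
  (hf.hasFDerivAt.comp_hasDerivAt x
    ((hasDerivAt_id x).prodMk (hasDerivAt_const x y))).unique h

theorem fderiv_eq_of_slice_snd {f : ℝ × ℝ → ℝ} {x y d : ℝ} (hf : DifferentiableAt ℝ f (x, y))
    (h : HasDerivAt (fun s => f (x, s)) d y) : fderiv ℝ f (x, y) (0, 1) = d :=
  (hf.hasFDerivAt.comp_hasDerivAt y
    ((hasDerivAt_const y x).prodMk (hasDerivAt_id y))).unique h

theorem hasFDerivAt_linForm {f : ℝ × ℝ → ℝ} {p : ℝ × ℝ} {a b : ℝ} (hf : DifferentiableAt ℝ f p)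
    (ha : fderiv ℝ f p (1, 0) = a) (hb : fderiv ℝ f p (0, 1) = b) :
    HasFDerivAt f (linForm a b) p := by
  refine hf.hasFDerivAt.congr_fderiv ?_
  ext <;> simp [ha, hb]

/-! ### The elliptic integrals of the angular motion -/

/-- The polynomial `(1 - ς W² (1 - w²)) (1 + (1 - ς) W² (1 - w²))` under the square root of the
angular elliptic integrals, after the substitution `sin² t = ς (1 + (1 - ς) W² (1 - w²))`. -/
def ellPoly (ς W w : ℝ) : ℝ :=
  (1 - ς * W ^ 2 * (1 - w ^ 2)) * (1 + (1 - ς) * W ^ 2 * (1 - w ^ 2))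

/-- The angular integral `∫_θ^τ dt / √(sin² τ - sin² t)` as a function of `ς = sin² θ` and of the
variable `W ≥ 0` with `sin² τ = ς (1 + (1 - ς) W²)`. The formula makes sense for `W < 0` too, where
it is minus the integral, and it is regular at the axis `ς = 0`, at the equator `ς = 1` and at
`W = 0`. -/
def ellH (q : ℝ × ℝ) : ℝ := ∫ w in (0 : ℝ)..1, q.2 / √(ellPoly q.1 q.2 w)

/-- The angular integral `∫_θ^τ √(sin² τ - sin² t) dt` in the variables of `ellH`; odd in `W`. -/
def ellK (q : ℝ × ℝ) : ℝ :=
  ∫ w in (0 : ℝ)..1, q.1 * (1 - q.1) * q.2 ^ 3 * w ^ 2 / √(ellPoly q.1 q.2 w)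

/-- The `ς`-derivative of `ellH`. -/
def ellHς (ς W : ℝ) : ℝ := ∫ w in (0 : ℝ)..1,
  W ^ 3 * (1 - w ^ 2) * (1 + (1 / 2 - ς) * W ^ 2 * (1 - w ^ 2)) /
    (ellPoly ς W w * √(ellPoly ς W w))

/-- The `W`-derivative of `ellH`. -/
def ellHW (ς W : ℝ) : ℝ := ∫ w in (0 : ℝ)..1,
  (1 + ς * (1 - ς) * W ^ 4 * (1 - w ^ 2) ^ 2) / (ellPoly ς W w * √(ellPoly ς W w))

/-- The parameters for which the polynomial `ellPoly` is positive on `[0, 1]`. -/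
def ellDom : Set (ℝ × ℝ) := {q | q.1 * q.2 ^ 2 < 1 ∧ (q.1 - 1) * q.2 ^ 2 < 1}

theorem isOpen_ellDom : IsOpen ellDom := by
  have h1 : IsOpen {q : ℝ × ℝ | q.1 * q.2 ^ 2 < 1} := isOpen_lt (by fun_prop) (by fun_prop)
  have h2 : IsOpen {q : ℝ × ℝ | (q.1 - 1) * q.2 ^ 2 < 1} := isOpen_lt (by fun_prop) (by fun_prop)
  exact h1.inter h2

theorem ellPoly_pos {ς W w : ℝ} (h : (ς, W) ∈ ellDom) (hw : w ∈ Icc (0 : ℝ) 1) :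
    0 < ellPoly ς W w := by
  obtain ⟨h1, h2⟩ := h
  simp only at h1 h2
  have h0 : 0 ≤ 1 - w ^ 2 := by nlinarith [hw.1, hw.2]
  have h3 : 1 - w ^ 2 ≤ 1 := by nlinarith [sq_nonneg w]
  apply mul_pos
  · rcases le_or_gt 0 (ς * W ^ 2) with h | h <;> nlinarith
  · rcases le_or_gt 0 ((ς - 1) * W ^ 2) with h | h <;> nlinarith

theorem contDiffAt_ellPoly {z : (ℝ × ℝ) × ℝ} :
    ContDiffAt ℝ 1 (fun z : (ℝ × ℝ) × ℝ => ellPoly z.1.1 z.1.2 z.2) z := by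
  unfold ellPoly; fun_prop

theorem continuous_ellPoly (ς W : ℝ) : Continuous (ellPoly ς W) := by unfold ellPoly; fun_prop

theorem contDiffAt_ellH_kernel {p : ℝ × ℝ} (hp : p ∈ ellDom) {t : ℝ} (ht : t ∈ uIcc (0 : ℝ) 1) :
    ContDiffAt ℝ 1
      (Function.uncurry fun (q : ℝ × ℝ) (w : ℝ) => q.2 / √(ellPoly q.1 q.2 w)) (p, t) := by
  rw [uIcc_of_le zero_le_one] at ht
  have h0 : ellPoly p.1 p.2 t ≠ 0 := (ellPoly_pos hp ht).ne'
  refine ContDiffAt.div (by fun_prop) (contDiffAt_ellPoly.sqrt h0) ?_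
  exact (Real.sqrt_pos.2 (ellPoly_pos hp ht)).ne'

theorem contDiffAt_ellK_kernel {p : ℝ × ℝ} (hp : p ∈ ellDom) {t : ℝ} (ht : t ∈ uIcc (0 : ℝ) 1) :
    ContDiffAt ℝ 1
      (Function.uncurry fun (q : ℝ × ℝ) (w : ℝ) =>
        q.1 * (1 - q.1) * q.2 ^ 3 * w ^ 2 / √(ellPoly q.1 q.2 w)) (p, t) := by
  rw [uIcc_of_le zero_le_one] at ht
  have h0 : ellPoly p.1 p.2 t ≠ 0 := (ellPoly_pos hp ht).ne'
  refine ContDiffAt.div (by fun_prop) (contDiffAt_ellPoly.sqrt h0) ?_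
  exact (Real.sqrt_pos.2 (ellPoly_pos hp ht)).ne'

theorem contDiffAt_ellH {p : ℝ × ℝ} (hp : p ∈ ellDom) : ContDiffAt ℝ 1 ellH p :=
  (contDiffAt_integral_param fun _ ht => contDiffAt_ellH_kernel hp ht).1

theorem hasDerivAt_ellPoly_ς (ς W w : ℝ) : HasDerivAt (fun s => ellPoly s W w)
    (-(2 * (W ^ 2 * (1 - w ^ 2)) + (1 - 2 * ς) * (W ^ 2 * (1 - w ^ 2)) ^ 2)) ς := by
  unfold ellPoly
  have h := (((hasDerivAt_id ς).mul_const (W ^ 2)).mul_const (1 - w ^ 2)).const_sub 1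
  have h' := (((((hasDerivAt_id ς).const_sub 1).mul_const (W ^ 2)).mul_const (1 - w ^ 2)).const_add 1)
  refine (h.mul h').congr_deriv ?_
  simp only [id]; ring

theorem hasDerivAt_ellPoly_W (ς W w : ℝ) : HasDerivAt (fun s => ellPoly ς s w)
    (2 * W * (1 - w ^ 2) * ((1 - 2 * ς) - 2 * (ς * (1 - ς)) * (W ^ 2 * (1 - w ^ 2)))) W := by
  unfold ellPoly
  have h := (((hasDerivAt_pow 2 W).const_mul ς).mul_const (1 - w ^ 2)).const_sub 1
  have h' := ((((hasDerivAt_pow 2 W).const_mul (1 - ς)).mul_const (1 - w ^ 2)).const_add 1)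
  refine (h.mul h').congr_deriv ?_
  push_cast; ring

theorem hasDerivAt_ellPoly_w (ς W w : ℝ) : HasDerivAt (fun s => ellPoly ς W s)
    (-(2 * w * W ^ 2) * ((1 - 2 * ς) - 2 * (ς * (1 - ς)) * (W ^ 2 * (1 - w ^ 2)))) w := by
  unfold ellPoly
  have h := ((((hasDerivAt_pow 2 w).const_sub 1).const_mul (ς * W ^ 2))).const_sub 1
  have h' := ((((hasDerivAt_pow 2 w).const_sub 1).const_mul ((1 - ς) * W ^ 2))).const_add 1
  refine (h.mul h').congr_deriv ?_
  push_cast; ring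

theorem hasFDerivAt_ellH {ς W : ℝ} (hp : (ς, W) ∈ ellDom) :
    HasFDerivAt ellH (linForm (ellHς ς W) (ellHW ς W)) (ς, W) := by
  have key := contDiffAt_integral_param fun _ ht => contDiffAt_ellH_kernel hp ht
  refine hasFDerivAt_linForm (key.1.differentiableAt one_ne_zero) ?_ ?_
  · refine (key.2 (1, 0)).trans (intervalIntegral.integral_congr fun t ht => ?_)
    have hd : DifferentiableAt ℝ (fun q : ℝ × ℝ => q.2 / √(ellPoly q.1 q.2 t)) (ς, W) :=
      ((contDiffAt_ellH_kernel hp ht).comp (ς, W) (f := fun q : ℝ × ℝ => (q, t))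
        (by fun_prop)).differentiableAt one_ne_zero
    refine fderiv_eq_of_slice_fst hd ?_
    rw [uIcc_of_le zero_le_one] at ht
    have h0 := ellPoly_pos hp ht
    have hs := Real.sqrt_pos.2 h0
    have hsq := Real.sq_sqrt h0.le
    refine ((hasDerivAt_const ς W).div ((hasDerivAt_ellPoly_ς ς W t).sqrt h0.ne')
      hs.ne').congr_deriv ?_
    rw [hsq]
    field_simp
    ring
  · refine (key.2 (0, 1)).trans (intervalIntegral.integral_congr fun t ht => ?_)
    have hd : DifferentiableAt ℝ (fun q : ℝ × ℝ => q.2 / √(ellPoly q.1 q.2 t)) (ς, W) :=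
      ((contDiffAt_ellH_kernel hp ht).comp (ς, W) (f := fun q : ℝ × ℝ => (q, t))
        (by fun_prop)).differentiableAt one_ne_zero
    refine fderiv_eq_of_slice_snd hd ?_
    rw [uIcc_of_le zero_le_one] at ht
    have h0 := ellPoly_pos hp ht
    have hs := Real.sqrt_pos.2 h0
    have hsq := Real.sq_sqrt h0.le
    refine ((hasDerivAt_id W).div ((hasDerivAt_ellPoly_W ς W t).sqrt h0.ne')
      hs.ne').congr_deriv ?_
    simp only [id]
    field_simp
    rw [hsq]
    unfold ellPoly
    ring

theorem intervalIntegrable_ellH {ς W : ℝ} (hp : (ς, W) ∈ ellDom) :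
    IntervalIntegrable (fun w => W / √(ellPoly ς W w)) MeasureTheory.volume 0 1 := by
  refine ContinuousOn.intervalIntegrable fun w hw => ?_
  rw [uIcc_of_le zero_le_one] at hw
  exact ContinuousWithinAt.div continuousWithinAt_const
    (continuous_ellPoly ς W).sqrt.continuousWithinAt (Real.sqrt_pos.2 (ellPoly_pos hp hw)).ne'

theorem intervalIntegrable_div_ellPoly {ς W : ℝ} (hp : (ς, W) ∈ ellDom) {f : ℝ → ℝ}
    (hf : Continuous f) : IntervalIntegrable
      (fun t => f t / (ellPoly ς W t * √(ellPoly ς W t))) MeasureTheory.volume 0 1 := by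
  refine ContinuousOn.intervalIntegrable fun w hw => ?_
  rw [uIcc_of_le zero_le_one] at hw
  have h0 := ellPoly_pos hp hw
  exact ContinuousWithinAt.div hf.continuousWithinAt
    (((continuous_ellPoly ς W).mul (continuous_ellPoly ς W).sqrt).continuousWithinAt)
    (mul_pos h0 (Real.sqrt_pos.2 h0)).ne'

/-- `∂K/∂W = ς (1 - ς) W H` and `∂K/∂ς = ((1 + (1 - 2 ς) W²) H - W) / 2`: in both cases the
difference of the integrands is the derivative in `w` of an explicit function. -/
theorem hasFDerivAt_ellK {ς W : ℝ} (hp : (ς, W) ∈ ellDom) :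
    HasFDerivAt ellK (linForm (((1 + (1 - 2 * ς) * W ^ 2) * ellH (ς, W) - W) / 2)
      (ς * (1 - ς) * W * ellH (ς, W))) (ς, W) := by
  have key := contDiffAt_integral_param fun _ ht => contDiffAt_ellK_kernel hp ht
  have hint := intervalIntegrable_ellH hp
  have hder : ∀ t ∈ uIcc (0 : ℝ) 1, DifferentiableAt ℝ (fun q : ℝ × ℝ =>
      q.1 * (1 - q.1) * q.2 ^ 3 * t ^ 2 / √(ellPoly q.1 q.2 t)) (ς, W) := fun t ht =>
    ((contDiffAt_ellK_kernel hp ht).comp (ς, W) (f := fun q : ℝ × ℝ => (q, t))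
        (by fun_prop)).differentiableAt one_ne_zero
  refine hasFDerivAt_linForm (key.1.differentiableAt one_ne_zero) ?_ ?_
  · set f : ℝ → ℝ := fun t => (1 - 2 * ς) * W ^ 3 * t ^ 2 * ellPoly ς W t
        + ς * (1 - ς) * W ^ 3 * t ^ 2 *
          (2 * (W ^ 2 * (1 - t ^ 2)) + (1 - 2 * ς) * (W ^ 2 * (1 - t ^ 2)) ^ 2) / 2 with hf
    have h1 : fderiv ℝ ellK (ς, W) (1, 0) =
        ∫ t in (0 : ℝ)..1, f t / (ellPoly ς W t * √(ellPoly ς W t)) := by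
      refine (key.2 (1, 0)).trans (intervalIntegral.integral_congr fun t ht => ?_)
      refine fderiv_eq_of_slice_fst (hder t ht) ?_
      rw [uIcc_of_le zero_le_one] at ht
      have h0 := ellPoly_pos hp ht
      have hs := Real.sqrt_pos.2 h0
      have hsq := Real.sq_sqrt h0.le
      have hn : HasDerivAt (fun s => s * (1 - s) * W ^ 3 * t ^ 2)
          ((1 - 2 * ς) * W ^ 3 * t ^ 2) ς := by
        refine ((((hasDerivAt_id ς).mul ((hasDerivAt_id ς).const_sub 1)).mul_const
          (W ^ 3)).mul_const (t ^ 2)).congr_deriv ?_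
        simp only [id]; ring
      refine (hn.div ((hasDerivAt_ellPoly_ς ς W t).sqrt h0.ne') hs.ne').congr_deriv ?_
      simp only [hf]
      field_simp
      rw [hsq]
      ring
    have hfc : Continuous f := by
      have := continuous_ellPoly ς W
      fun_prop
    have h2 : (∫ t in (0 : ℝ)..1, f t / (ellPoly ς W t * √(ellPoly ς W t))) -
        ∫ t in (0 : ℝ)..1, (1 + (1 - 2 * ς) * W ^ 2) / 2 * (W / √(ellPoly ς W t)) = -W / 2 := by
      rw [← intervalIntegral.integral_sub (intervalIntegrable_div_ellPoly hp hfc) (hint.const_mul _)]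
      have hG : ∀ t ∈ uIcc (0 : ℝ) 1, HasDerivAt
          (fun t => -(W * (t * (1 + (1 - 2 * ς) * (W ^ 2 * (1 - t ^ 2)))) / √(ellPoly ς W t)) / 2)
          (f t / (ellPoly ς W t * √(ellPoly ς W t)) -
            (1 + (1 - 2 * ς) * W ^ 2) / 2 * (W / √(ellPoly ς W t))) t := by
        intro t ht
        rw [uIcc_of_le zero_le_one] at ht
        have h0 := ellPoly_pos hp ht
        have hs := Real.sqrt_pos.2 h0
        have hsq := Real.sq_sqrt h0.le
        have hn : HasDerivAt (fun t => W * (t * (1 + (1 - 2 * ς) * (W ^ 2 * (1 - t ^ 2)))))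
            (W * ((1 + (1 - 2 * ς) * (W ^ 2 * (1 - t ^ 2))) +
              t * ((1 - 2 * ς) * (W ^ 2 * (-(2 * t)))))) t := by
          refine (((hasDerivAt_id t).mul (((((hasDerivAt_pow 2 t).const_sub 1).const_mul
            (W ^ 2)).const_mul (1 - 2 * ς)).const_add 1)).const_mul W).congr_deriv ?_
          simp only [id]; push_cast; ring
        refine ((hn.div ((hasDerivAt_ellPoly_w ς W t).sqrt h0.ne') hs.ne').neg.div_const
          2).congr_deriv ?_
        simp only [hf]
        field_simp
        rw [hsq]
        unfold ellPoly
        ring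
      rw [intervalIntegral.integral_eq_sub_of_hasDerivAt hG
        ((intervalIntegrable_div_ellPoly hp hfc).sub (hint.const_mul _))]
      simp [ellPoly]
    rw [intervalIntegral.integral_const_mul] at h2
    rw [h1]
    change _ - _ * ellH (ς, W) = _ at h2
    linarith
  · set f : ℝ → ℝ := fun t => 3 * ς * (1 - ς) * W ^ 2 * t ^ 2 * ellPoly ς W t
        - ς * (1 - ς) * W ^ 3 * t ^ 2 *
          (W * (1 - t ^ 2) * ((1 - 2 * ς) - 2 * (ς * (1 - ς)) * (W ^ 2 * (1 - t ^ 2)))) with hf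
    have h1 : fderiv ℝ ellK (ς, W) (0, 1) =
        ∫ t in (0 : ℝ)..1, f t / (ellPoly ς W t * √(ellPoly ς W t)) := by
      refine (key.2 (0, 1)).trans (intervalIntegral.integral_congr fun t ht => ?_)
      refine fderiv_eq_of_slice_snd (hder t ht) ?_
      rw [uIcc_of_le zero_le_one] at ht
      have h0 := ellPoly_pos hp ht
      have hs := Real.sqrt_pos.2 h0
      have hsq := Real.sq_sqrt h0.le
      refine ((((hasDerivAt_pow 3 W).const_mul (ς * (1 - ς))).mul_const
        _).div ((hasDerivAt_ellPoly_W ς W t).sqrt h0.ne') hs.ne').congr_deriv ?_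
      simp only [hf]
      field_simp
      rw [hsq]
      push_cast
      ring
    have hfc : Continuous f := by
      have := continuous_ellPoly ς W
      fun_prop
    have h2 : (∫ t in (0 : ℝ)..1, f t / (ellPoly ς W t * √(ellPoly ς W t))) -
        ∫ t in (0 : ℝ)..1, ς * (1 - ς) * W * (W / √(ellPoly ς W t)) = 0 := by
      rw [← intervalIntegral.integral_sub (intervalIntegrable_div_ellPoly hp hfc) (hint.const_mul _)]
      have hG : ∀ t ∈ uIcc (0 : ℝ) 1, HasDerivAt
          (fun t => -(ς * (1 - ς) * W ^ 2 * (t * (1 - t ^ 2)) / √(ellPoly ς W t)))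
          (f t / (ellPoly ς W t * √(ellPoly ς W t)) -
            ς * (1 - ς) * W * (W / √(ellPoly ς W t))) t := by
        intro t ht
        rw [uIcc_of_le zero_le_one] at ht
        have h0 := ellPoly_pos hp ht
        have hs := Real.sqrt_pos.2 h0
        have hsq := Real.sq_sqrt h0.le
        have hn : HasDerivAt (fun t => ς * (1 - ς) * W ^ 2 * (t * (1 - t ^ 2)))
            (ς * (1 - ς) * W ^ 2 * ((1 - t ^ 2) + t * (-(2 * t)))) t := by
          refine (((hasDerivAt_id t).mul ((hasDerivAt_pow 2 t).const_sub 1)).const_mul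
            (ς * (1 - ς) * W ^ 2)).congr_deriv ?_
          simp only [id]; push_cast; ring
        refine ((hn.div ((hasDerivAt_ellPoly_w ς W t).sqrt h0.ne') hs.ne').neg).congr_deriv ?_
        simp only [hf]
        field_simp
        rw [hsq]
        unfold ellPoly
        ring
      rw [intervalIntegral.integral_eq_sub_of_hasDerivAt hG
        ((intervalIntegrable_div_ellPoly hp hfc).sub (hint.const_mul _))]
      simp
    rw [intervalIntegral.integral_const_mul] at h2
    rw [h1]
    change _ - _ * ellH (ς, W) = _ at h2
    linarith

/-! ### The integrals of the radial motion -/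

/-- `Σ(r, θ)²` as a function of `r` and `κ = sin² θ`. -/
def radPoly (a m r κ : ℝ) : ℝ := (r ^ 2 + a ^ 2) ^ 2 - a ^ 2 * κ * kerrDelta a m r

/-- `Σ(r, θ)` as a function of `r` and `κ = sin² θ`. -/
def radS (a m r κ : ℝ) : ℝ := √(radPoly a m r κ)

/-- The radial integral `∫_{r₊}^r |a| ds / Σ(s, κ)`. -/
def radH (a m : ℝ) (q : ℝ × ℝ) : ℝ := ∫ s in (rPlus a m)..q.1, |a| / radS a m s q.2

/-- The radial part `∫_r^{r₊} (s² + a² - Σ(s, κ)) / Δ(s) ds` of `f_*`, with the integrand written as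
`a² κ / (s² + a² + Σ)`, which is regular at the zeros of `Δ`. -/
def radA (a m : ℝ) (q : ℝ × ℝ) : ℝ :=
  ∫ s in q.1..(rPlus a m), a ^ 2 * q.2 / (s ^ 2 + a ^ 2 + radS a m s q.2)

/-- The `κ`-derivative of `radH`. -/
def radHκ (a m r κ : ℝ) : ℝ := ∫ s in (rPlus a m)..r,
  |a| * (a ^ 2 * kerrDelta a m s) / (2 * (radPoly a m s κ * radS a m s κ))

/-- The pairs `(r, κ)` for which `radPoly` is positive between the horizon and `r`. -/
def radDom (a m : ℝ) : Set (ℝ × ℝ) :=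
  {q | ∀ t ∈ Icc (0 : ℝ) 1, 0 < radPoly a m (rPlus a m + (q.1 - rPlus a m) * t) q.2}

theorem kerrSigma_eq (a m r θ : ℝ) : kerrSigma a m r θ = radS a m r (Real.sin θ ^ 2) := rfl

theorem contDiff_radPoly (a m : ℝ) :
    ContDiff ℝ 1 (fun q : ℝ × ℝ => radPoly a m q.1 q.2) := by
  unfold radPoly kerrDelta; fun_prop

theorem continuous_radPoly (a m κ : ℝ) : Continuous (fun s => radPoly a m s κ) := by
  unfold radPoly kerrDelta; fun_prop

theorem isOpen_radDom (a m : ℝ) : IsOpen (radDom a m) := by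
  rw [isOpen_iff_mem_nhds]
  intro q hq
  refine isCompact_Icc.eventually_forall_of_forall_eventually
    (P := fun (x : ℝ × ℝ) (t : ℝ) => 0 < radPoly a m (rPlus a m + (x.1 - rPlus a m) * t) x.2)
    fun t ht => ?_
  have hc : Continuous fun z : (ℝ × ℝ) × ℝ =>
      radPoly a m (rPlus a m + (z.1.1 - rPlus a m) * z.2) z.1.2 := by
    unfold radPoly kerrDelta; fun_prop
  exact hc.continuousAt.eventually (lt_mem_nhds (hq t ht))

theorem radPoly_pos_of_mem_radDom {a m r κ s : ℝ} (h : (r, κ) ∈ radDom a m)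
    (hs : s ∈ uIcc (rPlus a m) r) : 0 < radPoly a m s κ := by
  rw [← segment_eq_uIcc, segment_eq_image'] at hs
  obtain ⟨t, ht, rfl⟩ := hs
  have := h t ht
  simpa [mul_comm] using this

/-- `Σ²` is a convex combination of its values at `κ = 0` and `κ = 1`, which are positive for every
`r > 0`; no sign of `Δ` is needed. -/
theorem radPoly_pos {a m r κ : ℝ} (hm : 0 < m) (hr : 0 < r) (hκ : κ ∈ Icc (0 : ℝ) 1) :
    0 < radPoly a m r κ := by
  have h1 : radPoly a m r κ = (1 - κ) * (r ^ 2 + a ^ 2) ^ 2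
      + κ * (r ^ 4 + a ^ 2 * r ^ 2 + 2 * m * a ^ 2 * r) := by
    unfold radPoly kerrDelta; ring
  have h2 : 0 < r ^ 4 := by positivity
  have h3 : r ^ 4 ≤ (r ^ 2 + a ^ 2) ^ 2 := by nlinarith [sq_nonneg a, sq_nonneg r]
  have h4 : 0 ≤ a ^ 2 * r ^ 2 + 2 * m * a ^ 2 * r := by positivity
  rw [h1]
  nlinarith [hκ.1, hκ.2, mul_nonneg hκ.1 h4, mul_nonneg (sub_nonneg.2 hκ.2) (sub_nonneg.2 h3)]

theorem rPlus_pos {a m : ℝ} (ham : |a| < m) : 0 < rPlus a m := by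
  have : 0 < m := (abs_nonneg a).trans_lt ham
  unfold rPlus; positivity

theorem mem_radDom {a m r κ : ℝ} (ham : |a| < m) (hr : 0 < r) (hκ : κ ∈ Icc (0 : ℝ) 1) :
    (r, κ) ∈ radDom a m := by
  intro t ht
  refine radPoly_pos ((abs_nonneg a).trans_lt ham) ?_ hκ
  have h1 := rPlus_pos ham
  have : rPlus a m + (r - rPlus a m) * t = (1 - t) * rPlus a m + t * r := by ring
  simp only [this]
  rcases ht.1.eq_or_lt with h | h
  · subst h; simpa using h1
  · have := mul_pos h hr
    have := mul_nonneg (sub_nonneg.2 ht.2) h1.le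
    linarith

theorem hasDerivAt_radPoly_κ (a m s κ : ℝ) :
    HasDerivAt (fun κ => radPoly a m s κ) (-(a ^ 2 * kerrDelta a m s)) κ := by
  unfold radPoly
  refine ((((hasDerivAt_id κ).const_mul (a ^ 2)).mul_const _).const_sub _).congr_deriv ?_
  ring

theorem contDiffAt_radS {a m : ℝ} {q : ℝ × ℝ} (h : 0 < radPoly a m q.1 q.2) :
    ContDiffAt ℝ 1 (fun q : ℝ × ℝ => radS a m q.1 q.2) q :=
  (contDiff_radPoly a m).contDiffAt.sqrt h.ne'

theorem radS_pos {a m r κ : ℝ} (h : 0 < radPoly a m r κ) : 0 < radS a m r κ := Real.sqrt_pos.2 h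

theorem radS_sq {a m r κ : ℝ} (h : 0 < radPoly a m r κ) : radS a m r κ ^ 2 = radPoly a m r κ :=
  Real.sq_sqrt h.le

theorem continuousAt_radS (a m s κ : ℝ) : ContinuousAt (fun s => radS a m s κ) s :=
  (continuous_radPoly a m κ).sqrt.continuousAt

/-- A function of `(s, κ)` that is `C¹` where `radPoly` is positive has a `C¹` integral
`∫_{r₊}^r g(s, κ) ds`, whose derivatives are the expected ones. -/
theorem contDiffAt_integral_rad {a m : ℝ} {g : ℝ × ℝ → ℝ}
    (hg : ∀ q : ℝ × ℝ, 0 < radPoly a m q.1 q.2 → ContDiffAt ℝ 1 g q) {r κ : ℝ}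
    (hq : (r, κ) ∈ radDom a m) :
    ContDiffAt ℝ 1 (fun q : ℝ × ℝ => ∫ s in (rPlus a m)..q.1, g (s, q.2)) (r, κ) ∧
    HasFDerivAt (fun q : ℝ × ℝ => ∫ s in (rPlus a m)..q.1, g (s, q.2))
      (linForm (g (r, κ)) (∫ s in (rPlus a m)..r, fderiv ℝ g (s, κ) (0, 1))) (r, κ) := by
  have hcd : ContDiffAt ℝ 1 (fun q : ℝ × ℝ => ∫ s in (rPlus a m)..q.1, g (s, q.2)) (r, κ) := by
    -- rescaling to `[0, 1]` turns the variable end point into a parameter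
    have h1 : (fun q : ℝ × ℝ => ∫ s in (rPlus a m)..q.1, g (s, q.2)) = fun q =>
        (q.1 - rPlus a m) * ∫ t in (0 : ℝ)..1, g (rPlus a m + (q.1 - rPlus a m) * t, q.2) := by
      funext q
      rw [intervalIntegral.mul_integral_comp_add_mul (f := fun s => g (s, q.2))]
      simp
    rw [h1]
    refine ContDiffAt.mul (by fun_prop) (contDiffAt_integral_param fun t ht => ?_).1
    rw [uIcc_of_le zero_le_one] at ht
    exact (hg (rPlus a m + (r - rPlus a m) * t, κ) (hq t ht)).comp ((r, κ), t)
      (f := fun z : (ℝ × ℝ) × ℝ => (rPlus a m + (z.1.1 - rPlus a m) * z.2, z.1.2)) (by fun_prop)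
  refine ⟨hcd, hasFDerivAt_linForm (hcd.differentiableAt one_ne_zero) ?_ ?_⟩
  · refine fderiv_eq_of_slice_fst (hcd.differentiableAt one_ne_zero) ?_
    have hO : IsOpen {s | 0 < radPoly a m s κ} := isOpen_lt continuous_const (continuous_radPoly a m κ)
    have hca : ∀ s, 0 < radPoly a m s κ → ContinuousAt (fun s => g (s, κ)) s := fun s hs =>
      ((hg (s, κ) hs).continuousAt).comp (f := fun s : ℝ => (s, κ)) (by fun_prop)
    have hr := radPoly_pos_of_mem_radDom hq right_mem_uIcc
    refine intervalIntegral.integral_hasDerivAt_right ?_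
      (ContinuousAt.stronglyMeasurableAtFilter hO hca r hr) (hca r hr)
    exact ContinuousOn.intervalIntegrable fun s hs =>
      (hca s (radPoly_pos_of_mem_radDom hq hs)).continuousWithinAt
  · refine fderiv_eq_of_slice_snd (hcd.differentiableAt one_ne_zero) ?_
    have hp := contDiffAt_integral_param (φ := fun q s => g (s, q.2)) (a := rPlus a m) (b := r)
      (p := (r, κ)) fun s hs =>
        (hg (s, κ) (radPoly_pos_of_mem_radDom hq hs)).comp ((r, κ), s)
          (f := fun z : (ℝ × ℝ) × ℝ => (z.2, z.1.2)) (by fun_prop)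
    have h2 : HasDerivAt (fun κ' => ∫ s in (rPlus a m)..r, g (s, κ'))
        (fderiv ℝ (fun q : ℝ × ℝ => ∫ s in (rPlus a m)..r, g (s, q.2)) (r, κ) (0, 1)) κ :=
      (hp.1.differentiableAt one_ne_zero).hasFDerivAt.comp_hasDerivAt κ
        ((hasDerivAt_const κ r).prodMk (hasDerivAt_id κ))
    refine h2.congr_deriv ((hp.2 (0, 1)).trans (intervalIntegral.integral_congr fun s hs => ?_))
    have hd := (hg (s, κ) (radPoly_pos_of_mem_radDom hq hs)).differentiableAt one_ne_zero
    have h3 : HasFDerivAt (fun q : ℝ × ℝ => g (s, q.2))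
        ((fderiv ℝ g (s, κ)).comp ((0 : ℝ × ℝ →L[ℝ] ℝ).prod (ContinuousLinearMap.snd ℝ ℝ ℝ)))
        (r, κ) :=
      hd.hasFDerivAt.comp (r, κ) (f := fun q : ℝ × ℝ => (s, q.2))
        ((hasFDerivAt_const s _).prodMk hasFDerivAt_snd)
    simp only [h3.fderiv]
    simp

theorem contDiffAt_radH {a m r κ : ℝ} (hq : (r, κ) ∈ radDom a m) :
    ContDiffAt ℝ 1 (radH a m) (r, κ) ∧
      HasFDerivAt (radH a m) (linForm (|a| / radS a m r κ) (radHκ a m r κ)) (r, κ) := by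
  have hg : ∀ q : ℝ × ℝ, 0 < radPoly a m q.1 q.2 →
      ContDiffAt ℝ 1 (fun q : ℝ × ℝ => |a| / radS a m q.1 q.2) q := fun q h =>
    contDiffAt_const.div (contDiffAt_radS h) (radS_pos h).ne'
  obtain ⟨h1, h2⟩ := contDiffAt_integral_rad hg hq
  refine ⟨h1, h2.congr_fderiv ?_⟩
  congr 1
  refine intervalIntegral.integral_congr fun s hs => ?_
  have h := radPoly_pos_of_mem_radDom hq hs
  refine fderiv_eq_of_slice_snd ((hg (s, κ) h).differentiableAt one_ne_zero) ?_
  have hS := radS_pos h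
  have hsq := radS_sq h
  refine ((hasDerivAt_const κ |a|).div ((hasDerivAt_radPoly_κ a m s κ).sqrt h.ne')
    hS.ne').congr_deriv ?_
  change _ / radS a m s κ ^ 2 = _
  rw [hsq]
  change (0 * radS a m s κ - |a| * (-(a ^ 2 * kerrDelta a m s) / (2 * radS a m s κ))) / _ = _
  field_simp
  ring

/-- The `κ`-derivative of `radA`: the quotient `(s² + a² - Σ) / Δ` has derivative
`a² / (2 Σ)`, whose integral is again `radH`. -/
theorem contDiffAt_radA {a m r κ : ℝ} (hq : (r, κ) ∈ radDom a m) :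
    ContDiffAt ℝ 1 (radA a m) (r, κ) ∧
      HasFDerivAt (radA a m) (linForm (-(a ^ 2 * κ / (r ^ 2 + a ^ 2 + radS a m r κ)))
        (-(|a| * radH a m (r, κ) / 2))) (r, κ) := by
  have hpos : ∀ q : ℝ × ℝ, 0 < radPoly a m q.1 q.2 → 0 < q.1 ^ 2 + a ^ 2 + radS a m q.1 q.2 :=
    fun q h => by have := radS_pos h; positivity
  have hg : ∀ q : ℝ × ℝ, 0 < radPoly a m q.1 q.2 →
      ContDiffAt ℝ 1 (fun q : ℝ × ℝ => a ^ 2 * q.2 / (q.1 ^ 2 + a ^ 2 + radS a m q.1 q.2)) q :=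
    fun q h => by
      have := contDiffAt_radS h
      exact ContDiffAt.div (by fun_prop) (by fun_prop) (hpos q h).ne'
  obtain ⟨h1, h2⟩ := contDiffAt_integral_rad hg hq
  have hA : radA a m = fun q : ℝ × ℝ =>
      -∫ s in (rPlus a m)..q.1, a ^ 2 * q.2 / (s ^ 2 + a ^ 2 + radS a m s q.2) := by
    funext q
    rw [radA, intervalIntegral.integral_symm]
  rw [hA]
  refine ⟨h1.neg, h2.neg.congr_fderiv ?_⟩
  have hint : (∫ s in (rPlus a m)..r, fderiv ℝ (fun q : ℝ × ℝ =>
      a ^ 2 * q.2 / (q.1 ^ 2 + a ^ 2 + radS a m q.1 q.2)) (s, κ) (0, 1)) =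
      |a| * radH a m (r, κ) / 2 := by
    rw [radH, mul_div_right_comm, ← intervalIntegral.integral_const_mul]
    refine intervalIntegral.integral_congr fun s hs => ?_
    have h := radPoly_pos_of_mem_radDom hq hs
    refine fderiv_eq_of_slice_snd ((hg (s, κ) h).differentiableAt one_ne_zero) ?_
    have hS := radS_pos h
    have hsq := radS_sq h
    have hp := hpos (s, κ) h
    have hd : HasDerivAt (fun κ => s ^ 2 + a ^ 2 + radS a m s κ)
        (-(a ^ 2 * kerrDelta a m s) / (2 * radS a m s κ)) κ :=
      ((hasDerivAt_radPoly_κ a m s κ).sqrt h.ne').const_add _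
    refine (((hasDerivAt_id κ).const_mul (a ^ 2)).div hd hp.ne').congr_deriv ?_
    simp only [id] at hp ⊢
    have e : |a| / 2 * (|a| / radS a m s κ) = a ^ 2 / (2 * radS a m s κ) := by
      rw [← sq_abs a]; ring
    rw [e]
    have hsq' : a ^ 2 * κ * kerrDelta a m s = (s ^ 2 + a ^ 2) ^ 2 - radS a m s κ ^ 2 := by
      rw [hsq, radPoly]; ring
    field_simp
    linear_combination a ^ 2 * hsq'
  rw [hint]
  ext <;> simp

/-! ### Estimates of the angular integrals -/

theorem mem_ellDom {ς W : ℝ} (h : ς * W ^ 2 < 1) : (ς, W) ∈ ellDom :=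
  ⟨h, by simp only; nlinarith [sq_nonneg W]⟩

theorem ellPoly_neg (ς W w : ℝ) : ellPoly ς (-W) w = ellPoly ς W w := by unfold ellPoly; ring

theorem ellH_neg (ς W : ℝ) : ellH (ς, -W) = -ellH (ς, W) := by
  simp only [ellH, ellPoly_neg, neg_div, intervalIntegral.integral_neg]

theorem ellK_neg (ς W : ℝ) : ellK (ς, -W) = -ellK (ς, W) := by
  simp only [ellK, ellPoly_neg]
  rw [← intervalIntegral.integral_neg]
  refine intervalIntegral.integral_congr fun t _ => ?_
  ring

theorem ellHς_neg (ς W : ℝ) : ellHς ς (-W) = -ellHς ς W := by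
  simp only [ellHς, ellPoly_neg]
  rw [← intervalIntegral.integral_neg]
  refine intervalIntegral.integral_congr fun t _ => ?_
  ring

theorem ellHW_neg (ς W : ℝ) : ellHW ς (-W) = ellHW ς W := by
  simp only [ellHW, ellPoly_neg]
  refine intervalIntegral.integral_congr fun t _ => ?_
  ring

theorem ellH_zero (ς : ℝ) : ellH (ς, 0) = 0 := by simp [ellH]

theorem ellPoly_le {ς W w : ℝ} (hς : ς ∈ Icc (0 : ℝ) 1) (hw : w ∈ Icc (0 : ℝ) 1) :
    ellPoly ς W w ≤ 1 + max 0 (1 - 2 * ς) * W ^ 2 := by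
  have h0 : 0 ≤ 1 - w ^ 2 := by nlinarith [hw.1, hw.2]
  have h3 : 1 - w ^ 2 ≤ 1 := by nlinarith [sq_nonneg w]
  have hz0 : 0 ≤ W ^ 2 * (1 - w ^ 2) := mul_nonneg (sq_nonneg W) h0
  have hz1 : W ^ 2 * (1 - w ^ 2) ≤ W ^ 2 := by nlinarith [sq_nonneg W]
  have e : ellPoly ς W w = 1 + (1 - 2 * ς) * (W ^ 2 * (1 - w ^ 2))
      - ς * (1 - ς) * (W ^ 2 * (1 - w ^ 2)) ^ 2 := by unfold ellPoly; ring
  have h4 : 0 ≤ ς * (1 - ς) * (W ^ 2 * (1 - w ^ 2)) ^ 2 :=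
    mul_nonneg (mul_nonneg hς.1 (sub_nonneg.2 hς.2)) (sq_nonneg _)
  have h5 : (1 - 2 * ς) * (W ^ 2 * (1 - w ^ 2)) ≤ max 0 (1 - 2 * ς) * (W ^ 2 * (1 - w ^ 2)) :=
    mul_le_mul_of_nonneg_right (le_max_right _ _) hz0
  have h6 : max 0 (1 - 2 * ς) * (W ^ 2 * (1 - w ^ 2)) ≤ max 0 (1 - 2 * ς) * W ^ 2 :=
    mul_le_mul_of_nonneg_left hz1 (le_max_left _ _)
  linarith

theorem ellPoly_le' {ς W w : ℝ} (hς : ς ∈ Icc (0 : ℝ) 1) (hw : w ∈ Icc (0 : ℝ) 1) :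
    ellPoly ς W w ≤ 1 + W ^ 2 := by
  refine (ellPoly_le hς hw).trans ?_
  have : max 0 (1 - 2 * ς) ≤ 1 := max_le zero_le_one (by linarith [hς.1])
  nlinarith [sq_nonneg W]

theorem div_sqrt_le_ellH {ς W M : ℝ} (hp : (ς, W) ∈ ellDom) (hW : 0 ≤ W)
    (hM : ∀ w ∈ Icc (0 : ℝ) 1, ellPoly ς W w ≤ M) : W / √M ≤ ellH (ς, W) := by
  have h : ∫ _ in (0 : ℝ)..1, W / √M ≤ ∫ w in (0 : ℝ)..1, W / √(ellPoly ς W w) := by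
    refine intervalIntegral.integral_mono_on zero_le_one intervalIntegrable_const
      (intervalIntegrable_ellH hp) fun w hw => ?_
    exact div_le_div_of_nonneg_left hW (Real.sqrt_pos.2 (ellPoly_pos hp hw))
      (Real.sqrt_le_sqrt (hM w hw))
  rw [ellH]
  simpa using h

theorem le_ellHW {ς W M : ℝ} (hς : ς ∈ Icc (0 : ℝ) 1) (hp : (ς, W) ∈ ellDom)
    (hM : ∀ w ∈ Icc (0 : ℝ) 1, ellPoly ς W w ≤ M) : 1 / (M * √M) ≤ ellHW ς W := by
  have h : ∫ _ in (0 : ℝ)..1, 1 / (M * √M) ≤ ellHW ς W := by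
    refine intervalIntegral.integral_mono_on zero_le_one intervalIntegrable_const
      (intervalIntegrable_div_ellPoly hp (by fun_prop)) fun w hw => ?_
    have h0 := ellPoly_pos hp hw
    have hs := Real.sqrt_pos.2 h0
    have h1 : 0 ≤ ς * (1 - ς) * W ^ 4 * (1 - w ^ 2) ^ 2 := by
      have := mul_nonneg hς.1 (sub_nonneg.2 hς.2)
      positivity
    have h2 : ellPoly ς W w * √(ellPoly ς W w) ≤ M * √M :=
      mul_le_mul (hM w hw) (Real.sqrt_le_sqrt (hM w hw)) hs.le (h0.le.trans (hM w hw))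
    calc 1 / (M * √M) ≤ 1 / (ellPoly ς W w * √(ellPoly ς W w)) :=
          one_div_le_one_div_of_le (mul_pos h0 hs) h2
      _ ≤ _ := by
          apply div_le_div_of_nonneg_right _ (mul_pos h0 hs).le
          linarith
  simpa using h

theorem ellHW_pos {ς W : ℝ} (hς : ς ∈ Icc (0 : ℝ) 1) (hp : (ς, W) ∈ ellDom) : 0 < ellHW ς W :=
  lt_of_lt_of_le (by positivity) (le_ellHW hς hp fun _ hw => ellPoly_le' hς hw)

theorem ellHς_nonneg {ς W : ℝ} (hp : (ς, W) ∈ ellDom) (hW : 0 ≤ W) : 0 ≤ ellHς ς W := by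
  refine intervalIntegral.integral_nonneg zero_le_one fun w hw => ?_
  have h0 := ellPoly_pos hp hw
  have hn : 0 ≤ 1 - w ^ 2 := by nlinarith [hw.1, hw.2]
  have hn1 : 1 - w ^ 2 ≤ 1 := by nlinarith [sq_nonneg w]
  have h1 : 0 ≤ 1 + (1 / 2 - ς) * W ^ 2 * (1 - w ^ 2) := by
    have h2 := hp.1
    simp only at h2
    have h3 : ς * W ^ 2 * (1 - w ^ 2) ≤ 1 := by
      rcases le_or_gt 0 (ς * W ^ 2) with h | h <;> nlinarith
    nlinarith [mul_nonneg (sq_nonneg W) hn]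
  have := Real.sqrt_nonneg (ellPoly ς W w)
  positivity

/-- The bound is used inside the horizon, where `radH_sq_le` forces `W² ≤ 1/7`. -/
theorem ellHς_le {ς W : ℝ} (hς : ς ∈ Icc (0 : ℝ) 1) (hW : 0 ≤ W) (hW2 : W ^ 2 ≤ 1 / 7) :
    ellHς ς W ≤ 1 / 4 * W := by
  have hp : (ς, W) ∈ ellDom := mem_ellDom (by nlinarith [hς.1, hς.2, sq_nonneg W])
  have h : ellHς ς W ≤ ∫ _ in (0 : ℝ)..1, 1 / 4 * W := by
    refine intervalIntegral.integral_mono_on zero_le_one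
      (intervalIntegrable_div_ellPoly hp (by fun_prop)) intervalIntegrable_const fun w hw => ?_
    have h0 := ellPoly_pos hp hw
    have hs := Real.sqrt_pos.2 h0
    have hn : 0 ≤ 1 - w ^ 2 := by nlinarith [hw.1, hw.2]
    have hn1 : 1 - w ^ 2 ≤ 1 := by nlinarith [sq_nonneg w]
    have hz0 := mul_nonneg (sq_nonneg W) hn
    have hz1 : W ^ 2 * (1 - w ^ 2) ≤ 1 / 7 := by nlinarith [sq_nonneg W]
    have hP : 6 / 7 ≤ ellPoly ς W w := by
      have e : ellPoly ς W w = (1 - ς * (W ^ 2 * (1 - w ^ 2))) *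
        (1 + (1 - ς) * (W ^ 2 * (1 - w ^ 2))) := by unfold ellPoly; ring
      have h1 : ς * (W ^ 2 * (1 - w ^ 2)) ≤ 1 / 7 := by nlinarith [hς.1, hς.2]
      have h2 : 0 ≤ (1 - ς) * (W ^ 2 * (1 - w ^ 2)) := mul_nonneg (sub_nonneg.2 hς.2) hz0
      rw [e]; nlinarith
    have hsq : 9 / 10 ≤ √(ellPoly ς W w) := Real.le_sqrt_of_sq_le (by linarith)
    have hden : 3 / 4 ≤ ellPoly ς W w * √(ellPoly ς W w) := by nlinarith
    rw [div_le_iff₀ (mul_pos h0 hs)]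
    have h5 : (1 - w ^ 2) * (1 + (1 / 2 - ς) * W ^ 2 * (1 - w ^ 2)) ≤ 1.1 := by
      have : (1 / 2 - ς) * W ^ 2 * (1 - w ^ 2) ≤ 1 / 14 := by nlinarith [hς.1]
      nlinarith
    have h6 : W ^ 3 * (1 - w ^ 2) * (1 + (1 / 2 - ς) * W ^ 2 * (1 - w ^ 2)) ≤ W * (1 / 7 * 1.1) := by
      have e : W ^ 3 * (1 - w ^ 2) * (1 + (1 / 2 - ς) * W ^ 2 * (1 - w ^ 2)) =
        W * (W ^ 2 * ((1 - w ^ 2) * (1 + (1 / 2 - ς) * W ^ 2 * (1 - w ^ 2)))) := by ring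
      rw [e]
      refine mul_le_mul_of_nonneg_left ?_ hW
      nlinarith [sq_nonneg W]
    nlinarith
  simpa using h

/-! ### Estimates of the radial integrals -/

theorem rPlus_add_rMinus (a m : ℝ) : rPlus a m + rMinus a m = 2 * m := by
  unfold rPlus rMinus; ring

theorem sq_lt_sq_of_abs_lt {a m : ℝ} (ham : |a| < m) : a ^ 2 < m ^ 2 := by
  rw [← sq_abs a]; exact pow_lt_pow_left₀ ham (abs_nonneg a) two_ne_zero

theorem rPlus_mul_rMinus {a m : ℝ} (ham : |a| < m) : rPlus a m * rMinus a m = a ^ 2 := by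
  have := Real.sq_sqrt (sub_nonneg.2 (sq_lt_sq_of_abs_lt ham).le)
  unfold rPlus rMinus; linear_combination -this

theorem kerrDelta_eq {a m : ℝ} (ham : |a| < m) (r : ℝ) :
    kerrDelta a m r = (r - rPlus a m) * (r - rMinus a m) := by
  unfold kerrDelta
  linear_combination r * rPlus_add_rMinus a m - rPlus_mul_rMinus ham

theorem lt_rPlus {a m : ℝ} (ham : |a| < m) : m < rPlus a m := by
  have := Real.sqrt_pos.2 (sub_pos.2 (sq_lt_sq_of_abs_lt ham))
  unfold rPlus; linarith

theorem rMinus_lt {a m : ℝ} (ham : |a| < m) : rMinus a m < m := by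
  have := Real.sqrt_pos.2 (sub_pos.2 (sq_lt_sq_of_abs_lt ham))
  unfold rMinus; linarith

theorem rMinus_nonneg {a m : ℝ} (ham : |a| < m) : 0 ≤ rMinus a m := by
  have h1 := rPlus_mul_rMinus ham
  have h2 := rPlus_pos ham
  by_contra h
  nlinarith [sq_nonneg a]

theorem kerrDelta_nonneg {a m r : ℝ} (ham : |a| < m) (hr : rPlus a m ≤ r) :
    0 ≤ kerrDelta a m r := by
  rw [kerrDelta_eq ham]
  exact mul_nonneg (by linarith) (by linarith [lt_rPlus ham, rMinus_lt ham])

theorem kerrDelta_nonpos {a m r : ℝ} (ham : |a| < m) (h1 : rMinus a m ≤ r) (hr : r ≤ rPlus a m) :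
    kerrDelta a m r ≤ 0 := by
  rw [kerrDelta_eq ham]
  exact mul_nonpos_of_nonpos_of_nonneg (by linarith) (by linarith)

theorem intervalIntegrable_radH {a m r κ : ℝ} (hq : (r, κ) ∈ radDom a m) :
    IntervalIntegrable (fun s => |a| / radS a m s κ) MeasureTheory.volume (rPlus a m) r :=
  ContinuousOn.intervalIntegrable fun s hs => (continuousAt_const.div (continuousAt_radS a m s κ)
    (radS_pos (radPoly_pos_of_mem_radDom hq hs)).ne').continuousWithinAt

theorem intervalIntegrable_radHκ {a m r κ : ℝ} (hq : (r, κ) ∈ radDom a m) :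
    IntervalIntegrable
      (fun s => |a| * (a ^ 2 * kerrDelta a m s) / (2 * (radPoly a m s κ * radS a m s κ)))
      MeasureTheory.volume (rPlus a m) r :=
  ContinuousOn.intervalIntegrable fun s hs => by
    have h := radPoly_pos_of_mem_radDom hq hs
    have hS := radS_pos h
    refine (ContinuousAt.div (by unfold kerrDelta; fun_prop) ?_
      (by positivity)).continuousWithinAt
    exact continuousAt_const.mul
      ((continuous_radPoly a m κ).continuousAt.mul (continuousAt_radS a m s κ))

/-- Outside the horizon `Σ²` is smallest at `κ = 1`; there `m` may be replaced by `|a|`. -/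
theorem quartic_le_radPoly {a m s κ : ℝ} (ham : |a| < m) (hs : rPlus a m ≤ s)
    (hκ : κ ∈ Icc (0 : ℝ) 1) : s ^ 4 + |a| ^ 2 * s ^ 2 + 2 * |a| ^ 3 * s ≤ radPoly a m s κ := by
  have h0 := kerrDelta_nonneg ham hs
  have hs0 : 0 < s := (rPlus_pos ham).trans_le hs
  have h1 : radPoly a m s κ = (s ^ 4 + a ^ 2 * s ^ 2 + 2 * m * a ^ 2 * s)
      + (1 - κ) * (a ^ 2 * kerrDelta a m s) := by
    unfold radPoly kerrDelta; ring
  have h2 : 0 ≤ (1 - κ) * (a ^ 2 * kerrDelta a m s) :=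
    mul_nonneg (sub_nonneg.2 hκ.2) (mul_nonneg (sq_nonneg a) h0)
  have h3 : |a| ^ 3 * s ≤ m * a ^ 2 * s := by
    refine mul_le_mul_of_nonneg_right ?_ hs0.le
    rw [← sq_abs a]
    nlinarith [sq_nonneg |a|]
  rw [h1, sq_abs]; linarith

/-- A lower bound for `Σ` whose reciprocal has an elementary primitive. The constants `2/5` and
`6/5` are chosen so that the resulting estimate `radH_le` of `∫ |a| / Σ` stays below `1`. -/
theorem shift_sq_le_radS {a m s κ : ℝ} (ham : |a| < m) (hs : rPlus a m ≤ s)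
    (hκ : κ ∈ Icc (0 : ℝ) 1) : (s + 2 / 5 * |a|) ^ 2 / (6 / 5) ≤ radS a m s κ := by
  refine Real.le_sqrt_of_sq_le ((le_of_sub_nonneg ?_).trans (quartic_le_radPoly ham hs hκ))
  have hα := abs_nonneg a
  have hsα : |a| ≤ s := by linarith [lt_rPlus ham]
  -- in terms of `u = s - |a| ≥ 0` the difference is a sum of nonnegative terms
  obtain ⟨u, hu, rfl⟩ : ∃ u, 0 ≤ u ∧ s = |a| + u := ⟨s - |a|, by linarith, by ring⟩
  have e : (|a| + u) ^ 4 + |a| ^ 2 * (|a| + u) ^ 2 + 2 * |a| ^ 3 * (|a| + u)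
      - ((|a| + u + 2 / 5 * |a|) ^ 2 / (6 / 5)) ^ 2
      = (25 / 36) * (0.44 * (u ^ 2 - 1.9 * |a| ^ 2) ^ 2 + 0.16 * (|a| * (u * (u - |a| / 2) ^ 2))
        + 0.152 * (u ^ 2 * |a| ^ 2) + (0.504) * (u * |a| ^ 3) + 0.33 * |a| ^ 4) := by ring
  rw [e]
  positivity

/-- Integration of `shift_sq_le_radS` from `r₊ ≥ |a|`; `6/7 = (6/5) / (1 + 2/5)`. The factor `1 -
|a|/r` makes `|a| radH` small compared with `r`, uniformly in `r`. -/
theorem radH_le {a m r κ : ℝ} (ham : |a| < m) (hr : rPlus a m ≤ r) (hκ : κ ∈ Icc (0 : ℝ) 1) :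
    radH a m (r, κ) ≤ 6 / 7 * (1 - |a| / r) := by
  have hα := abs_nonneg a
  have hp := lt_rPlus ham
  have hr0 : 0 < r := (rPlus_pos ham).trans_le hr
  have hpos : ∀ s, rPlus a m ≤ s → 0 < s + 2 / 5 * |a| := fun s hs => by linarith
  have hmem := mem_radDom ham hr0 hκ
  have hi : IntervalIntegrable (fun s => 6 / 5 * |a| / (s + 2 / 5 * |a|) ^ 2)
      MeasureTheory.volume (rPlus a m) r := by
    refine ContinuousOn.intervalIntegrable fun s hs => ?_
    rw [uIcc_of_le hr] at hs
    have := hpos s hs.1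
    exact (ContinuousAt.div (by fun_prop) (by fun_prop) (by positivity)).continuousWithinAt
  have h1 : radH a m (r, κ) ≤ ∫ s in (rPlus a m)..r, 6 / 5 * |a| / (s + 2 / 5 * |a|) ^ 2 := by
    refine intervalIntegral.integral_mono_on hr (intervalIntegrable_radH hmem) hi fun s hs => ?_
    have h2 := hpos s hs.1
    calc |a| / radS a m s κ ≤ |a| / ((s + 2 / 5 * |a|) ^ 2 / (6 / 5)) :=
          div_le_div_of_nonneg_left hα (by positivity) (shift_sq_le_radS ham hs.1 hκ)
      _ = _ := by field_simp
  have h2 : ∫ s in (rPlus a m)..r, 6 / 5 * |a| / (s + 2 / 5 * |a|) ^ 2 =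
      6 / 5 * |a| / (rPlus a m + 2 / 5 * |a|) - 6 / 5 * |a| / (r + 2 / 5 * |a|) := by
    rw [intervalIntegral.integral_eq_sub_of_hasDerivAt
      (f := fun s => -(6 / 5 * |a| / (s + 2 / 5 * |a|))) (fun s hs => ?_) hi]
    · ring
    · rw [uIcc_of_le hr] at hs
      have h2 := hpos s hs.1
      refine (((hasDerivAt_const s (6 / 5 * |a|)).div ((hasDerivAt_id s).add_const (2 / 5 * |a|))
        h2.ne').neg).congr_deriv ?_
      simp only [id]; ring
  refine h1.trans ?_
  rw [h2]
  rcases hα.eq_or_lt with h | h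
  · simp [← h]; norm_num
  have h3 : 6 / 5 * |a| / (rPlus a m + 2 / 5 * |a|) ≤ 6 / 7 := by
    rw [div_le_iff₀ (hpos _ le_rfl)]; linarith
  have h4 : 6 / 7 * (|a| / r) ≤ 6 / 5 * |a| / (r + 2 / 5 * |a|) := by
    rw [le_div_iff₀ (hpos _ hr), ← mul_div_assoc, div_mul_eq_mul_div, div_le_iff₀ hr0]
    nlinarith
  linarith

theorem radH_nonneg {a m r κ : ℝ} (hr : rPlus a m ≤ r) : 0 ≤ radH a m (r, κ) :=
  intervalIntegral.integral_nonneg hr fun _ _ => div_nonneg (abs_nonneg a) (Real.sqrt_nonneg _)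

theorem radH_nonpos {a m r κ : ℝ} (hr : r ≤ rPlus a m) : radH a m (r, κ) ≤ 0 := by
  rw [radH, intervalIntegral.integral_symm, neg_nonpos]
  exact intervalIntegral.integral_nonneg hr fun _ _ =>
    div_nonneg (abs_nonneg a) (Real.sqrt_nonneg _)

/-- Outside the horizon `a² Δ` is small compared with `Σ²`, because `Δ ≤ (s - |a|)²` and `4.6 |a| (s
- |a|) ≤ s² + a²`; hence `Σ` depends only weakly on `κ`. -/
theorem delta_le_radPoly {a m s κ : ℝ} (ham : |a| < m) (hs : rPlus a m ≤ s)
    (hκ : κ ∈ Icc (0 : ℝ) 1) : 20 * (a ^ 2 * kerrDelta a m s) ≤ radPoly a m s κ := by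
  have h0 := kerrDelta_nonneg ham hs
  have hα := abs_nonneg a
  have hm : m < s := (lt_rPlus ham).trans_le hs
  have h1 : kerrDelta a m s ≤ (s - |a|) ^ 2 := by
    have h2 := sq_lt_sq_of_abs_lt ham
    have : kerrDelta a m s = (s - m) ^ 2 - (m ^ 2 - a ^ 2) := by unfold kerrDelta; ring
    nlinarith
  have h2 : 4.6 * (|a| * (s - |a|)) ≤ s ^ 2 + a ^ 2 := by
    rw [← sq_abs a]; nlinarith [sq_nonneg (s - 2.3 * |a|), sq_nonneg |a|]
  have h3 : (4.6 * (|a| * (s - |a|))) ^ 2 ≤ (s ^ 2 + a ^ 2) ^ 2 :=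
    pow_le_pow_left₀ (mul_nonneg (by norm_num) (mul_nonneg hα (by linarith))) h2 2
  have h4 : a ^ 2 * kerrDelta a m s ≤ a ^ 2 * (s - |a|) ^ 2 :=
    mul_le_mul_of_nonneg_left h1 (sq_nonneg a)
  have h5 : (4.6 * (|a| * (s - |a|))) ^ 2 = 21.16 * (a ^ 2 * (s - |a|) ^ 2) := by
    rw [← sq_abs a]; ring
  have h6 : κ * (a ^ 2 * kerrDelta a m s) ≤ a ^ 2 * kerrDelta a m s := by
    have := mul_nonneg (sq_nonneg a) h0
    nlinarith [hκ.2]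
  have h7 : 0 ≤ a ^ 2 * (s - |a|) ^ 2 := by positivity
  unfold radPoly
  nlinarith

/-- The sign holds on both sides of the horizon: inside it, `Δ < 0` and the orientation of the
integral is reversed. -/
theorem radHκ_nonneg {a m r κ : ℝ} (ham : |a| < m) (hr : rMinus a m < r) :
    0 ≤ radHκ a m r κ := by
  have hα := abs_nonneg a
  rcases le_or_gt (rPlus a m) r with h | h
  · refine intervalIntegral.integral_nonneg h fun s hs => ?_
    have h1 := kerrDelta_nonneg ham hs.1
    -- where `radPoly ≤ 0` the integrand is a division by zero, hence zero
    rcases le_or_gt (radPoly a m s κ) 0 with h2 | h2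
    · simp [radS, Real.sqrt_eq_zero_of_nonpos h2]
    · have := Real.sqrt_nonneg (radPoly a m s κ)
      unfold radS; positivity
  · rw [radHκ, intervalIntegral.integral_symm, ← intervalIntegral.integral_neg]
    refine intervalIntegral.integral_nonneg h.le fun s hs => ?_
    have h1 := kerrDelta_nonpos ham (hr.le.trans hs.1) hs.2
    rcases le_or_gt (radPoly a m s κ) 0 with h2 | h2
    · simp [radS, Real.sqrt_eq_zero_of_nonpos h2]
    · have h3 := Real.sqrt_nonneg (radPoly a m s κ)
      rw [← neg_div, ← mul_neg, ← mul_neg]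
      have h4 := neg_nonneg.2 h1
      unfold radS; positivity

theorem radHκ_le {a m r κ : ℝ} (ham : |a| < m) (hr : rPlus a m ≤ r) (hκ : κ ∈ Icc (0 : ℝ) 1) :
    radHκ a m r κ ≤ radH a m (r, κ) / 40 := by
  have hr0 : 0 < r := (rPlus_pos ham).trans_le hr
  have hmem := mem_radDom ham hr0 hκ
  rw [radH, div_eq_mul_inv _ (40 : ℝ), ← intervalIntegral.integral_mul_const]
  refine intervalIntegral.integral_mono_on hr (intervalIntegrable_radHκ hmem)
    ((intervalIntegrable_radH hmem).mul_const _) fun s hs => ?_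
  have h0 := radPoly_pos (a := a) ((abs_nonneg a).trans_lt ham) ((rPlus_pos ham).trans_le hs.1) hκ
  have hS := radS_pos h0
  have h1 := delta_le_radPoly ham hs.1 hκ
  simp only
  rw [div_mul_eq_mul_div, div_le_div_iff₀ (by positivity) hS]
  have h2 : |a| * (20 * (a ^ 2 * kerrDelta a m s)) ≤ |a| * radPoly a m s κ :=
    mul_le_mul_of_nonneg_left h1 (abs_nonneg a)
  nlinarith

/-- Between `r = m` and the horizon `-Δ ≤ m² - a²`, and `8 a² (m² - a²) ≤ (m² + a²)²`. -/
theorem neg_delta_le {a m s : ℝ} (ham : |a| < m) (hs : m ≤ s) :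
    8 * (a ^ 2 * -kerrDelta a m s) ≤ (s ^ 2 + a ^ 2) ^ 2 := by
  have hm : 0 < m := (abs_nonneg a).trans_lt ham
  have h1 : -kerrDelta a m s ≤ m ^ 2 - a ^ 2 := by
    have : kerrDelta a m s = (s - m) ^ 2 - (m ^ 2 - a ^ 2) := by unfold kerrDelta; ring
    nlinarith [sq_nonneg (s - m)]
  have h2 : a ^ 2 * -kerrDelta a m s ≤ a ^ 2 * (m ^ 2 - a ^ 2) :=
    mul_le_mul_of_nonneg_left h1 (sq_nonneg a)
  have h3 : (m ^ 2 + a ^ 2) ^ 2 ≤ (s ^ 2 + a ^ 2) ^ 2 := by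
    refine pow_le_pow_left₀ (by positivity) ?_ 2
    nlinarith
  nlinarith [sq_nonneg (m ^ 2 - 3 * a ^ 2)]

theorem sq_le_radPoly {a m s κ : ℝ} (ham : |a| < m) (h1 : rMinus a m ≤ s) (hs : s ≤ rPlus a m)
    (hκ : 0 ≤ κ) : (s ^ 2 + a ^ 2) ^ 2 ≤ radPoly a m s κ := by
  have := kerrDelta_nonpos ham h1 hs
  unfold radPoly
  nlinarith [mul_nonneg (sq_nonneg a) hκ]

theorem radHκ_le_of_le {a m r κ : ℝ} (ham : |a| < m) (hm : m ≤ r) (hr : r ≤ rPlus a m)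
    (hκ : κ ∈ Icc (0 : ℝ) 1) : radHκ a m r κ ≤ -radH a m (r, κ) / 16 := by
  have hr0 : 0 < r := ((abs_nonneg a).trans_lt ham).trans_le hm
  have hmem := mem_radDom ham hr0 hκ
  have e1 : radHκ a m r κ = ∫ s in r..(rPlus a m), -(|a| * (a ^ 2 * kerrDelta a m s) /
      (2 * (radPoly a m s κ * radS a m s κ))) := by
    rw [radHκ, intervalIntegral.integral_symm, intervalIntegral.integral_neg]
  have e2 : -radH a m (r, κ) / 16 = ∫ s in r..(rPlus a m), |a| / radS a m s κ * (1 / 16) := by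
    rw [radH, intervalIntegral.integral_symm, intervalIntegral.integral_mul_const]; ring
  rw [e1, e2]
  refine intervalIntegral.integral_mono_on hr (intervalIntegrable_radHκ hmem).symm.neg
    ((intervalIntegrable_radH hmem).symm.mul_const _) fun s hs => ?_
  have h0 := radPoly_pos (a := a) ((abs_nonneg a).trans_lt ham) (hr0.trans_le hs.1) hκ
  have hS := radS_pos h0
  have h1 := (neg_delta_le ham (hm.trans hs.1)).trans
    (sq_le_radPoly ham ((rMinus_lt ham).le.trans (hm.trans hs.1)) hs.2 hκ.1)
  rw [← neg_div, div_mul_eq_mul_div, div_le_div_iff₀ (by positivity) hS]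
  have h2 : |a| * (8 * (a ^ 2 * -kerrDelta a m s)) ≤ |a| * radPoly a m s κ :=
    mul_le_mul_of_nonneg_left h1 (abs_nonneg a)
  nlinarith

/-- Between `r = m` and the horizon, `|radH| ≤ |a| √(m² - a²) / (m² + a²)`, whose square is at most
`1/8`. -/
theorem radH_sq_le {a m r κ : ℝ} (ham : |a| < m) (hm : m ≤ r) (hr : r ≤ rPlus a m)
    (hκ : κ ∈ Icc (0 : ℝ) 1) : radH a m (r, κ) ^ 2 ≤ 1 / 8 := by
  have hα := abs_nonneg a
  have hm0 : 0 < m := hα.trans_lt ham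
  have hmem := mem_radDom ham (hm0.trans_le hm) hκ
  set d := √(m ^ 2 - a ^ 2) with hd
  have hd0 : 0 ≤ d := Real.sqrt_nonneg _
  have hd2 : d ^ 2 = m ^ 2 - a ^ 2 := Real.sq_sqrt (sub_nonneg.2 (sq_lt_sq_of_abs_lt ham).le)
  have h1 : -radH a m (r, κ) ≤ ∫ _ in r..(rPlus a m), |a| / (m ^ 2 + a ^ 2) := by
    rw [radH, intervalIntegral.integral_symm, neg_neg]
    refine intervalIntegral.integral_mono_on hr (intervalIntegrable_radH hmem).symm
      intervalIntegrable_const fun s hs => ?_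
    refine div_le_div_of_nonneg_left hα (by positivity) (Real.le_sqrt_of_sq_le ?_)
    refine le_trans ?_
      (sq_le_radPoly ham ((rMinus_lt ham).le.trans (hm.trans hs.1)) hs.2 hκ.1)
    refine pow_le_pow_left₀ (by positivity) ?_ 2
    nlinarith [hs.1]
  rw [intervalIntegral.integral_const, smul_eq_mul] at h1
  have h2 : (rPlus a m - r) * (|a| / (m ^ 2 + a ^ 2)) ≤ d * (|a| / (m ^ 2 + a ^ 2)) := by
    refine mul_le_mul_of_nonneg_right ?_ (by positivity)
    unfold rPlus; linarith
  have h3 : 0 ≤ -radH a m (r, κ) := neg_nonneg.2 (radH_nonpos hr)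
  have h4 : radH a m (r, κ) ^ 2 ≤ (d * (|a| / (m ^ 2 + a ^ 2))) ^ 2 := by
    rw [← neg_sq]
    exact pow_le_pow_left₀ h3 (h1.trans h2) 2
  refine h4.trans ?_
  rw [mul_pow, div_pow, hd2, sq_abs, ← mul_div_assoc, div_le_iff₀ (by positivity)]
  nlinarith [sq_nonneg (m ^ 2 - 3 * a ^ 2)]

/-! ### The equation for `θ_*` in the variable `W` -/

/-- `sin² θ_*` in terms of `ς = sin² θ` and `W`. -/
def kap (ς W : ℝ) : ℝ := ς * (1 + (1 - ς) * W ^ 2)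

/-- The equation `piFun = 0` for `θ_*` in the variable `W`. -/
def IsSol (a m r ς W : ℝ) : Prop :=
  ς * W ^ 2 < 1 ∧ ellH (ς, W) = radH a m (r, kap ς W)

/-- The `W`-derivative of `H(ς, W) - h(r, κ(ς, W))`. -/
def solW (a m r ς W : ℝ) : ℝ :=
  ellHW ς W - radHκ a m r (kap ς W) * (2 * ς * (1 - ς) * W)

theorem kap_mem {ς W : ℝ} (hς : ς ∈ Icc (0 : ℝ) 1) (h : ς * W ^ 2 ≤ 1) :
    kap ς W ∈ Icc (0 : ℝ) 1 := by
  have h1 := sub_nonneg.2 hς.2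
  have h0 := hς.1
  constructor
  · unfold kap; positivity
  · have : 1 - kap ς W = (1 - ς) * (1 - ς * W ^ 2) := by unfold kap; ring
    nlinarith [mul_nonneg h1 (sub_nonneg.2 h)]

theorem kap_neg (ς W : ℝ) : kap ς (-W) = kap ς W := by unfold kap; ring

theorem div_sqrt_le_ellH' {ς W : ℝ} (hς : ς ∈ Icc (0 : ℝ) 1) (hp : ς * W ^ 2 < 1)
    (hW : 0 ≤ W) : W / √(1 + W ^ 2) ≤ ellH (ς, W) :=
  div_sqrt_le_ellH (mem_ellDom hp) hW fun _ hw => ellPoly_le' hς hw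

theorem ellH_pos {ς W : ℝ} (hς : ς ∈ Icc (0 : ℝ) 1) (hp : ς * W ^ 2 < 1) (hW : 0 < W) :
    0 < ellH (ς, W) :=
  lt_of_lt_of_le (by positivity) (div_sqrt_le_ellH' hς hp hW.le)

theorem sq_le_of_ellH_le {ς W h : ℝ} (hς : ς ∈ Icc (0 : ℝ) 1) (hp : ς * W ^ 2 < 1)
    (hW : 0 ≤ W) (hh : ellH (ς, W) ≤ h) : W ^ 2 ≤ h ^ 2 * (1 + W ^ 2) := by
  have h1 := (div_sqrt_le_ellH' hς hp hW).trans hh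
  have h2 : (W / √(1 + W ^ 2)) ^ 2 ≤ h ^ 2 := pow_le_pow_left₀ (by positivity) h1 2
  rw [div_pow, Real.sq_sqrt (by positivity), div_le_iff₀ (by positivity)] at h2
  exact h2

theorem IsSol.nonneg {a m r ς W : ℝ} (hς : ς ∈ Icc (0 : ℝ) 1) (hs : IsSol a m r ς W)
    (hr : rPlus a m ≤ r) : 0 ≤ W := by
  by_contra hW
  push Not at hW
  have h1 := ellH_pos (W := -W) hς (by simpa using hs.1) (by linarith)
  rw [ellH_neg, hs.2] at h1
  linarith [radH_nonneg (κ := kap ς W) hr]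

theorem IsSol.nonpos {a m r ς W : ℝ} (hς : ς ∈ Icc (0 : ℝ) 1) (hs : IsSol a m r ς W)
    (hr : r ≤ rPlus a m) : W ≤ 0 := by
  by_contra hW
  push Not at hW
  have h1 := ellH_pos hς hs.1 hW
  rw [hs.2] at h1
  linarith [radH_nonpos (κ := kap ς W) hr]

/-- From `W² ≤ h² (1 + W²)` and `h ≤ 6/7`: the second bound is `(36/49) / (1 - 36/49)`, and then `1
+ W² ≤ 49/13 < 4`. -/
theorem IsSol.bounds {a m r ς W : ℝ} (ham : |a| < m) (hς : ς ∈ Icc (0 : ℝ) 1)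
    (hs : IsSol a m r ς W) (hr : rPlus a m ≤ r) :
    W ≤ 2 * radH a m (r, kap ς W) ∧ W ^ 2 ≤ 36 / 13 := by
  have h0 := hs.nonneg hς hr
  have h1 := sq_le_of_ellH_le hς hs.1 h0 hs.2.le
  have h2 := radH_le ham hr (kap_mem hς hs.1.le)
  have h3 := radH_nonneg (κ := kap ς W) hr
  have h4 : 0 ≤ |a| / r := div_nonneg (abs_nonneg a) ((rPlus_pos ham).trans_le hr).le
  set h := radH a m (r, kap ς W)
  have h5 : h ^ 2 ≤ 36 / 49 := by nlinarith
  have h6 : W ^ 2 ≤ 36 / 13 := by nlinarith [sq_nonneg W]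
  refine ⟨abs_le_of_sq_le_sq' ?_ (by linarith) |>.2, h6⟩
  nlinarith [sq_nonneg h]

/-- Outside the horizon the two terms of `solW` compete. The first is at least `M^(-3/2)` with `M =
49/13`, and `radHκ_le` makes the second much smaller. -/
theorem solW_pos_of_bounds {a m r ς W : ℝ} (ham : |a| < m) (hς : ς ∈ Icc (0 : ℝ) 1)
    (hp : ς * W ^ 2 < 1) (hW : 0 ≤ W) (hW2 : W ^ 2 ≤ 36 / 13) (hr : rPlus a m ≤ r) :
    1 / 9 ≤ solW a m r ς W := by
  have hκ := kap_mem hς hp.le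
  have h1 := le_ellHW (M := 49 / 13) hς (mem_ellDom hp)
    fun w hw => (ellPoly_le' hς hw).trans (by linarith)
  have h2 : √(49 / 13 : ℝ) ≤ 1.945 := Real.sqrt_le_iff.2 ⟨by norm_num, by norm_num⟩
  have h3 : (1 : ℝ) / (49 / 13 * 1.945) ≤ 1 / (49 / 13 * √(49 / 13)) :=
    one_div_le_one_div_of_le (by positivity) (by linarith)
  have h4 := radHκ_le ham hr hκ
  have h5 := radH_le ham hr hκ
  have h6 : 0 ≤ |a| / r := div_nonneg (abs_nonneg a) ((rPlus_pos ham).trans_le hr).le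
  have h7 := radHκ_nonneg (κ := kap ς W) ham
    ((rMinus_lt ham).trans ((lt_rPlus ham).trans_le hr))
  have h8 : W ≤ 1.67 := by nlinarith
  have h9 : 2 * ς * (1 - ς) * W ≤ 1 / 2 * 1.67 := by
    have : ς * (1 - ς) ≤ 1 / 4 := by nlinarith [sq_nonneg (ς - 1 / 2)]
    nlinarith
  have h10 : 0 ≤ 2 * ς * (1 - ς) * W :=
    mul_nonneg (mul_nonneg (by linarith [hς.1]) (sub_nonneg.2 hς.2)) hW
  have h11 : radHκ a m r (kap ς W) ≤ 3 / 140 := by linarith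
  have h12 : radHκ a m r (kap ς W) * (2 * ς * (1 - ς) * W) ≤ 3 / 140 * (1 / 2 * 1.67) :=
    mul_le_mul h11 h9 h10 (by norm_num)
  unfold solW
  norm_num at h1 h3 h12 ⊢
  linarith

/-- Inside the horizon `W ≤ 0`, and both terms of `solW` are nonnegative. -/
theorem solW_pos_of_nonpos {a m r ς W : ℝ} (ham : |a| < m) (hς : ς ∈ Icc (0 : ℝ) 1)
    (hp : ς * W ^ 2 < 1) (hW : W ≤ 0) (hr : rMinus a m < r) : 0 < solW a m r ς W := by
  have h1 := ellHW_pos hς (mem_ellDom hp)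
  have h2 := radHκ_nonneg (κ := kap ς W) ham hr
  have h3 : 2 * ς * (1 - ς) * W ≤ 0 :=
    mul_nonpos_of_nonneg_of_nonpos (mul_nonneg (by linarith [hς.1]) (sub_nonneg.2 hς.2)) hW
  unfold solW
  nlinarith [mul_nonneg h2 (neg_nonneg.2 h3)]

theorem IsSol.solW_pos {a m r ς W : ℝ} (ham : |a| < m) (hς : ς ∈ Icc (0 : ℝ) 1)
    (hs : IsSol a m r ς W) (hr : rMinus a m < r) : 0 < solW a m r ς W := by
  rcases le_or_gt (rPlus a m) r with h | h
  · have := solW_pos_of_bounds ham hς hs.1 (hs.nonneg hς h) (hs.bounds ham hς h).2 h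
    linarith
  · exact solW_pos_of_nonpos ham hς hs.1 (hs.nonpos hς h.le) hr

/-- The function whose zeros in `W` are the solutions, as a function of `((r, ς), W)`. -/
def solFun (a m : ℝ) (z : (ℝ × ℝ) × ℝ) : ℝ :=
  ellH (z.1.2, z.2) - radH a m (z.1.1, kap z.1.2 z.2)

theorem contDiffAt_solFun {a m : ℝ} {z : (ℝ × ℝ) × ℝ} (h1 : (z.1.2, z.2) ∈ ellDom)
    (h2 : (z.1.1, kap z.1.2 z.2) ∈ radDom a m) : ContDiffAt ℝ 1 (solFun a m) z := by
  refine ContDiffAt.sub ?_ ?_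
  · exact (contDiffAt_ellH h1).comp z (f := fun z : (ℝ × ℝ) × ℝ => (z.1.2, z.2)) (by fun_prop)
  · exact (contDiffAt_radH h2).1.comp z
      (f := fun z : (ℝ × ℝ) × ℝ => (z.1.1, kap z.1.2 z.2)) (by unfold kap; fun_prop)

theorem hasDerivAt_kap_W (ς W : ℝ) : HasDerivAt (kap ς) (2 * ς * (1 - ς) * W) W := by
  unfold kap
  refine ((((hasDerivAt_pow 2 W).const_mul (1 - ς)).const_add 1).const_mul ς).congr_deriv ?_
  push_cast; ring

theorem hasFDerivAt_kap (ς W : ℝ) : HasFDerivAt (fun q : ℝ × ℝ => kap q.1 q.2)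
    (linForm (1 + (1 - 2 * ς) * W ^ 2) (2 * ς * (1 - ς) * W)) (ς, W) := by
  have hd : DifferentiableAt ℝ (fun q : ℝ × ℝ => kap q.1 q.2) (ς, W) := by
    unfold kap; fun_prop
  refine hasFDerivAt_linForm hd (fderiv_eq_of_slice_fst hd ?_)
    (fderiv_eq_of_slice_snd hd (hasDerivAt_kap_W ς W))
  unfold kap
  refine ((hasDerivAt_id ς).mul ((((hasDerivAt_id ς).const_sub 1).mul_const
    (W ^ 2)).const_add 1)).congr_deriv ?_
  simp only [id]; ring

theorem hasDerivAt_solFun_W {a m r ς W : ℝ} (h1 : (ς, W) ∈ ellDom)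
    (h2 : (r, kap ς W) ∈ radDom a m) :
    HasDerivAt (fun W => solFun a m ((r, ς), W)) (solW a m r ς W) W := by
  have e1 := (hasFDerivAt_ellH h1).comp_hasDerivAt W ((hasDerivAt_const W ς).prodMk
    (hasDerivAt_id W))
  have e2 := (contDiffAt_radH h2).2.comp_hasDerivAt W ((hasDerivAt_const W r).prodMk
    (hasDerivAt_kap_W ς W))
  refine (e1.sub e2).congr_deriv ?_
  simp [solW]

/-- Between two solutions the bounds for solutions hold as well, so the `W`-derivative `solW` is
positive there and the function `solFun` is strictly increasing. -/
theorem IsSol.unique {a m r ς W W' : ℝ} (ham : |a| < m) (hς : ς ∈ Icc (0 : ℝ) 1)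
    (hr : rMinus a m < r) (hs : IsSol a m r ς W) (hs' : IsSol a m r ς W') : W = W' := by
  have hr0 : 0 < r := (rMinus_nonneg ham).trans_lt hr
  wlog hlt : W < W' generalizing W W'
  · rcases lt_trichotomy W W' with h | h | h
    · exact this hs hs' h
    · exact h
    · exact (this hs' hs h).symm
  exfalso
  have hmem : ∀ x ∈ Icc W W', ς * x ^ 2 < 1 ∧ 0 < solW a m r ς x := by
    intro x hx
    rcases le_or_gt (rPlus a m) r with h | h
    · have h0 : 0 ≤ x := (hs.nonneg hς h).trans hx.1
      have h2 : x ^ 2 ≤ W' ^ 2 := pow_le_pow_left₀ h0 hx.2 2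
      have h3 : ς * x ^ 2 < 1 := (mul_le_mul_of_nonneg_left h2 hς.1).trans_lt hs'.1
      have := solW_pos_of_bounds ham hς h3 h0 (h2.trans (hs'.bounds ham hς h).2) h
      exact ⟨h3, by linarith⟩
    · have h0 : x ≤ 0 := hx.2.trans (hs'.nonpos hς h.le)
      have h2 : x ^ 2 ≤ W ^ 2 := by nlinarith [hx.1]
      have h3 : ς * x ^ 2 < 1 := (mul_le_mul_of_nonneg_left h2 hς.1).trans_lt hs.1
      exact ⟨h3, solW_pos_of_nonpos ham hς h3 h0 hr⟩
  have hd : ∀ x ∈ Icc W W', HasDerivAt (fun W => solFun a m ((r, ς), W)) (solW a m r ς x) x :=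
    fun x hx => hasDerivAt_solFun_W (mem_ellDom (hmem x hx).1)
      (mem_radDom ham hr0 (kap_mem hς (hmem x hx).1.le))
  have hmono : StrictMonoOn (fun W => solFun a m ((r, ς), W)) (Icc W W') := by
    refine strictMonoOn_of_deriv_pos (convex_Icc _ _)
      (fun x hx => (hd x hx).continuousAt.continuousWithinAt) fun x hx => ?_
    rw [interior_Icc] at hx
    rw [(hd x (Ioo_subset_Icc_self hx)).deriv]
    exact (hmem x (Ioo_subset_Icc_self hx)).2
  have := hmono (left_mem_Icc.2 hlt.le) (right_mem_Icc.2 hlt.le) hlt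
  simp only [solFun, hs.2, hs'.2, sub_self, lt_irrefl] at this

/-- A value of `W` at which `H` exceeds every possible value of `|h|`. -/
theorem exists_ellH_ge {ς : ℝ} (hς : ς ∈ Icc (0 : ℝ) 1) :
    ∃ W, 0 ≤ W ∧ ς * W ^ 2 < 1 ∧ 6 / 7 ≤ ellH (ς, W) := by
  -- the constraint `ς W² < 1` allows `W = 1.67` for `ς ≤ 1/3`; for larger `ς` the smaller value
  -- `0.99` suffices because `ellPoly ≤ 1 + W² / 3`
  rcases le_or_gt ς (1 / 3) with h | h
  · have hp : ς * (1.67 : ℝ) ^ 2 < 1 := by norm_num; linarith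
    refine ⟨1.67, by norm_num, hp, le_trans ?_ (div_sqrt_le_ellH' hς hp (by norm_num))⟩
    rw [le_div_iff₀ (by positivity)]
    have : √(1 + 1.67 ^ 2 : ℝ) ≤ 1.947 := Real.sqrt_le_iff.2 ⟨by norm_num, by norm_num⟩
    linarith
  · have hp : ς * (0.99 : ℝ) ^ 2 < 1 := by norm_num; linarith [hς.2]
    refine ⟨0.99, by norm_num, hp, le_trans ?_ (div_sqrt_le_ellH (M := 1 + 1 / 3 * 0.99 ^ 2)
      (mem_ellDom hp) (by norm_num) fun w hw => (ellPoly_le hς hw).trans ?_)⟩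
    · rw [le_div_iff₀ (by positivity)]
      have : √(1 + 1 / 3 * 0.99 ^ 2 : ℝ) ≤ 1.152 := Real.sqrt_le_iff.2 ⟨by norm_num, by norm_num⟩
      linarith
    · have : max 0 (1 - 2 * ς) ≤ 1 / 3 := max_le (by norm_num) (by linarith)
      nlinarith

/-- The intermediate value theorem on `[-V, V]`, with `V` from `exists_ellH_ge`: by `radH_le` and
`radH_sq_le`, `|h| ≤ 6/7` on both sides of the horizon. -/
theorem exists_isSol {a m r ς : ℝ} (ham : |a| < m) (hς : ς ∈ Icc (0 : ℝ) 1) (hr : m ≤ r) :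
    ∃ W, IsSol a m r ς W := by
  have hm : 0 < m := (abs_nonneg a).trans_lt ham
  have hr0 : 0 < r := hm.trans_le hr
  obtain ⟨V, hV0, hV1, hV2⟩ := exists_ellH_ge hς
  have hle : ∀ x ∈ Icc (-V) V, ς * x ^ 2 < 1 := fun x hx => by
    have : x ^ 2 ≤ V ^ 2 := sq_le_sq' hx.1 hx.2
    exact (mul_le_mul_of_nonneg_left this hς.1).trans_lt hV1
  have hh : ∀ x ∈ Icc (-V) V, |radH a m (r, kap ς x)| ≤ 6 / 7 := fun x hx => by
    have hκ := kap_mem hς (hle x hx).le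
    rcases le_or_gt (rPlus a m) r with h | h
    · rw [abs_of_nonneg (radH_nonneg h)]
      have : 0 ≤ |a| / r := by positivity
      linarith [radH_le ham h hκ]
    · have := radH_sq_le ham hr h.le hκ
      refine abs_le_of_sq_le_sq ?_ (by norm_num)
      norm_num; linarith
  have hc : ContinuousOn (fun W => solFun a m ((r, ς), W)) (Icc (-V) V) := fun x hx =>
    (hasDerivAt_solFun_W (mem_ellDom (hle x hx))
      (mem_radDom ham hr0 (kap_mem hς (hle x hx).le))).continuousAt.continuousWithinAt
  have hVV : -V ≤ V := by linarith
  have h1 := (abs_le.1 (hh _ (right_mem_Icc.2 hVV))).2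
  have h2 := (abs_le.1 (hh _ (left_mem_Icc.2 hVV))).1
  obtain ⟨W, hW, h0⟩ := intermediate_value_Icc hVV hc (show (0 : ℝ) ∈ _ by
    constructor
    · simp only [solFun, ellH_neg]; linarith
    · simp only [solFun]; linarith)
  exact ⟨W, hle W hW, sub_eq_zero.1 h0⟩

/-! ### Positivity of the expansion -/

/-- The `r`-derivative of `radS`. -/
def radSr (a m r κ : ℝ) : ℝ :=
  (2 * r * (r ^ 2 + a ^ 2) - a ^ 2 * κ * (r - m)) / radS a m r κ

/-- `|q|²` times the d'Alembertian of the optical function, in terms of `r`, `ς` and `W`. Both null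
expansions are multiples of this quantity. -/
def expB (a m r ς W : ℝ) : ℝ :=
  radSr a m r (kap ς W)
    - a ^ 2 * kerrDelta a m r / radPoly a m r (kap ς W) * (|a| * (ς * (1 - ς) * W))
        / solW a m r ς W
    - |a| * ((2 - 3 * ς) * W)
    + |a| * (2 * (ς * (1 - ς)) * (ellHς ς W -
        radHκ a m r (kap ς W) * (1 + (1 - 2 * ς) * W ^ 2))) / solW a m r ς W

/-- The main term of `expB` outside the horizon, where `Σ ≤ r² + a²`. -/
theorem le_radSr_of_rPlus_le {a m r κ : ℝ} (ham : |a| < m) (hr : rPlus a m ≤ r)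
    (hκ : κ ∈ Icc (0 : ℝ) 1) : 3 / 2 * r ≤ radSr a m r κ := by
  have hm : 0 < m := (abs_nonneg a).trans_lt ham
  have hr1 : m < r := (lt_rPlus ham).trans_le hr
  have h0 := radPoly_pos (a := a) hm (hm.trans hr1) hκ
  have hS := radS_pos h0
  have h1 : radS a m r κ ≤ r ^ 2 + a ^ 2 := by
    refine Real.sqrt_le_iff.2 ⟨by positivity, ?_⟩
    have := mul_nonneg (mul_nonneg (sq_nonneg a) hκ.1) (kerrDelta_nonneg ham hr)
    unfold radPoly; linarith
  have h2 := sq_lt_sq_of_abs_lt ham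
  have h3 : a ^ 2 * κ * (r - m) ≤ a ^ 2 * r := by
    have : κ * (r - m) ≤ r := by nlinarith [hκ.1, hκ.2]
    nlinarith [sq_nonneg a]
  have h4 : a ^ 2 ≤ r ^ 2 := by nlinarith
  unfold radSr
  rw [le_div_iff₀ hS]
  nlinarith

/-- The main term of `expB` inside the horizon, where `Σ² ≤ (9/8) (r² + a²)²` by `neg_delta_le`. -/
theorem le_radSr_of_le_rPlus {a m r κ : ℝ} (ham : |a| < m) (hr1 : m ≤ r) (hr : r ≤ rPlus a m)
    (hκ : κ ∈ Icc (0 : ℝ) 1) : r ≤ radSr a m r κ := by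
  have hm : 0 < m := (abs_nonneg a).trans_lt ham
  have h0 := radPoly_pos (a := a) hm (hm.trans_le hr1) hκ
  have hS := radS_pos h0
  have h1 : radS a m r κ ≤ 11 / 10 * (r ^ 2 + a ^ 2) := by
    refine Real.sqrt_le_iff.2 ⟨by positivity, ?_⟩
    have h2 := neg_delta_le ham hr1
    have h3 := kerrDelta_nonpos ham ((rMinus_lt ham).le.trans hr1) hr
    have h4 : κ * (a ^ 2 * -kerrDelta a m r) ≤ a ^ 2 * -kerrDelta a m r :=
      mul_le_of_le_one_left (mul_nonneg (sq_nonneg a) (neg_nonneg.2 h3)) hκ.2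
    unfold radPoly; nlinarith
  have h2 := sq_lt_sq_of_abs_lt ham
  have h3 : a ^ 2 * κ * (r - m) ≤ a ^ 2 * r := by
    have : κ * (r - m) ≤ r := by nlinarith [hκ.1, hκ.2]
    nlinarith [sq_nonneg a]
  have h4 : a ^ 2 ≤ r ^ 2 := by nlinarith
  unfold radSr
  rw [le_div_iff₀ hS]
  nlinarith [mul_le_mul_of_nonneg_left h1 (hm.trans_le hr1).le]

theorem mul_one_sub_le {ς : ℝ} : ς * (1 - ς) ≤ 1 / 4 := by nlinarith [sq_nonneg (ς - 1 / 2)]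

/-- The main term is at least `3 r / 2`. By `W ≤ 2 h` each of the three corrections is bounded by a
multiple of `|a| h`, and `|a| h ≤ (6/7) |a| (1 - |a|/r) ≤ (3/14) r`; in total the corrections are
less than `r`. -/
theorem expB_pos_of_rPlus_le {a m r ς W : ℝ} (ham : |a| < m) (hς : ς ∈ Icc (0 : ℝ) 1)
    (hs : IsSol a m r ς W) (hr : rPlus a m ≤ r) : 0 < expB a m r ς W := by
  have hα := abs_nonneg a
  have hm : 0 < m := hα.trans_lt ham
  have hr1 : m < r := (lt_rPlus ham).trans_le hr
  have hr0 : 0 < r := hm.trans hr1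
  have hκ := kap_mem hς hs.1.le
  have h0 := radPoly_pos (a := a) hm hr0 hκ
  have hW := hs.nonneg hς hr
  obtain ⟨hW1, hW2⟩ := hs.bounds ham hς hr
  have hq := solW_pos_of_bounds ham hς hs.1 hW hW2 hr
  have hh := radH_le ham hr hκ
  have hh0 := radH_nonneg (κ := kap ς W) hr
  have hk := radHκ_le ham hr hκ
  have hk0 := radHκ_nonneg (κ := kap ς W) ham ((rMinus_lt ham).trans hr1)
  have hH := ellHς_nonneg (mem_ellDom hs.1) hW
  have hS := le_radSr_of_rPlus_le ham hr hκ
  have hd := delta_le_radPoly ham hr hκ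
  set h := radH a m (r, kap ς W)
  set k := radHκ a m r (kap ς W)
  have hb0 : 0 ≤ ς * (1 - ς) := mul_nonneg hς.1 (sub_nonneg.2 hς.2)
  have hb := mul_one_sub_le (ς := ς)
  have hqpos : 0 < solW a m r ς W := by linarith
  have t1 : a ^ 2 * kerrDelta a m r / radPoly a m r (kap ς W) * (|a| * (ς * (1 - ς) * W))
        / solW a m r ς W ≤ |a| * W * (9 / 80) := by
    rw [div_le_iff₀ hqpos]
    have e1 : a ^ 2 * kerrDelta a m r / radPoly a m r (kap ς W) ≤ 1 / 20 := by
      rw [div_le_iff₀ h0]; linarith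
    have e2 : |a| * (ς * (1 - ς) * W) ≤ |a| * W * (1 / 4) := by
      nlinarith [mul_nonneg hα hW]
    have e3 : 0 ≤ |a| * (ς * (1 - ς) * W) := by positivity
    have e4 := mul_nonneg hα hW
    calc _ ≤ 1 / 20 * (|a| * W * (1 / 4)) := mul_le_mul e1 e2 e3 (by norm_num)
      _ ≤ _ := by nlinarith
  have t2 : -(|a| * h * (43 / 100)) ≤ |a| * (2 * (ς * (1 - ς)) * (ellHς ς W -
        k * (1 + (1 - 2 * ς) * W ^ 2))) / solW a m r ς W := by
    rw [le_div_iff₀ hqpos]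
    have e1 : k * (1 + (1 - 2 * ς) * W ^ 2) ≤ h / 40 * (49 / 13) := by
      have : 1 + (1 - 2 * ς) * W ^ 2 ≤ 49 / 13 := by nlinarith [hς.1, sq_nonneg W]
      nlinarith
    have e2 : -(1 / 2 * (h / 40 * (49 / 13))) ≤
        2 * (ς * (1 - ς)) * (ellHς ς W - k * (1 + (1 - 2 * ς) * W ^ 2)) := by nlinarith
    have e3 := mul_le_mul_of_nonneg_left e2 hα
    have e4 := mul_nonneg hα hh0
    nlinarith
  have t3 : |a| * ((2 - 3 * ς) * W) ≤ |a| * (2 * W) :=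
    mul_le_mul_of_nonneg_left (by nlinarith [hς.1]) hα
  have t4 : |a| * W ≤ |a| * (2 * h) := mul_le_mul_of_nonneg_left hW1 hα
  have t5 : |a| * h ≤ 6 / 7 * (r / 4) := by
    have e1 := mul_le_mul_of_nonneg_left hh hα
    have e2 : |a| * (1 - |a| / r) ≤ r / 4 := by
      have : |a| * (1 - |a| / r) = r / 4 - (r / 2 - |a|) ^ 2 / r := by field_simp; ring
      rw [this]
      have : 0 ≤ (r / 2 - |a|) ^ 2 / r := by positivity
      linarith
    nlinarith
  unfold expB
  nlinarith

/-- The main term is at least `r ≥ m > |a|`, and since `h² ≤ 1/8` forces `|W| ≤ 0.38`, the three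
corrections add up to less than `|a| / 2`. -/
theorem expB_pos_of_le_rPlus {a m r ς W : ℝ} (ham : |a| < m) (hς : ς ∈ Icc (0 : ℝ) 1)
    (hs : IsSol a m r ς W) (hr1 : m ≤ r) (hr : r ≤ rPlus a m) : 0 < expB a m r ς W := by
  have hα := abs_nonneg a
  have hm : 0 < m := hα.trans_lt ham
  have hr0 : 0 < r := hm.trans_le hr1
  have hr2 : rMinus a m < r := (rMinus_lt ham).trans_le hr1
  have hκ := kap_mem hς hs.1.le
  have h0 := radPoly_pos (a := a) hm hr0 hκ
  have hW := hs.nonpos hς hr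
  obtain ⟨V, rfl⟩ : ∃ V, W = -V := ⟨-W, by ring⟩
  have hV : 0 ≤ V := by linarith
  have hp : ς * V ^ 2 < 1 := by simpa using hs.1
  have hh0 := radH_nonpos (a := a) (m := m) (κ := kap ς (-V)) hr
  have hh := radH_sq_le ham hr1 hr hκ
  have hk := radHκ_le_of_le ham hr1 hr hκ
  have hk0 := radHκ_nonneg (κ := kap ς (-V)) ham hr2
  have hS := le_radSr_of_le_rPlus ham hr1 hr hκ
  have hd := (neg_delta_le ham hr1).trans (sq_le_radPoly ham hr2.le hr hκ.1)
  have hd0 := kerrDelta_nonpos ham hr2.le hr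
  have hVh : V ^ 2 ≤ radH a m (r, kap ς (-V)) ^ 2 * (1 + V ^ 2) := by
    rw [← neg_sq (radH a m _)]
    refine sq_le_of_ellH_le hς hp hV ?_
    rw [← hs.2, ellH_neg, neg_neg]
  have hq0 : radHκ a m r (kap ς (-V)) * (2 * ς * (1 - ς) * -V) ≤ 0 :=
    mul_nonpos_of_nonneg_of_nonpos hk0 (mul_nonpos_of_nonneg_of_nonpos
      (mul_nonneg (by linarith [hς.1]) (sub_nonneg.2 hς.2)) hW)
  set h := radH a m (r, kap ς (-V))
  set k := radHκ a m r (kap ς (-V))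
  have hV2 : V ^ 2 ≤ 1 / 7 := by
    linarith [mul_le_mul_of_nonneg_right hh (by positivity : 0 ≤ 1 + V ^ 2)]
  have hV3 : V ≤ 38 / 100 := abs_le_of_sq_le_sq' (by linarith) (by norm_num) |>.2
  have hh3 : -h ≤ 36 / 100 :=
    abs_le_of_sq_le_sq' (by rw [neg_sq]; linarith) (by norm_num) |>.2
  have hH := ellHς_le hς hV hV2
  have hb0 : 0 ≤ ς * (1 - ς) := mul_nonneg hς.1 (sub_nonneg.2 hς.2)
  have hb := mul_one_sub_le (ς := ς)
  have hq : 4 / 5 ≤ solW a m r ς (-V) := by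
    have h1 := le_ellHW (M := 8 / 7) hς (mem_ellDom hp)
      fun w hw => (ellPoly_le' hς hw).trans (by linarith)
    have h2 : √(8 / 7 : ℝ) ≤ 1.07 := Real.sqrt_le_iff.2 ⟨by norm_num, by norm_num⟩
    have h3 : (1 : ℝ) / (8 / 7 * 1.07) ≤ 1 / (8 / 7 * √(8 / 7)) :=
      one_div_le_one_div_of_le (by positivity) (by linarith)
    unfold solW
    rw [ellHW_neg]
    norm_num at h1 h3 ⊢
    linarith
  have hqpos : 0 < solW a m r ς (-V) := by linarith
  have t1 : a ^ 2 * kerrDelta a m r / radPoly a m r (kap ς (-V)) * (|a| * (ς * (1 - ς) * -V))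
        / solW a m r ς (-V) ≤ |a| * (2 / 100) := by
    rw [div_le_iff₀ hqpos]
    have e1 : -(a ^ 2 * kerrDelta a m r / radPoly a m r (kap ς (-V))) ≤ 1 / 8 := by
      rw [← neg_div, div_le_iff₀ h0]; linarith
    have e2 : |a| * (ς * (1 - ς) * V) ≤ |a| * (1 / 4 * (38 / 100)) :=
      mul_le_mul_of_nonneg_left (mul_le_mul hb hV3 hV (by norm_num)) hα
    have e3 : 0 ≤ |a| * (ς * (1 - ς) * V) := by positivity
    have e5 := mul_le_mul e1 e2 e3 (by norm_num)
    calc _ = -(a ^ 2 * kerrDelta a m r / radPoly a m r (kap ς (-V))) *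
          (|a| * (ς * (1 - ς) * V)) := by ring
      _ ≤ _ := e5
      _ ≤ |a| * (2 / 100) * (4 / 5) := by linarith
      _ ≤ _ := mul_le_mul_of_nonneg_left hq (by positivity)
  have t2 : -(|a| * (8 / 100)) ≤ |a| * (2 * (ς * (1 - ς)) * (ellHς ς (-V) -
        k * (1 + (1 - 2 * ς) * (-V) ^ 2))) / solW a m r ς (-V) := by
    rw [le_div_iff₀ hqpos, ellHς_neg]
    have e1 : k * (1 + (1 - 2 * ς) * (-V) ^ 2) ≤ 36 / 1600 * (8 / 7) := by
      have h1 : 1 + (1 - 2 * ς) * (-V) ^ 2 ≤ 8 / 7 := by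
        linarith [mul_nonneg hς.1 (sq_nonneg V), neg_sq V,
          show (1 - 2 * ς) * (-V) ^ 2 = V ^ 2 - 2 * (ς * V ^ 2) by ring]
      calc k * (1 + (1 - 2 * ς) * (-V) ^ 2) ≤ k * (8 / 7) := mul_le_mul_of_nonneg_left h1 hk0
        _ ≤ _ := by linarith
    have e2 : -(64 / 1000) ≤
        2 * (ς * (1 - ς)) * (-ellHς ς V - k * (1 + (1 - 2 * ς) * (-V) ^ 2)) := by
      have h1 : -(122 / 1000) ≤ -ellHς ς V - k * (1 + (1 - 2 * ς) * (-V) ^ 2) := by linarith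
      nlinarith [mul_le_mul_of_nonneg_left h1 hb0]
    have e3 := mul_le_mul_of_nonneg_left e2 hα
    have e4 : |a| * (8 / 100) * (4 / 5) ≤ |a| * (8 / 100) * solW a m r ς (-V) :=
      mul_le_mul_of_nonneg_left hq (by positivity)
    linarith
  have t3 : |a| * ((2 - 3 * ς) * -V) ≤ |a| * (38 / 100) :=
    mul_le_mul_of_nonneg_left (by linarith [mul_nonneg (sub_nonneg.2 hς.2) hV,
      show (2 - 3 * ς) * -V = V - 3 * ((1 - ς) * V) by ring]) hα
  unfold expB
  linarith

theorem IsSol.expB_pos {a m r ς W : ℝ} (ham : |a| < m) (hς : ς ∈ Icc (0 : ℝ) 1)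
    (hs : IsSol a m r ς W) (hr : m ≤ r) : 0 < expB a m r ς W := by
  rcases le_or_gt (rPlus a m) r with h | h
  · exact expB_pos_of_rPlus_le ham hς hs h
  · exact expB_pos_of_le_rPlus ham hς hs hr h.le

/-! ### The Pretorius–Israel function in the variable `W` -/

/-- The substitution `sin² t = ς (1 + (1 - ς) V² (1 - w²))`, `ς = sin² θ`, from `t ∈ (θ, τ)` to
`w ∈ (0, 1)`. -/
theorem integral_subst {θ τ V : ℝ} (hθ : 0 < θ) (hθτ : θ < τ) (hτ : τ < Real.pi / 2) (hV : 0 < V)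
    (hk : Real.sin τ ^ 2 = kap (Real.sin θ ^ 2) V) (G : ℝ → ℝ) :
    ∫ w in (0 : ℝ)..1, V / √(ellPoly (Real.sin θ ^ 2) V w) * G w =
      ∫ t in θ..τ, 1 / √(Real.sin τ ^ 2 - Real.sin t ^ 2) *
        G (√((Real.sin τ ^ 2 - Real.sin t ^ 2) /
          (Real.sin θ ^ 2 * (1 - Real.sin θ ^ 2) * V ^ 2))) := by
  set ς := Real.sin θ ^ 2 with hς
  have hmono : ∀ x y : ℝ, 0 ≤ x → x < y → y ≤ Real.pi / 2 → Real.sin x ^ 2 < Real.sin y ^ 2 := by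
    intro x y hx hxy hy
    refine pow_lt_pow_left₀ (Real.strictMonoOn_sin ⟨by linarith, by linarith⟩
      ⟨by linarith, hy⟩ hxy) (Real.sin_nonneg_of_nonneg_of_le_pi hx (by linarith)) two_ne_zero
  have hς0 : 0 < ς := by
    have := hmono 0 θ le_rfl hθ (by linarith); simpa using this
  have hς1 : ς < 1 := by
    have := hmono θ (Real.pi / 2) hθ.le (by linarith) le_rfl
    rwa [Real.sin_pi_div_two, one_pow] at this
  have hb : 0 < ς * (1 - ς) := mul_pos hς0 (sub_pos.2 hς1)
  set D := ς * (1 - ς) * V ^ 2 with hD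
  have hD0 : 0 < D := by positivity
  have hkD : Real.sin τ ^ 2 = ς + D := by rw [hk, kap, hD]; ring
  set f : ℝ → ℝ := fun t => √((Real.sin τ ^ 2 - Real.sin t ^ 2) / D) with hf
  have hfc : Continuous f := by fun_prop
  have hpos : ∀ t ∈ Ioo θ τ, 0 < (Real.sin τ ^ 2 - Real.sin t ^ 2) / D := fun t ht =>
    div_pos (sub_pos.2 (hmono t τ (hθ.trans ht.1).le ht.2 hτ.le)) hD0
  have himg : f '' Ioo θ τ = Ioo 0 1 := by
    apply Subset.antisymm
    · rintro _ ⟨t, ht, rfl⟩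
      refine ⟨Real.sqrt_pos.2 (hpos t ht), ?_⟩
      rw [hf]
      simp only
      rw [Real.sqrt_lt' one_pos, one_pow, div_lt_one hD0, hkD]
      linarith [hmono θ t hθ.le ht.1 (ht.2.trans hτ).le]
    · have := intermediate_value_Ioo' hθτ.le hfc.continuousOn
      have e1 : f τ = 0 := by simp [hf]
      have e2 : f θ = 1 := by
        rw [hf]; simp only
        rw [hkD, ← hς, add_sub_cancel_left, div_self hD0.ne', Real.sqrt_one]
      rwa [e1, e2] at this
  have hderiv : ∀ t ∈ Ioo θ τ, HasDerivAt f (-(Real.sin t * Real.cos t) / (D * f t)) t := by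
    intro t ht
    have h1 : HasDerivAt (fun t => (Real.sin τ ^ 2 - Real.sin t ^ 2) / D)
        (-(2 * Real.sin t * Real.cos t) / D) t := by
      refine ((((Real.hasDerivAt_sin t).pow 2).const_sub _).div_const D).congr_deriv ?_
      push_cast; ring
    refine (h1.sqrt (hpos t ht).ne').congr_deriv ?_
    have := Real.sqrt_pos.2 (hpos t ht)
    simp only [hf]
    field_simp
  have hinj : InjOn f (Ioo θ τ) := by
    intro x hx y hy hxy
    have h1 := (Real.sqrt_inj (hpos x hx).le (hpos y hy).le).1 hxy
    rw [div_left_inj' hD0.ne', sub_right_inj] at h1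
    rcases lt_trichotomy x y with h | h | h
    · exact absurd h1 (hmono x y (hθ.trans hx.1).le h (hy.2.trans hτ).le).ne
    · exact h
    · exact absurd h1 (hmono y x (hθ.trans hy.1).le h (hx.2.trans hτ).le).ne'
  have key := MeasureTheory.integral_image_eq_integral_abs_deriv_smul measurableSet_Ioo
    (fun t ht => (hderiv t ht).hasDerivWithinAt) hinj (fun w => V / √(ellPoly ς V w) * G w)
  rw [himg] at key
  rw [intervalIntegral.integral_of_le zero_le_one, intervalIntegral.integral_of_le hθτ.le,
    MeasureTheory.integral_Ioc_eq_integral_Ioo, MeasureTheory.integral_Ioc_eq_integral_Ioo, key]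
  refine MeasureTheory.setIntegral_congr_fun measurableSet_Ioo fun t ht => ?_
  have hs : 0 < Real.sin t := Real.sin_pos_of_pos_of_lt_pi (hθ.trans ht.1)
    (by linarith [ht.2, Real.pi_pos])
  have hc : 0 < Real.cos t := Real.cos_pos_of_mem_Ioo ⟨by linarith [ht.1, Real.pi_pos],
    by linarith [ht.2]⟩
  have hft : 0 < f t := Real.sqrt_pos.2 (hpos t ht)
  have hft2 : f t ^ 2 = (Real.sin τ ^ 2 - Real.sin t ^ 2) / D := Real.sq_sqrt (hpos t ht).le
  have hft3 : D * f t ^ 2 = Real.sin τ ^ 2 - Real.sin t ^ 2 := by rw [hft2]; field_simp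
  have hB : 0 < √(ς * (1 - ς)) := Real.sqrt_pos.2 hb
  have hB2 : √(ς * (1 - ς)) ^ 2 = ς * (1 - ς) := Real.sq_sqrt hb.le
  have hP : √(ellPoly ς V (f t)) = Real.sin t * Real.cos t / √(ς * (1 - ς)) := by
    rw [← Real.sqrt_sq (show 0 ≤ Real.sin t * Real.cos t / √(ς * (1 - ς)) by positivity), div_pow,
      hB2, mul_pow, Real.cos_sq']
    congr 1
    rw [eq_div_iff hb.ne']
    have e1 : Real.sin t ^ 2 = ς * (1 + (1 - ς) * V ^ 2 * (1 - f t ^ 2)) := by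
      have : Real.sin t ^ 2 = ς + D - D * f t ^ 2 := by rw [hft3, hkD]; ring
      rw [this, hD]; ring
    rw [e1]; unfold ellPoly; ring
  have hsq : √(Real.sin τ ^ 2 - Real.sin t ^ 2) = √(ς * (1 - ς)) * V * f t := by
    rw [← hft3, ← Real.sqrt_sq (show 0 ≤ √(ς * (1 - ς)) * V * f t by positivity), mul_pow, mul_pow,
      hB2]
  simp only [smul_eq_mul]
  rw [hP, hsq, abs_div, abs_neg, abs_of_pos (mul_pos hs hc), abs_of_pos (mul_pos hD0 hft)]
  change Real.sin t * Real.cos t / (D * f t) * (_ * G (f t)) = _ * G (f t)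
  have hne : 1 - ς ≠ 0 := (sub_pos.2 hς1).ne'
  rw [hD]
  field_simp
  rw [hB2]

/-- The angular integrals for an end point `τ ≥ θ` correspond to values `V ≥ 0` of the variable `W`.
-/
theorem integral_eq_ellH {θ τ V : ℝ} (hθ : 0 < θ) (hθτ : θ ≤ τ) (hτ : τ < Real.pi / 2)
    (hV : 0 ≤ V) (hk : Real.sin τ ^ 2 = kap (Real.sin θ ^ 2) V) :
    (∫ t in τ..θ, 1 / √(Real.sin τ ^ 2 - Real.sin t ^ 2)) = -ellH (Real.sin θ ^ 2, V) ∧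
      (∫ t in τ..θ, √(Real.sin τ ^ 2 - Real.sin t ^ 2)) = -ellK (Real.sin θ ^ 2, V) := by
  have hs : 0 < Real.sin θ := Real.sin_pos_of_pos_of_lt_pi hθ (by linarith [Real.pi_pos])
  have hc : 0 < Real.cos θ := Real.cos_pos_of_mem_Ioo ⟨by linarith, by linarith⟩
  have hς1 : 0 < 1 - Real.sin θ ^ 2 := by rw [← Real.cos_sq']; positivity
  have hinj : Real.sin τ ^ 2 = Real.sin θ ^ 2 → τ = θ := fun h => by
    refine Real.injOn_sin ⟨by linarith, by linarith⟩ ⟨by linarith, by linarith⟩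
      ((pow_left_inj₀ (Real.sin_nonneg_of_nonneg_of_le_pi (by linarith) (by linarith)) hs.le
        two_ne_zero).1 h)
  rcases hV.eq_or_lt with h | h
  · subst h
    have : τ = θ := hinj (by rw [hk]; unfold kap; ring)
    subst this
    simp [ellH, ellK]
  have hlt : θ < τ := by
    refine hθτ.lt_of_ne fun e => ?_
    rw [← e] at hk
    have : 0 < Real.sin θ ^ 2 * ((1 - Real.sin θ ^ 2) * V ^ 2) := by positivity
    have e2 : kap (Real.sin θ ^ 2) V =
      Real.sin θ ^ 2 + Real.sin θ ^ 2 * ((1 - Real.sin θ ^ 2) * V ^ 2) := by unfold kap; ring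
    linarith
  have hD : 0 < Real.sin θ ^ 2 * (1 - Real.sin θ ^ 2) * V ^ 2 := by positivity
  constructor
  · have h1 := integral_subst hθ hlt hτ h hk (fun _ => 1)
    simp only [mul_one] at h1
    rw [intervalIntegral.integral_symm, ellH, h1]
  · have h1 := integral_subst hθ hlt hτ h hk
      (fun w => Real.sin θ ^ 2 * (1 - Real.sin θ ^ 2) * V ^ 2 * w ^ 2)
    have h3 : ellK (Real.sin θ ^ 2, V) = ∫ w in (0 : ℝ)..1, V / √(ellPoly (Real.sin θ ^ 2) V w) *
        (Real.sin θ ^ 2 * (1 - Real.sin θ ^ 2) * V ^ 2 * w ^ 2) :=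
      intervalIntegral.integral_congr fun w _ => by ring
    rw [intervalIntegral.integral_symm, neg_inj, h3, h1]
    refine intervalIntegral.integral_congr fun t ht => ?_
    rw [uIcc_of_le hθτ] at ht
    have h2 : 0 ≤ Real.sin τ ^ 2 - Real.sin t ^ 2 := by
      refine sub_nonneg.2 (pow_le_pow_left₀ (Real.sin_nonneg_of_nonneg_of_le_pi
        (hθ.le.trans ht.1) (by linarith [ht.2])) (Real.monotoneOn_sin ⟨by linarith [ht.1],
          by linarith [ht.2]⟩ ⟨by linarith, by linarith⟩ ht.2) 2)
    rw [Real.sq_sqrt (div_nonneg h2 hD.le), mul_div_cancel₀ _ hD.ne', one_div_mul_eq_div,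
      Real.div_sqrt]

theorem piFun_eq {a m r θ τ V : ℝ} (hθ : 0 < θ) (hθτ : θ ≤ τ) (hτ : τ < Real.pi / 2)
    (hV : 0 ≤ V) (hk : Real.sin τ ^ 2 = kap (Real.sin θ ^ 2) V) :
    piFun a m r θ τ = -ellH (Real.sin θ ^ 2, V) +
      Real.sign (r - rPlus a m) * radH a m (r, kap (Real.sin θ ^ 2) V) := by
  rw [piFun, (integral_eq_ellH hθ hθτ hτ hV hk).1, ← hk]
  rfl

theorem piRho_eq {a m r θ τ V : ℝ} (hθ : 0 < θ) (hθτ : θ ≤ τ) (hτ : τ < Real.pi / 2)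
    (hV : 0 ≤ V) (hk : Real.sin τ ^ 2 = kap (Real.sin θ ^ 2) V) :
    piRho a m r θ τ = radA a m (r, kap (Real.sin θ ^ 2) V) +
      Real.sign (r - rPlus a m) * (|a| * ellK (Real.sin θ ^ 2, V)) := by
  rw [piRho, intervalIntegral.integral_const_mul, (integral_eq_ellH hθ hθτ hτ hV hk).2, ← hk]
  simp only [radA, kerrSigma_eq]
  ring

theorem radH_rPlus (a m κ : ℝ) : radH a m (rPlus a m, κ) = 0 := by simp [radH]

/-- A zero of `piFun` gives a solution `W`, with the sign of `r - r₊`. -/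
theorem isSol_of_piFun_eq_zero {a m r θ τ : ℝ} (hθ : 0 < θ) (hθτ : θ ≤ τ) (hτ : τ < Real.pi / 2)
    (h0 : piFun a m r θ τ = 0) : ∃ W, IsSol a m r (Real.sin θ ^ 2) W ∧
      piRho a m r θ τ = radA a m (r, kap (Real.sin θ ^ 2) W) + |a| * ellK (Real.sin θ ^ 2, W) := by
  have hs : 0 < Real.sin θ := Real.sin_pos_of_pos_of_lt_pi hθ (by linarith [Real.pi_pos])
  have hc : 0 < Real.cos θ := Real.cos_pos_of_mem_Ioo ⟨by linarith, by linarith⟩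
  have hcτ : 0 < Real.cos τ := Real.cos_pos_of_mem_Ioo ⟨by linarith, by linarith⟩
  have hle : Real.sin θ ^ 2 ≤ Real.sin τ ^ 2 := pow_le_pow_left₀ hs.le
    (Real.monotoneOn_sin ⟨by linarith, by linarith⟩ ⟨by linarith, by linarith⟩ hθτ) 2
  have hτ1 : Real.sin τ ^ 2 < 1 := by nlinarith [Real.sin_sq_add_cos_sq τ]
  have hς1 : 0 < 1 - Real.sin θ ^ 2 := by rw [← Real.cos_sq']; positivity
  have hς0 : 0 < Real.sin θ ^ 2 := by positivity
  have hmem : Real.sin θ ^ 2 ∈ Icc (0 : ℝ) 1 := ⟨hς0.le, by linarith⟩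
  set ς := Real.sin θ ^ 2 with hς
  set V := √((Real.sin τ ^ 2 - ς) / (ς * (1 - ς))) with hVdef
  have hV : 0 ≤ V := Real.sqrt_nonneg _
  have hV2 : V ^ 2 = (Real.sin τ ^ 2 - ς) / (ς * (1 - ς)) :=
    Real.sq_sqrt (div_nonneg (by linarith) (by positivity))
  have hk : Real.sin τ ^ 2 = kap ς V := by
    unfold kap; rw [hV2]; field_simp; ring
  have hp : ς * V ^ 2 < 1 := by
    rw [hV2, ← mul_div_assoc, div_lt_one (by positivity)]
    nlinarith
  have e1 := piFun_eq (a := a) (m := m) (r := r) hθ hθτ hτ hV hk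
  have e2 := piRho_eq (a := a) (m := m) (r := r) hθ hθτ hτ hV hk
  rw [h0] at e1
  rw [← hς] at e1 e2
  rcases lt_trichotomy r (rPlus a m) with h | h | h
  · rw [Real.sign_of_neg (sub_neg.2 h)] at e1 e2
    refine ⟨-V, ⟨by simpa using hp, ?_⟩, ?_⟩
    · rw [ellH_neg, kap_neg]; linarith
    · rw [ellK_neg, kap_neg, e2]; ring
  · subst h
    simp only [sub_self, Real.sign_zero, zero_mul, add_zero] at e1 e2
    have hV0 : V = 0 := by
      by_contra hne
      have := ellH_pos hmem hp (lt_of_le_of_ne hV (Ne.symm hne))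
      linarith
    refine ⟨V, ⟨hp, ?_⟩, ?_⟩
    · rw [radH_rPlus]; linarith
    · rw [e2, hV0]; simp [ellK]
  · rw [Real.sign_of_pos (sub_pos.2 h)] at e1 e2
    exact ⟨V, ⟨hp, by linarith⟩, by rw [e2]; ring⟩

/-- Conversely to `isSol_of_piFun_eq_zero`, a solution `W` gives the zero `arcsin √κ` of `piFun`. -/
theorem exists_piFun_eq_zero {a m r θ W : ℝ} (hθ : θ ∈ Ioo 0 (Real.pi / 2))
    (hs : IsSol a m r (Real.sin θ ^ 2) W) :
    ∃ τ ∈ Ico θ (Real.pi / 2), piFun a m r θ τ = 0 := by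
  have hsθ : 0 < Real.sin θ := Real.sin_pos_of_pos_of_lt_pi hθ.1 (by linarith [Real.pi_pos, hθ.2])
  have hc : 0 < Real.cos θ := Real.cos_pos_of_mem_Ioo ⟨by linarith [hθ.1, Real.pi_pos], hθ.2⟩
  have hς1 : 0 < 1 - Real.sin θ ^ 2 := by rw [← Real.cos_sq']; positivity
  have hmem : Real.sin θ ^ 2 ∈ Icc (0 : ℝ) 1 := ⟨by positivity, by linarith⟩
  have hk1 : kap (Real.sin θ ^ 2) W < 1 := by
    have : 1 - kap (Real.sin θ ^ 2) W = (1 - Real.sin θ ^ 2) * (1 - Real.sin θ ^ 2 * W ^ 2) := by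
      unfold kap; ring
    have := mul_pos hς1 (sub_pos.2 hs.1)
    linarith
  have hk0 : Real.sin θ ^ 2 ≤ kap (Real.sin θ ^ 2) W := by
    have : 0 ≤ Real.sin θ ^ 2 * ((1 - Real.sin θ ^ 2) * W ^ 2) := by positivity
    unfold kap; nlinarith
  have hkn := (kap_mem hmem hs.1.le).1
  set κ := kap (Real.sin θ ^ 2) W with hκ
  have hsin : Real.sin (Real.arcsin √κ) = √κ :=
    Real.sin_arcsin (by linarith [Real.sqrt_nonneg κ]) (Real.sqrt_le_one.2 hk1.le)
  have hτ : Real.arcsin √κ < Real.pi / 2 := by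
    rw [Real.arcsin_lt_pi_div_two, Real.sqrt_lt' one_pos]; simpa using hk1
  have hθτ : θ ≤ Real.arcsin √κ := by
    rw [Real.le_arcsin_iff_sin_le' ⟨by linarith [hθ.1, Real.pi_pos], hθ.2.le⟩]
    exact Real.le_sqrt_of_sq_le hk0
  have hk : Real.sin (Real.arcsin √κ) ^ 2 = kap (Real.sin θ ^ 2) |W| := by
    rw [hsin, Real.sq_sqrt hkn, hκ]; unfold kap; rw [sq_abs]
  refine ⟨_, ⟨hθτ, hτ⟩, ?_⟩
  rw [piFun_eq hθ.1 hθτ hτ (abs_nonneg W) hk, ← hk, hsin, Real.sq_sqrt hkn]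
  have h2 := hs.2
  rw [← hκ] at h2
  rcases lt_trichotomy r (rPlus a m) with h | h | h
  · have hW := hs.nonpos hmem h.le
    rw [Real.sign_of_neg (sub_neg.2 h), abs_of_nonpos hW, ellH_neg, h2]; ring
  · have h3 := hs.nonneg hmem h.ge
    have h4 := hs.nonpos hmem h.le
    have : W = 0 := le_antisymm h4 h3
    subst h
    simp [this, ellH_zero]
  · have hW := hs.nonneg hmem h.le
    rw [Real.sign_of_pos (sub_pos.2 h), abs_of_nonneg hW, h2]; ring

/-- The function `f_*` in terms of a solution `W`. At the axis and at the equator, where `θ_*` is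
`θ` by definition, `κ` does not depend on `W` and `ellK` vanishes, so the formula holds there too.
-/
theorem fStar_eq {a m r θ W : ℝ} (ham : |a| < m) (hr : rMinus a m < r)
    (hθ : θ ∈ Icc 0 Real.pi) (hs : IsSol a m r (Real.sin θ ^ 2) W) :
    fStar a m r θ =
      radA a m (r, kap (Real.sin θ ^ 2) W) + |a| * ellK (Real.sin θ ^ 2, W) := by
  unfold fStar
  simp only
  set ϑ := min θ (Real.pi - θ) with hϑ
  have hsin : Real.sin ϑ = Real.sin θ := by
    rcases min_choice θ (Real.pi - θ) with h | h <;> rw [hϑ, h]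
    rw [Real.sin_pi_sub]
  have h0 : 0 ≤ ϑ := le_min hθ.1 (by linarith [hθ.2])
  have h1 : ϑ ≤ Real.pi / 2 := by
    rcases le_or_gt θ (Real.pi / 2) with h | h
    · exact (min_le_left _ _).trans h
    · exact (min_le_right _ _).trans (by linarith)
  rw [← hsin] at hs ⊢
  have hmem : Real.sin ϑ ^ 2 ∈ Icc (0 : ℝ) 1 := ⟨sq_nonneg _, Real.sin_sq_le_one ϑ⟩
  have hboundary : ∀ h : ϑ ∉ Ioo 0 (Real.pi / 2), thetaStar a m r ϑ = ϑ := fun h => by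
    unfold thetaStar
    rw [dif_neg (fun h' => h h'.1)]
  rcases h0.eq_or_lt with h | h
  · rw [hboundary (fun h' => by linarith [h'.1]), ← h]
    simp [piRho, radA, kap, ellK, kerrSigma_eq]
  rcases h1.eq_or_lt with h' | h'
  · rw [hboundary (fun h'' => by linarith [h''.2]), h']
    simp [piRho, radA, kap, ellK, kerrSigma_eq]
  have hex : ϑ ∈ Ioo 0 (Real.pi / 2) ∧ ∃ τ ∈ Ico ϑ (Real.pi / 2), piFun a m r ϑ τ = 0 :=
    ⟨⟨h, h'⟩, exists_piFun_eq_zero ⟨h, h'⟩ hs⟩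
  have hts : thetaStar a m r ϑ ∈ Ico ϑ (Real.pi / 2) ∧ piFun a m r ϑ (thetaStar a m r ϑ) = 0 := by
    unfold thetaStar
    rw [dif_pos hex]
    exact hex.2.choose_spec
  obtain ⟨W', hW', he⟩ := isSol_of_piFun_eq_zero h hts.1.1 hts.1.2 hts.2
  rw [he, hs.unique ham hmem hr hW']

/-! ### Regularity of the optical function -/

theorem isInvertible_of_apply_one_ne_zero {L : ℝ →L[ℝ] ℝ} (h : L 1 ≠ 0) : L.IsInvertible := by
  refine ⟨ContinuousLinearEquiv.unitsEquivAut ℝ (Units.mk0 (L 1) h), ?_⟩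
  ext
  simp

/-- A solution of the equation for `θ_*` extends to a `C¹` function of `(r, ς)`, also for values
of `ς` outside `[0, 1]`. -/
theorem IsSol.exists_contDiffAt {a m r ς W : ℝ} (ham : |a| < m) (hς : ς ∈ Icc (0 : ℝ) 1)
    (hr : rMinus a m < r) (hs : IsSol a m r ς W) :
    ∃ g : ℝ × ℝ → ℝ, ContDiffAt ℝ 1 g (r, ς) ∧ g (r, ς) = W ∧
      ∀ᶠ q in 𝓝 (r, ς), (q.2, g q) ∈ ellDom ∧ (q.1, kap q.2 (g q)) ∈ radDom a m ∧
        ellH (q.2, g q) = radH a m (q.1, kap q.2 (g q)) := by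
  have h1 := mem_ellDom hs.1
  have h2 := mem_radDom ham ((rMinus_nonneg ham).trans_lt hr) (kap_mem hς hs.1.le)
  have hcd : ContDiffAt ℝ 1 (solFun a m) ((r, ς), W) := contDiffAt_solFun h1 h2
  have hinv : (fderiv ℝ (solFun a m) ((r, ς), W) ∘L .inr ℝ (ℝ × ℝ) ℝ).IsInvertible := by
    apply isInvertible_of_apply_one_ne_zero
    have e : fderiv ℝ (solFun a m) ((r, ς), W) ((0, 0), 1) = solW a m r ς W :=
      ((hcd.differentiableAt one_ne_zero).hasFDerivAt.comp_hasDerivAt W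
        ((hasDerivAt_const W (r, ς)).prodMk (hasDerivAt_id W))).unique (hasDerivAt_solFun_W h1 h2)
    change fderiv ℝ (solFun a m) ((r, ς), W) ((0, 0), 1) ≠ 0
    rw [e]
    exact (hs.solW_pos ham hς hr).ne'
  have hg := hcd.contDiffAt_implicitFunction one_ne_zero hinv
  have hg0 := hcd.implicitFunction_apply_self one_ne_zero hinv
  have hge := hcd.eventually_apply_implicitFunction one_ne_zero hinv
  set g := hcd.implicitFunction one_ne_zero hinv
  simp only at hg hg0 hge
  refine ⟨g, hg, hg0, ?_⟩
  have c1 : ContinuousAt (fun q : ℝ × ℝ => (q.2, g q)) (r, ς) :=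
    continuousAt_snd.prodMk hg.continuousAt
  have c2 : ContinuousAt (fun q : ℝ × ℝ => (q.1, kap q.2 (g q))) (r, ς) := by
    have := hg.continuousAt
    unfold kap; fun_prop
  filter_upwards [hge, c1.eventually (isOpen_ellDom.mem_nhds (by simpa only [hg0] using h1)),
    c2.eventually ((isOpen_radDom a m).mem_nhds (by simpa only [hg0] using h2))] with q e1 e2 e3
  refine ⟨e2, e3, ?_⟩
  have : solFun a m ((r, ς), W) = 0 := sub_eq_zero.2 hs.2
  rw [this] at e1
  exact sub_eq_zero.1 e1

theorem radDom_radPoly_pos {a m r κ : ℝ} (h : (r, κ) ∈ radDom a m) : 0 < radPoly a m r κ :=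
  radPoly_pos_of_mem_radDom h right_mem_uIcc

theorem hasFDerivAt_radS {a m r κ : ℝ} (h : 0 < radPoly a m r κ) :
    HasFDerivAt (fun q : ℝ × ℝ => radS a m q.1 q.2)
      (linForm (radSr a m r κ) (-(a ^ 2 * kerrDelta a m r) / (2 * radS a m r κ))) (r, κ) := by
  have hd := (contDiffAt_radS (q := (r, κ)) h).differentiableAt one_ne_zero
  refine hasFDerivAt_linForm hd (fderiv_eq_of_slice_fst hd ?_)
    (fderiv_eq_of_slice_snd hd ((hasDerivAt_radPoly_κ a m r κ).sqrt h.ne'))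
  have e : HasDerivAt (fun r => radPoly a m r κ)
      (2 * (2 * r * (r ^ 2 + a ^ 2) - a ^ 2 * κ * (r - m))) r := by
    unfold radPoly kerrDelta
    refine (((((hasDerivAt_pow 2 r).add_const (a ^ 2)).pow 2).sub
      ((((hasDerivAt_pow 2 r).sub ((hasDerivAt_id r).const_mul (2 * m))).add_const
        (a ^ 2)).const_mul (a ^ 2 * κ)))).congr_deriv ?_
    push_cast; ring
  refine (e.sqrt h.ne').congr_deriv ?_
  change _ / (2 * radS a m r κ) = _
  have := radS_pos h
  unfold radSr
  field_simp

/-- The optical function near a point, in the variables `r` and `ς = sin² θ`: a function `f` whose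
partial derivatives `u` and `v` are `C¹` and satisfy the eikonal equation. The last field is
`|q|²` times the d'Alembertian. -/
structure LocalOptical (a m r ς B : ℝ) (f u v : ℝ × ℝ → ℝ) (ur uς vς : ℝ) : Prop where
  u_contDiff : ContDiffAt ℝ 1 u (r, ς)
  v_contDiff : ContDiffAt ℝ 1 v (r, ς)
  hasFDerivAt : ∀ᶠ q in 𝓝 (r, ς), HasFDerivAt f (linForm (u q) (v q)) q
  u_deriv : HasFDerivAt u (linForm ur uς) (r, ς)
  v_deriv : HasFDerivAt v (linForm uς vς) (r, ς)
  eikonal : ∀ᶠ q in 𝓝 (r, ς), kerrDelta a m q.1 * u q ^ 2 + 2 * (q.1 ^ 2 + a ^ 2) * u q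
    + a ^ 2 * q.2 + 4 * q.2 * (1 - q.2) * v q ^ 2 = 0
  pos : 0 < r ^ 2 + a ^ 2 + kerrDelta a m r * u (r, ς)
  eq_B : 2 * r + (2 * r - 2 * m) * u (r, ς) + kerrDelta a m r * ur + 2 * (2 - 3 * ς) * v (r, ς)
    + 4 * ς * (1 - ς) * vς = B

/-- Near every point `f_*` is given by a function of `r` and `ς` satisfying the eikonal equation.
Its derivatives are `∂_r f = -a² κ / (r² + a² + Σ)` and `∂_ς f = -|a| W / 2`: the chain rule
produces no derivative of `W`, since the derivative of `radA + |a| ellK` in `W` at fixed `(r, ς)` is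
a multiple of `ellH - radH`. -/
theorem IsSol.exists_localOptical {a m r ς W : ℝ} (ham : |a| < m) (hς : ς ∈ Icc (0 : ℝ) 1)
    (hr : rMinus a m < r) (hs : IsSol a m r ς W) :
    ∃ f u v ur uς vς, LocalOptical a m r ς (expB a m r ς W) f u v ur uς vς ∧
      ∀ᶠ q : ℝ × ℝ in 𝓝 (r, ς), ∀ θ ∈ Icc 0 Real.pi, Real.sin θ ^ 2 = q.2 →
        fStar a m q.1 θ = f q := by
  obtain ⟨g, hg, hg0, hge⟩ := hs.exists_contDiffAt ham hς hr
  set κ : ℝ × ℝ → ℝ := fun q => kap q.2 (g q) with hκ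
  set S : ℝ × ℝ → ℝ := fun q => radS a m q.1 (κ q) with hS
  set f : ℝ × ℝ → ℝ := fun q => radA a m (q.1, κ q) + |a| * ellK (q.2, g q) with hf
  set u : ℝ × ℝ → ℝ := fun q => -(a ^ 2 * κ q / (q.1 ^ 2 + a ^ 2 + S q)) with hu
  set v : ℝ × ℝ → ℝ := fun q => -(|a| * g q / 2) with hv
  have hSpos : ∀ᶠ q in 𝓝 (r, ς), 0 < radPoly a m q.1 (κ q) := by
    filter_upwards [hge] with q hq using radDom_radPoly_pos hq.2.1
  have hκc : ContDiffAt ℝ 1 κ (r, ς) := by rw [hκ]; unfold kap; fun_prop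
  have hSc : ContDiffAt ℝ 1 S (r, ς) :=
    (contDiffAt_radS hSpos.self_of_nhds).comp (r, ς) (f := fun q : ℝ × ℝ => (q.1, κ q))
      (by fun_prop)
  have hS0 : 0 < S (r, ς) := radS_pos hSpos.self_of_nhds
  have hden : r ^ 2 + a ^ 2 + S (r, ς) ≠ 0 := by positivity
  have huc : ContDiffAt ℝ 1 u (r, ς) :=
    have h : ContDiffAt ℝ 1 (fun q : ℝ × ℝ => a ^ 2 * κ q / (q.1 ^ 2 + a ^ 2 + S q)) (r, ς) :=
      ContDiffAt.div (by fun_prop) (by fun_prop) hden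
    h.neg
  have hvc : ContDiffAt ℝ 1 v (r, ς) := by fun_prop
  -- the coefficient of `dg` in `df` vanishes because `g` solves the equation for `θ_*`
  have hfd : ∀ᶠ q in 𝓝 (r, ς), HasFDerivAt f (linForm (u q) (v q)) q := by
    filter_upwards [hge, hg.eventually (by simp)] with q hq hgq
    have hG := (hgq.differentiableAt one_ne_zero).hasFDerivAt
    have hK := (hasFDerivAt_ellK hq.1).comp q (f := fun q : ℝ × ℝ => (q.2, g q))
      (hasFDerivAt_snd.prodMk hG)
    have hk := (hasFDerivAt_kap q.2 (g q)).comp q (f := fun q : ℝ × ℝ => (q.2, g q))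
      (hasFDerivAt_snd.prodMk hG)
    have hA := (contDiffAt_radA hq.2.1).2.comp q (f := fun q : ℝ × ℝ => (q.1, κ q))
      (hasFDerivAt_fst.prodMk hk)
    refine (hA.add (hK.const_mul |a|)).congr_fderiv ?_
    refine ContinuousLinearMap.ext fun x => ?_
    simp only [_root_.add_apply, _root_.smul_apply,
      ContinuousLinearMap.comp_apply, ContinuousLinearMap.prod_apply, linForm_apply,
      ContinuousLinearMap.coe_fst', ContinuousLinearMap.coe_snd', smul_eq_mul, hu, hv, hS, hκ]
    rw [← hq.2.2]
    ring
  obtain ⟨D, hD⟩ : ∃ D, HasFDerivAt u D (r, ς) := (huc.differentiableAt one_ne_zero)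
  have hgd := (hg.differentiableAt one_ne_zero).hasFDerivAt
  set G := fderiv ℝ g (r, ς) with hGdef
  have hvd : HasFDerivAt v (linForm (-(|a| * G (1, 0) / 2)) (-(|a| * G (0, 1) / 2))) (r, ς) := by
    refine ((hgd.const_mul |a|).mul_const (1 / 2)).neg.congr_fderiv ?_ |>.congr_of_eventuallyEq
      (Eventually.of_forall fun q => by simp only [hv, Pi.neg_apply]; ring)
    ext <;> simp <;> ring
  have hud : HasFDerivAt u (linForm (D (1, 0)) (D (0, 1))) (r, ς) :=
    hasFDerivAt_linForm (huc.differentiableAt one_ne_zero) (by rw [hD.fderiv]) (by rw [hD.fderiv])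
  -- equality of mixed partial derivatives
  have hsymm : D (0, 1) = -(|a| * G (1, 0) / 2) := by
    have hL : HasFDerivAt (fun q => linForm (u q) (v q))
        ((linForm (D (1, 0)) (D (0, 1))).smulRight (ContinuousLinearMap.fst ℝ ℝ ℝ) +
          (linForm (-(|a| * G (1, 0) / 2)) (-(|a| * G (0, 1) / 2))).smulRight
            (ContinuousLinearMap.snd ℝ ℝ ℝ)) (r, ς) :=
      (hud.smul_const (ContinuousLinearMap.fst ℝ ℝ ℝ)).add
        (hvd.smul_const (ContinuousLinearMap.snd ℝ ℝ ℝ))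
    have := second_derivative_symmetric_of_eventually hfd hL (0, 1) (1, 0)
    simpa using this
  -- `r² + a² + Δ ∂_r f = Σ(r, θ_*)`
  have hSsq : ∀ᶠ q in 𝓝 (r, ς), q.1 ^ 2 + a ^ 2 + kerrDelta a m q.1 * u q = S q := by
    filter_upwards [hSpos] with q hq
    have h1 : 0 < S q := radS_pos hq
    have h2 : S q ^ 2 = radPoly a m q.1 (κ q) := radS_sq hq
    have h3 : q.1 ^ 2 + a ^ 2 + S q ≠ 0 := by positivity
    unfold radPoly at h2
    simp only [hu]
    field_simp
    linear_combination -h2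
  -- implicit differentiation of the equation for `W`
  have hW : ∀ x, solW a m r ς W * G x = |a| / S (r, ς) * x.1
      - (ellHς ς W - radHκ a m r (kap ς W) * (1 + (1 - 2 * ς) * W ^ 2)) * x.2 := by
    intro x
    obtain ⟨d1, d2, d3⟩ := hge.self_of_nhds
    simp only [hg0] at d1 d2
    have hH := (hasFDerivAt_ellH (ς := (r, ς).2) (W := g (r, ς)) (by rw [hg0]; exact d1)).comp
      (r, ς) (f := fun q : ℝ × ℝ => (q.2, g q)) (hasFDerivAt_snd.prodMk hgd)
    have hk := (hasFDerivAt_kap (r, ς).2 (g (r, ς))).comp (r, ς)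
      (f := fun q : ℝ × ℝ => (q.2, g q)) (hasFDerivAt_snd.prodMk hgd)
    have hR := (contDiffAt_radH (r := (r, ς).1) (κ := κ (r, ς)) hge.self_of_nhds.2.1).2.comp
      (r, ς) (f := fun q : ℝ × ℝ => (q.1, κ q)) (hasFDerivAt_fst.prodMk hk)
    have h0 : HasFDerivAt (fun q : ℝ × ℝ => ellH (q.2, g q) - radH a m (q.1, κ q))
        (0 : ℝ × ℝ →L[ℝ] ℝ) (r, ς) := by
      refine (hasFDerivAt_const (0 : ℝ) (r, ς)).congr_of_eventuallyEq ?_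
      filter_upwards [hge] with q hq
      simp only [hκ, hq.2.2, sub_self]
    have h1 := congrArg (fun L : ℝ × ℝ →L[ℝ] ℝ => L x) ((hH.sub hR).unique h0)
    simp only [_root_.sub_apply,
      ContinuousLinearMap.comp_apply, ContinuousLinearMap.prod_apply, linForm_apply,
      ContinuousLinearMap.coe_fst', ContinuousLinearMap.coe_snd', hg0, hκ,
      _root_.zero_apply] at h1
    simp only [hS, hκ, hg0, solW]
    linear_combination h1
  have hq := hs.solW_pos ham hς hr
  refine ⟨f, u, v, D (1, 0), D (0, 1), -(|a| * G (0, 1) / 2),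
    ⟨huc, hvc, hfd, hud, by rw [hsymm]; exact hvd, ?_, ?_, ?_⟩, ?_⟩
  · filter_upwards [hSpos] with q hq
    have h1 : 0 < S q := radS_pos hq
    have h2 : S q ^ 2 = radPoly a m q.1 (κ q) := radS_sq hq
    have h3 : q.1 ^ 2 + a ^ 2 + S q ≠ 0 := by positivity
    have h4 : kerrDelta a m q.1 * u q ^ 2 + 2 * (q.1 ^ 2 + a ^ 2) * u q = -(a ^ 2 * κ q) := by
      unfold radPoly at h2
      simp only [hu]
      field_simp
      linear_combination a ^ 2 * κ q * h2
    rw [h4]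
    simp only [hv, hκ, kap]
    linear_combination q.2 * (1 - q.2) * g q ^ 2 * sq_abs a
  · have := hSsq.self_of_nhds
    simp only at this
    rw [this]; exact hS0
  · -- the `r`-derivative of `Σ(r, θ_*)`, computed in two ways
    have hk := (hasFDerivAt_kap (r, ς).2 (g (r, ς))).comp (r, ς)
      (f := fun q : ℝ × ℝ => (q.2, g q)) (hasFDerivAt_snd.prodMk hgd)
    have hS1 := (hasFDerivAt_radS (r := (r, ς).1) (κ := κ (r, ς)) hSpos.self_of_nhds).comp
      (r, ς) (f := fun q : ℝ × ℝ => (q.1, κ q)) (hasFDerivAt_fst.prodMk hk)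
    have hΔ : HasFDerivAt (fun q : ℝ × ℝ => kerrDelta a m q.1) (linForm (2 * r - 2 * m) 0)
        (r, ς) := by
      have hd : DifferentiableAt ℝ (fun q : ℝ × ℝ => kerrDelta a m q.1) (r, ς) := by
        unfold kerrDelta; fun_prop
      refine hasFDerivAt_linForm hd (fderiv_eq_of_slice_fst hd ?_)
        (fderiv_eq_of_slice_snd hd (hasDerivAt_const ς (kerrDelta a m r)))
      unfold kerrDelta
      refine (((hasDerivAt_pow 2 r).sub ((hasDerivAt_id r).const_mul (2 * m))).add_const
        (a ^ 2)).congr_deriv ?_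
      push_cast; ring
    have hN : HasFDerivAt (fun q : ℝ × ℝ => q.1 ^ 2 + a ^ 2) (linForm (2 * r) 0) (r, ς) := by
      have hd : DifferentiableAt ℝ (fun q : ℝ × ℝ => q.1 ^ 2 + a ^ 2) (r, ς) := by fun_prop
      refine hasFDerivAt_linForm hd (fderiv_eq_of_slice_fst hd ?_)
        (fderiv_eq_of_slice_snd hd (hasDerivAt_const ς (r ^ 2 + a ^ 2)))
      refine ((hasDerivAt_pow 2 r).add_const (a ^ 2)).congr_deriv ?_
      push_cast; ring
    have h1 := ((hN.add (hΔ.mul hud)).congr_of_eventuallyEq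
      (hSsq.mono fun q hq => hq.symm)).unique hS1
    have h2 := congrArg (fun L : ℝ × ℝ →L[ℝ] ℝ => L (1, 0)) h1
    simp only [_root_.add_apply, _root_.smul_apply, smul_eq_mul,
      ContinuousLinearMap.comp_apply, ContinuousLinearMap.prod_apply, linForm_apply,
      ContinuousLinearMap.coe_fst', ContinuousLinearMap.coe_snd', hg0, hκ, mul_one, mul_zero,
      add_zero] at h2
    have h3 := hW (1, 0)
    have h4 := hW (0, 1)
    simp only [mul_one, mul_zero, sub_zero, zero_sub] at h3 h4
    have h5 : G (1, 0) = |a| / S (r, ς) / solW a m r ς W := by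
      rw [eq_div_iff hq.ne']; linarith
    have h6 : G (0, 1) = -(ellHς ς W - radHκ a m r (kap ς W) * (1 + (1 - 2 * ς) * W ^ 2))
        / solW a m r ς W := by
      rw [eq_div_iff hq.ne']; linarith
    have h7 : radPoly a m r (kap ς W) = S (r, ς) ^ 2 := by
      rw [hS]; simp only [hκ, hg0]
      exact (radS_sq (by have := hSpos.self_of_nhds; simpa only [hκ, hg0] using this)).symm
    have h8 : radS a m r (kap ς W) = S (r, ς) := by simp only [hS, hκ, hg0]
    rw [h8] at h2
    have h9 : 2 * r + (2 * r - 2 * m) * u (r, ς) + kerrDelta a m r * D (1, 0) =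
        radSr a m r (kap ς W) + -(a ^ 2 * kerrDelta a m r) / (2 * S (r, ς)) *
          (2 * ς * (1 - ς) * W * G (1, 0)) := by
      linear_combination h2
    rw [h9, h5, h6, expB, h7]
    simp only [hv, hg0]
    field_simp
    ring
  · have hrq : ∀ᶠ q : ℝ × ℝ in 𝓝 (r, ς), rMinus a m < q.1 :=
      continuousAt_fst.eventually (lt_mem_nhds hr)
    filter_upwards [hge, hrq] with q hq hrq θ hθ hθq
    have : IsSol a m q.1 (Real.sin θ ^ 2) (g q) := by rw [hθq]; exact ⟨hq.1.1, hq.2.2⟩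
    rw [fStar_eq ham hrq hθ this, hθq]

/-! ### Null expansions from explicit vector fields -/

section Inner

variable {g : ChartMetric} {x : Coord}

theorem inner_add_left (v v' w : Coord) : g.inner x (v + v') w = g.inner x v w + g.inner x v' w := by
  simp [ChartMetric.inner, add_dotProduct]

theorem inner_smul_left (t : ℝ) (v w : Coord) : g.inner x (t • v) w = t * g.inner x v w := by
  simp [ChartMetric.inner]

theorem inner_sub_left (v v' w : Coord) : g.inner x (v - v') w = g.inner x v w - g.inner x v' w := by
  simp [ChartMetric.inner, sub_dotProduct]

theorem inner_add_right (v w w' : Coord) : g.inner x v (w + w') = g.inner x v w + g.inner x v w' := by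
  simp [ChartMetric.inner, Matrix.mulVec_add]

theorem inner_smul_right (t : ℝ) (v w : Coord) : g.inner x v (t • w) = t * g.inner x v w := by
  simp [ChartMetric.inner, Matrix.mulVec_smul]

theorem inner_sub_right (v w w' : Coord) : g.inner x v (w - w') = g.inner x v w - g.inner x v w' := by
  simp [ChartMetric.inner, Matrix.mulVec_sub]

theorem inner_eq_sum (v w : Coord) : g.inner x v w = ∑ i, ∑ j, v i * g x i j * w j := by
  simp only [ChartMetric.inner, dotProduct, Matrix.mulVec, Finset.mul_sum, mul_assoc]

theorem inner_comm (hg : (g x).IsSymm) (v w : Coord) : g.inner x v w = g.inner x w v := by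
  simp only [ChartMetric.inner]
  rw [Matrix.dotProduct_mulVec, ← Matrix.mulVec_transpose, hg, dotProduct_comm]

/-- If four vectors have nondegenerate Gram matrix, they span, and the metric is nondegenerate. -/
theorem eq_zero_of_gram {E : Fin 4 → Coord}
    (hE : (Matrix.of fun i j => g.inner x (E i) (E j)).det ≠ 0) {z : Coord}
    (hz : ∀ i, g.inner x (E i) z = 0) : z = 0 := by
  have e : (Matrix.of fun i j => g.inner x (E i) (E j))
      = Matrix.of E * (g x * (Matrix.of E)ᵀ) := by
    ext i j
    simp only [ChartMetric.inner, Matrix.of_apply, Matrix.mul_apply, dotProduct, Matrix.mulVec,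
      Matrix.transpose_apply]
  rw [e, Matrix.det_mul, Matrix.det_mul] at hE
  have h1 : (Matrix.of E * g x).det ≠ 0 := by
    rw [Matrix.det_mul]
    exact mul_ne_zero (left_ne_zero_of_mul hE) (left_ne_zero_of_mul (right_ne_zero_of_mul hE))
  refine Matrix.eq_zero_of_mulVec_eq_zero h1 ?_
  ext i
  rw [← Matrix.mulVec_mulVec]
  exact hz i

/-- A pair of orthonormal vectors together with a null pair orthogonal to it spans. -/
theorem eq_zero_of_orthogonal (hg : (g x).IsSymm) {e₁ e₂ e₃ e₄ z : Coord}
    (h11 : g.inner x e₁ e₁ = 1) (h22 : g.inner x e₂ e₂ = 1) (h12 : g.inner x e₁ e₂ = 0)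
    (h13 : g.inner x e₁ e₃ = 0) (h14 : g.inner x e₁ e₄ = 0) (h23 : g.inner x e₂ e₃ = 0)
    (h24 : g.inner x e₂ e₄ = 0) (h33 : g.inner x e₃ e₃ = 0) (h44 : g.inner x e₄ e₄ = 0)
    (h34 : g.inner x e₃ e₄ = -2) (z1 : g.inner x e₁ z = 0) (z2 : g.inner x e₂ z = 0)
    (z3 : g.inner x e₃ z = 0) (z4 : g.inner x e₄ z = 0) : z = 0 := by
  refine eq_zero_of_gram (g := g) (x := x) (E := ![e₁, e₂, e₃, e₄]) ?_ ?_
  · have e : (Matrix.of fun i j => g.inner x (![e₁, e₂, e₃, e₄] i) (![e₁, e₂, e₃, e₄] j))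
        = !![1, 0, 0, 0; 0, 1, 0, 0; 0, 0, 0, -2; 0, 0, -2, 0] := by
      ext i j
      fin_cases i <;> fin_cases j <;>
        simp [h11, h22, h12, h13, h14, h23, h24, h33, h44, h34, inner_comm hg e₂ e₁,
          inner_comm hg e₃ e₁, inner_comm hg e₃ e₂, inner_comm hg e₄ e₁, inner_comm hg e₄ e₂,
          inner_comm hg e₄ e₃]
    rw [e]
    simp [Matrix.det_succ_row_zero, Fin.sum_univ_succ, Fin.succAbove]
  · intro i
    fin_cases i <;> assumption

/-- The null vector `e₄` is determined by its products with `e₁`, `e₂` and `e₃`. -/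
theorem null_vector_unique (hg : (g x).IsSymm) {e₁ e₂ e₃ e₄ L : Coord}
    (h11 : g.inner x e₁ e₁ = 1) (h22 : g.inner x e₂ e₂ = 1) (h12 : g.inner x e₁ e₂ = 0)
    (h13 : g.inner x e₁ e₃ = 0) (h14 : g.inner x e₁ e₄ = 0) (h23 : g.inner x e₂ e₃ = 0)
    (h24 : g.inner x e₂ e₄ = 0) (h33 : g.inner x e₃ e₃ = 0) (h44 : g.inner x e₄ e₄ = 0)
    (h34 : g.inner x e₃ e₄ = -2) (z1 : g.inner x e₁ L = 0) (z2 : g.inner x e₂ L = 0)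
    (z3 : g.inner x e₃ L = -2) (zL : g.inner x L L = 0) : e₄ = L := by
  set c := g.inner x e₄ L with hc
  have h43 := inner_comm hg e₄ e₃
  have h0 : L - e₄ + (c / 2) • e₃ = 0 := by
    refine eq_zero_of_orthogonal hg h11 h22 h12 h13 h14 h23 h24 h33 h44 h34 ?_ ?_ ?_ ?_ <;>
      simp only [inner_add_right, inner_sub_right, inner_smul_right, *] <;> ring
  have hL : L = e₄ - (c / 2) • e₃ := by
    rw [← sub_eq_zero, ← h0]; abel
  have h1 := zL
  rw [hL] at h1
  simp only [inner_sub_left, inner_sub_right, inner_smul_right, inner_smul_left, h44, h33, h34,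
    h43] at h1
  have : c = 0 := by linarith
  rw [hL, this]; simp

end Inner

/-- The contribution `g(D_v L, v) = g(∂_v L, v) + (∂_L g)(v, v) / 2` of the tangent vector `v` to
the expansion of `L`. -/
def expTerm (g : ChartMetric) (L : Coord → Coord) (p v : Coord) : ℝ :=
  g.inner p (fderiv ℝ L p v) v + g.dInner p (L p) v v / 2

section Frame

variable {g : ChartMetric} {p : Coord}

theorem innerCov_self (hs : ∀ x, (g x).IsSymm) (L : Coord → Coord) (v : Coord) :
    g.innerCov L p v v = expTerm g L p v := by
  have : (fun y => g.inner y v (L p)) = fun y => g.inner y (L p) v :=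
    funext fun y => inner_comm (hs y) _ _
  simp only [ChartMetric.innerCov, expTerm, ChartMetric.dInner, this]
  ring

theorem contDiffAt_inner (hg : ∀ i j, ContDiffAt ℝ 1 (fun x => g x i j) p) {X Y : Coord → Coord}
    (hX : ContDiffAt ℝ 1 X p) (hY : ContDiffAt ℝ 1 Y p) :
    ContDiffAt ℝ 1 (fun x => g.inner x (X x) (Y x)) p := by
  simp only [inner_eq_sum]
  refine ContDiffAt.sum fun i _ => ContDiffAt.sum fun j _ => ?_
  exact ((contDiffAt_pi.1 hX i).mul (hg i j)).mul (contDiffAt_pi.1 hY j)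

theorem dInner_eq_sum (hg : ∀ i j, ContDiffAt ℝ 1 (fun x => g x i j) p) (z v w : Coord) :
    g.dInner p z v w = ∑ i, ∑ j, v i * fderiv ℝ (fun x => g x i j) p z * w j := by
  have h : HasFDerivAt (fun y => g.inner y v w)
      (∑ i, ∑ j, w j • (v i • fderiv ℝ (fun x => g x i j) p)) p := by
    simp only [inner_eq_sum]
    refine HasFDerivAt.fun_sum fun i _ => HasFDerivAt.fun_sum fun j _ => ?_
    exact (((hg i j).differentiableAt one_ne_zero).hasFDerivAt.const_mul (v i)).mul_const (w j)
  rw [ChartMetric.dInner, h.fderiv]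
  simp only [_root_.sum_apply, _root_.smul_apply, smul_eq_mul]
  refine Finset.sum_congr rfl fun i _ => Finset.sum_congr rfl fun j _ => by ring

theorem expTerm_smul (hg : ∀ i j, ContDiffAt ℝ 1 (fun x => g x i j) p) (L : Coord → Coord) (t : ℝ)
    (v : Coord) : expTerm g L p (t • v) = t ^ 2 * expTerm g L p v := by
  simp only [expTerm, dInner_eq_sum hg, map_smul, inner_smul_left, inner_smul_right, mul_add,
    Finset.sum_div, Finset.mul_sum, Pi.smul_apply, smul_eq_mul]
  congr 1
  · ring
  · refine Finset.sum_congr rfl fun i _ => Finset.sum_congr rfl fun j _ => by ring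

/-- The expansion does not depend on the choice of the orthonormal frame of the tangent plane. -/
theorem expTerm_rotate (hg : ∀ i j, ContDiffAt ℝ 1 (fun x => g x i j) p) (L : Coord → Coord)
    {α β γ δ : ℝ} (h1 : α ^ 2 + β ^ 2 = 1) (h2 : γ ^ 2 + δ ^ 2 = 1) (h3 : α * γ + β * δ = 0)
    (v w : Coord) : expTerm g L p (α • v + β • w) + expTerm g L p (γ • v + δ • w) =
      expTerm g L p v + expTerm g L p w := by
  have hO : !![α, β; γ, δ] * !![α, β; γ, δ]ᵀ = 1 := by
    ext i j
    fin_cases i <;> fin_cases j <;> simp [Matrix.mul_apply, Fin.sum_univ_two] <;> linarith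
  have hO' := mul_eq_one_comm.1 hO
  have k1 := congrFun (congrFun hO' 0) 0
  have k2 := congrFun (congrFun hO' 1) 1
  have k3 := congrFun (congrFun hO' 0) 1
  simp [Matrix.mul_apply, Fin.sum_univ_two] at k1 k2 k3
  have q : ∀ s t : ℝ, expTerm g L p (s • v + t • w) = s ^ 2 * expTerm g L p v
      + s * t * (g.inner p (fderiv ℝ L p v) w + g.inner p (fderiv ℝ L p w) v
        + (g.dInner p (L p) v w + g.dInner p (L p) w v) / 2) + t ^ 2 * expTerm g L p w := by
    intro s t
    simp only [expTerm, dInner_eq_sum hg, map_add, map_smul, inner_smul_left, inner_smul_right,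
      inner_add_left, inner_add_right, Fin.sum_univ_four, Pi.smul_apply, Pi.add_apply, smul_eq_mul]
    ring
  rw [q, q]
  linear_combination (expTerm g L p v) * k1 + (expTerm g L p w) * k2 +
    (g.inner p (fderiv ℝ L p v) w + g.inner p (fderiv ℝ L p w) v
        + (g.dInner p (L p) v w + g.dInner p (L p) w v) / 2) * k3

/-- A tangent vector expands in an orthonormal frame of the tangent plane. -/
theorem eq_smul_add_smul {x e₁ e₂ e₃ e₄ z : Coord} (hs : (g x).IsSymm)
    (h11 : g.inner x e₁ e₁ = 1) (h22 : g.inner x e₂ e₂ = 1) (h12 : g.inner x e₁ e₂ = 0)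
    (h13 : g.inner x e₁ e₃ = 0) (h14 : g.inner x e₁ e₄ = 0) (h23 : g.inner x e₂ e₃ = 0)
    (h24 : g.inner x e₂ e₄ = 0) (h33 : g.inner x e₃ e₃ = 0) (h44 : g.inner x e₄ e₄ = 0)
    (h34 : g.inner x e₃ e₄ = -2) (z3 : g.inner x e₃ z = 0) (z4 : g.inner x e₄ z = 0) :
    z = g.inner x e₁ z • e₁ + g.inner x e₂ z • e₂ := by
  rw [← sub_eq_zero]
  refine eq_zero_of_orthogonal hs h11 h22 h12 h13 h14 h23 h24 h33 h44 h34 ?_ ?_ ?_ ?_ <;>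
    simp only [inner_add_right, inner_sub_right, inner_smul_right, inner_comm hs e₂ e₁,
      inner_comm hs e₃ e₁, inner_comm hs e₃ e₂, inner_comm hs e₄ e₁, inner_comm hs e₄ e₂, *] <;>
    ring

/-- The null expansions computed from `C¹` vector fields `L₃`, `L₄` satisfying the conditions on
`e₃`, `e₄`, and from tangent fields `X₁`, `X₂` that are orthogonal at the point under
consideration. -/
theorem hasNullExpansions_of_fields {U R : Coord → ℝ} {L₃ L₄ X₁ X₂ : Coord → Coord}
    (hg : ∀ i j, ContDiffAt ℝ 1 (fun x => g x i j) p) (hs : ∀ x, (g x).IsSymm)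
    (hL₃ : ContDiffAt ℝ 1 L₃ p) (hL₄ : ContDiffAt ℝ 1 L₄ p)
    (hX₁ : ContDiffAt ℝ 1 X₁ p) (hX₂ : ContDiffAt ℝ 1 X₂ p)
    (hUR : ∀ᶠ x in 𝓝 p, DifferentiableAt ℝ U x ∧ DifferentiableAt ℝ R x)
    (h3 : ∀ᶠ x in 𝓝 p, ∀ v, g.inner x (L₃ x) v = -fderiv ℝ U x v)
    (h4 : ∀ᶠ x in 𝓝 p, ∀ v, fderiv ℝ U x v = 0 → fderiv ℝ R x v = 0 → g.inner x (L₄ x) v = 0)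
    (hnull : ∀ᶠ x in 𝓝 p, g.inner x (L₃ x) (L₃ x) = 0 ∧ g.inner x (L₄ x) (L₄ x) = 0 ∧
      g.inner x (L₃ x) (L₄ x) = -2)
    (htan : ∀ᶠ x in 𝓝 p, fderiv ℝ U x (X₁ x) = 0 ∧ fderiv ℝ R x (X₁ x) = 0 ∧
      fderiv ℝ U x (X₂ x) = 0 ∧ fderiv ℝ R x (X₂ x) = 0)
    (hpos₁ : 0 < g.inner p (X₁ p) (X₁ p)) (hpos₂ : 0 < g.inner p (X₂ p) (X₂ p))
    (horth : g.inner p (X₁ p) (X₂ p) = 0) :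
    HasNullExpansions g U R p
      (expTerm g L₄ p (X₁ p) / g.inner p (X₁ p) (X₁ p)
        + expTerm g L₄ p (X₂ p) / g.inner p (X₂ p) (X₂ p))
      (expTerm g L₃ p (X₁ p) / g.inner p (X₁ p) (X₁ p)
        + expTerm g L₃ p (X₂ p) / g.inner p (X₂ p) (X₂ p)) := by
  -- the Gram–Schmidt process gives a `C¹` frame; at `p` it only normalizes `X₁` and `X₂`
  set n₁ : Coord → ℝ := fun x => √(g.inner x (X₁ x) (X₁ x)) with hn₁
  set e₁ : Coord → Coord := fun x => (n₁ x)⁻¹ • X₁ x with he₁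
  set Y : Coord → Coord := fun x => X₂ x - g.inner x (X₂ x) (e₁ x) • e₁ x with hY
  set n₂ : Coord → ℝ := fun x => √(g.inner x (Y x) (Y x)) with hn₂
  set e₂ : Coord → Coord := fun x => (n₂ x)⁻¹ • Y x with he₂
  have hn₁p : 0 < n₁ p := Real.sqrt_pos.2 hpos₁
  have cn₁ : ContDiffAt ℝ 1 n₁ p := (contDiffAt_inner hg hX₁ hX₁).sqrt hpos₁.ne'
  have ce₁ : ContDiffAt ℝ 1 e₁ p := (cn₁.inv hn₁p.ne').smul hX₁
  have cY : ContDiffAt ℝ 1 Y p := hX₂.sub ((contDiffAt_inner hg hX₂ ce₁).smul ce₁)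
  have hYp : Y p = X₂ p := by
    simp [hY, he₁, inner_smul_right, inner_comm (hs p) (X₂ p), horth]
  have hposY : 0 < g.inner p (Y p) (Y p) := by rw [hYp]; exact hpos₂
  have hn₂p : 0 < n₂ p := Real.sqrt_pos.2 hposY
  have cn₂ : ContDiffAt ℝ 1 n₂ p := (contDiffAt_inner hg cY cY).sqrt hposY.ne'
  have ce₂ : ContDiffAt ℝ 1 e₂ p := (cn₂.inv hn₂p.ne').smul cY
  have ev₁ : ∀ᶠ x in 𝓝 p, 0 < g.inner x (X₁ x) (X₁ x) :=
    (contDiffAt_inner hg hX₁ hX₁).continuousAt.eventually (lt_mem_nhds hpos₁)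
  have ev₂ : ∀ᶠ x in 𝓝 p, 0 < g.inner x (Y x) (Y x) :=
    (contDiffAt_inner hg cY cY).continuousAt.eventually (lt_mem_nhds hposY)
  have ont : ∀ᶠ x in 𝓝 p, g.inner x (e₁ x) (e₁ x) = 1 ∧ g.inner x (e₂ x) (e₂ x) = 1 ∧
      g.inner x (e₁ x) (e₂ x) = 0 := by
    filter_upwards [ev₁, ev₂] with x p1 p2
    have s1 : n₁ x ^ 2 = g.inner x (X₁ x) (X₁ x) := Real.sq_sqrt p1.le
    have s2 : n₂ x ^ 2 = g.inner x (Y x) (Y x) := Real.sq_sqrt p2.le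
    have q1 : 0 < n₁ x := Real.sqrt_pos.2 p1
    have q2 : 0 < n₂ x := Real.sqrt_pos.2 p2
    have a1 : g.inner x (e₁ x) (e₁ x) = 1 := by
      simp only [he₁, inner_smul_left, inner_smul_right, ← s1]; field_simp
    refine ⟨a1, ?_, ?_⟩
    · simp only [he₂, inner_smul_left, inner_smul_right, ← s2]; field_simp
    · have : g.inner x (e₁ x) (Y x) = 0 := by
        simp only [hY, inner_sub_right, inner_smul_right, a1, inner_comm (hs x) (X₂ x)]
        ring
      simp only [he₂, inner_smul_right, this, mul_zero]
  have tan' : ∀ᶠ x in 𝓝 p, fderiv ℝ U x (e₁ x) = 0 ∧ fderiv ℝ R x (e₁ x) = 0 ∧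
      fderiv ℝ U x (e₂ x) = 0 ∧ fderiv ℝ R x (e₂ x) = 0 := by
    filter_upwards [htan] with x ⟨t1, t2, t3, t4⟩
    simp only [he₂, he₁, hY, map_smul, map_sub, t1, t2, t3, t4, smul_zero, sub_zero, and_self]
  have orth_of_tan : ∀ {E₁ E₂ : Coord → Coord}, (∀ᶠ x in 𝓝 p,
      fderiv ℝ U x (E₁ x) = 0 ∧ fderiv ℝ R x (E₁ x) = 0 ∧
      fderiv ℝ U x (E₂ x) = 0 ∧ fderiv ℝ R x (E₂ x) = 0) → ∀ᶠ x in 𝓝 p,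
      g.inner x (E₁ x) (L₃ x) = 0 ∧ g.inner x (E₁ x) (L₄ x) = 0 ∧
      g.inner x (E₂ x) (L₃ x) = 0 ∧ g.inner x (E₂ x) (L₄ x) = 0 := by
    intro E₁ E₂ ht
    filter_upwards [ht, h3, h4] with x ⟨t1, t2, t3, t4⟩ k3 k4
    rw [inner_comm (hs x) (E₁ x), inner_comm (hs x) (E₁ x), inner_comm (hs x) (E₂ x),
      inner_comm (hs x) (E₂ x), k3, k3, t1, t3]
    exact ⟨neg_zero, k4 _ t1 t2, neg_zero, k4 _ t3 t4⟩
  have orth' := orth_of_tan tan'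
  refine ⟨⟨e₁, e₂, L₃, L₄, ⟨ce₁, ce₂, hL₃, hL₄, hUR, h3, tan', ont, orth', hnull⟩⟩, ?_⟩
  -- any other adapted frame has the same null vectors near `p`, and differs by an orthogonal
  -- transformation in the tangent plane at `p`
  intro E₁ E₂ E₃ E₄ hE
  have eq3 : E₃ =ᶠ[𝓝 p] L₃ := by
    filter_upwards [h3, hE.e₃_eq, hE.orthonormal, hE.orthogonal, hE.null] with x k k' o1 o2 o3
    rw [← sub_eq_zero]
    have hz : ∀ v, g.inner x v (E₃ x - L₃ x) = 0 := fun v => by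
      rw [inner_comm (hs x), inner_sub_left, k, k', sub_self]
    exact eq_zero_of_orthogonal (hs x) o1.1 o1.2.1 o1.2.2 o2.1 o2.2.1 o2.2.2.1 o2.2.2.2 o3.1 o3.2.1
      o3.2.2 (hz _) (hz _) (hz _) (hz _)
  have orthE := orth_of_tan hE.tangent
  have eq4 : E₄ =ᶠ[𝓝 p] L₄ := by
    filter_upwards [eq3, hnull, hE.orthonormal, hE.orthogonal, hE.null, orthE] with
      x k k' o1 o2 o3 o4
    exact null_vector_unique (hs x) o1.1 o1.2.1 o1.2.2 o2.1 o2.2.1 o2.2.2.1 o2.2.2.2 o3.1 o3.2.1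
      o3.2.2 o4.2.1 o4.2.2.2 (by rw [k]; exact k'.2.2) k'.2.1
  obtain ⟨o1, o2, o3⟩ := ont.self_of_nhds
  obtain ⟨a1, a2, a3, a4⟩ := orth'.self_of_nhds
  obtain ⟨n1, n2, n3⟩ := hnull.self_of_nhds
  obtain ⟨O1, O2, O3⟩ := hE.orthonormal.self_of_nhds
  obtain ⟨b1, b2, b3, b4⟩ := orthE.self_of_nhds
  have x1 := eq_smul_add_smul (hs p) o1 o2 o3 a1 a2 a3 a4 n1 n2 n3
    (by rw [inner_comm (hs p)]; exact b1) (by rw [inner_comm (hs p)]; exact b2)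
  have x2 := eq_smul_add_smul (hs p) o1 o2 o3 a1 a2 a3 a4 n1 n2 n3
    (by rw [inner_comm (hs p)]; exact b3) (by rw [inner_comm (hs p)]; exact b4)
  set α := g.inner p (e₁ p) (E₁ p)
  set β := g.inner p (e₂ p) (E₁ p)
  set γ := g.inner p (e₁ p) (E₂ p)
  set δ := g.inner p (e₂ p) (E₂ p)
  have o3' := inner_comm (hs p) (e₂ p) (e₁ p)
  rw [x1] at O1 O3
  rw [x2] at O2 O3
  simp only [inner_add_left, inner_add_right, inner_smul_left, inner_smul_right, o1, o2, o3,
    o3'] at O1 O2 O3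
  have key : ∀ L : Coord → Coord, expTerm g L p (E₁ p) + expTerm g L p (E₂ p) =
      expTerm g L p (X₁ p) / g.inner p (X₁ p) (X₁ p)
        + expTerm g L p (X₂ p) / g.inner p (X₂ p) (X₂ p) := by
    intro L
    rw [x1, x2, expTerm_rotate hg L (by linarith) (by linarith) (by linarith)]
    have s1 : n₁ p ^ 2 = g.inner p (X₁ p) (X₁ p) := Real.sq_sqrt hpos₁.le
    have s2 : n₂ p ^ 2 = g.inner p (X₂ p) (X₂ p) := by rw [← hYp]; exact Real.sq_sqrt hposY.le
    simp only [he₁, he₂, hYp, expTerm_smul hg, ← s1, ← s2]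
    field_simp
  have germ : ∀ {L L' : Coord → Coord}, L =ᶠ[𝓝 p] L' → expTerm g L p = expTerm g L' p := by
    intro L L' h
    funext v
    rw [expTerm, expTerm, h.fderiv_eq, h.self_of_nhds]
  constructor
  · rw [nullExpansion, innerCov_self hs, innerCov_self hs, germ eq4, key]
  · rw [nullExpansion, innerCov_self hs, innerCov_self hs, germ eq3, key]

end Frame

/-! ### The regular radial function -/

/-- The regular positive factor in `r̃ = r₊ + (r - r₊) · (factor)`, at radius `r` and with `F` the
value of `f_*`. -/
def horizonFactor (a m c r F : ℝ) : ℝ :=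
  Real.exp (kerrKappa a m * (r + c + F) - rMinus a m / rPlus a m * Real.log (r - rMinus a m))

theorem horizonFactor_pos (a m c r F : ℝ) : 0 < horizonFactor a m c r F := Real.exp_pos _

theorem kerrKappa_pos {a m : ℝ} (ham : |a| < m) : 0 < kerrKappa a m := by
  have := (rMinus_lt ham).trans (lt_rPlus ham)
  have hm := (abs_nonneg a).trans_lt ham
  have := rPlus_pos ham
  unfold kerrKappa
  have : 0 < rPlus a m - rMinus a m := by linarith
  positivity

/-- In `κ f(r)` the coefficients of the logarithms of `|r - r₊|` and `|r - r₋|` are `1` and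
`-r₋ / r₊`, so that the first of them contributes the factor `|r - r₊|` to `e^{κ r_*}`. At `r = r₊`
both sides equal `r₊`. -/
theorem rTilde_eq {a m r : ℝ} (ham : |a| < m) (hr : rMinus a m < r) (c θ : ℝ) :
    rTilde a m c r θ =
      rPlus a m + (r - rPlus a m) * horizonFactor a m c r (fStar a m r θ) := by
  have hm := (abs_nonneg a).trans_lt ham
  have hp := rPlus_pos ham
  have hpm : 0 < rPlus a m - rMinus a m := by linarith [rMinus_lt ham, lt_rPlus ham]
  rcases eq_or_ne r (rPlus a m) with h | h
  · simp [rTilde, h]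
  have h' : r - rPlus a m ≠ 0 := sub_ne_zero.2 h
  have h1 : kerrKappa a m * rStar a m c r θ = Real.log |r - rPlus a m| +
      (kerrKappa a m * (r + c + fStar a m r θ)
        - rMinus a m / rPlus a m * Real.log (r - rMinus a m)) := by
    unfold kerrKappa rStar kerrTortoise
    rw [abs_of_pos (by linarith : 0 < r - rMinus a m)]
    field_simp
    ring
  rw [rTilde, h1, Real.exp_add, Real.exp_log (abs_pos.2 h'), ← mul_assoc]
  congr 2
  rcases lt_or_gt_of_ne h' with h | h
  · rw [Real.sign_of_neg h, abs_of_neg h]; ring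
  · rw [Real.sign_of_pos h, abs_of_pos h]; ring

/-- The differential of `r̃` is a nonzero multiple of `(r² + a² + Δ ∂_r f) dr + Δ ∂_ς f dς`. -/
theorem hasFDerivAt_rHat {a m : ℝ} (ham : |a| < m) (c : ℝ) {f : ℝ × ℝ → ℝ} {u v : ℝ} {q : ℝ × ℝ}
    (hr : rMinus a m < q.1) (hf : HasFDerivAt f (linForm u v) q) :
    HasFDerivAt (fun q => rPlus a m + (q.1 - rPlus a m) * horizonFactor a m c q.1 (f q))
      ((horizonFactor a m c q.1 (f q) * kerrKappa a m / (q.1 - rMinus a m)) •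
        linForm (q.1 ^ 2 + a ^ 2 + kerrDelta a m q.1 * u) (kerrDelta a m q.1 * v)) q := by
  have hm := (abs_nonneg a).trans_lt ham
  have hp := rPlus_pos ham
  have hpm : 0 < rPlus a m - rMinus a m := by linarith [rMinus_lt ham, lt_rPlus ham]
  have hr' : q.1 - rMinus a m ≠ 0 := by linarith
  have h1 : HasFDerivAt (fun q : ℝ × ℝ => q.1 + c + f q)
      (ContinuousLinearMap.fst ℝ ℝ ℝ + linForm u v) q := (hasFDerivAt_fst.add_const c).add hf
  have h2 : HasFDerivAt (fun q : ℝ × ℝ => Real.log (q.1 - rMinus a m))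
      ((q.1 - rMinus a m)⁻¹ • ContinuousLinearMap.fst ℝ ℝ ℝ) q :=
    (hasFDerivAt_fst.sub_const (rMinus a m)).log hr'
  have h3 := ((h1.const_mul (kerrKappa a m)).sub (h2.const_mul (rMinus a m / rPlus a m))).exp
  have h4 := ((hasFDerivAt_fst.sub_const (rPlus a m)).mul h3).const_add (rPlus a m)
  refine h4.congr_fderiv (ContinuousLinearMap.ext fun x => ?_)
  simp only [_root_.add_apply, _root_.smul_apply, _root_.sub_apply, linForm_apply,
    ContinuousLinearMap.coe_fst', smul_eq_mul]
  change _ * (horizonFactor a m c q.1 (f q) * _) + horizonFactor a m c q.1 (f q) * _ = _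
  have hP := rPlus_mul_rMinus ham
  have hS := rPlus_add_rMinus a m
  rw [kerrDelta_eq ham, kerrKappa, ← hP]
  have hm' : m = (rPlus a m + rMinus a m) / 2 := by linarith
  have h0 : 0 ≤ rMinus a m := rMinus_nonneg ham
  have : rPlus a m + rMinus a m ≠ 0 := by linarith
  generalize rPlus a m = A at *
  generalize rMinus a m = B at *
  generalize horizonFactor a m c q.1 (f q) = E
  subst hm'
  field_simp
  ring

/-- The differentials of the optical function and of `r̃` in a chart in which `σ` represents
`sin² θ`. -/
theorem LocalOptical.eventually_fderiv {a m r ς B ur uς vς : ℝ} {f u v : ℝ × ℝ → ℝ} (ham : |a| < m)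
    (hr : rMinus a m < r) (h : LocalOptical a m r ς B f u v ur uς vς)
    (hf : ∀ᶠ q : ℝ × ℝ in 𝓝 (r, ς), ∀ θ ∈ Icc 0 Real.pi, Real.sin θ ^ 2 = q.2 →
        fStar a m q.1 θ = f q) (c : ℝ) {p : Coord} {σ Θ : Coord → ℝ} (hp : p 1 = r)
    (hσ : ContDiffAt ℝ 1 σ p) (hσp : σ p = ς)
    (hΘ : ∀ᶠ x in 𝓝 p, Θ x ∈ Icc 0 Real.pi ∧ Real.sin (Θ x) ^ 2 = σ x) :
    ∀ᶠ x in 𝓝 p,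
      (DifferentiableAt ℝ (fun x => ubZero a m (x 0) (x 1) (Θ x)) x ∧
        DifferentiableAt ℝ (fun x => rTilde a m c (x 1) (Θ x)) x) ∧
      (∀ w, fderiv ℝ (fun x => ubZero a m (x 0) (x 1) (Θ x)) x w =
        w 0 + u (x 1, σ x) * w 1 + v (x 1, σ x) * fderiv ℝ σ x w) ∧
      ∃ C ≠ 0, ∀ w, fderiv ℝ (fun x => rTilde a m c (x 1) (Θ x)) x w =
        C * ((x 1 ^ 2 + a ^ 2 + kerrDelta a m (x 1) * u (x 1, σ x)) * w 1
          + kerrDelta a m (x 1) * v (x 1, σ x) * fderiv ℝ σ x w) := by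
  have hcont : Tendsto (fun x : Coord => (x 1, σ x)) (𝓝 p) (𝓝 (r, ς)) := by
    rw [← hp, ← hσp]
    exact (continuous_apply 1).continuousAt.prodMk hσ.continuousAt
  have hrr : ∀ᶠ x : Coord in 𝓝 p, rMinus a m < x 1 :=
    (continuous_apply 1).continuousAt.eventually (lt_mem_nhds (hr.trans_eq hp.symm))
  have hval : ∀ᶠ x in 𝓝 p, fStar a m (x 1) (Θ x) = f (x 1, σ x) := by
    filter_upwards [hcont.eventually hf, hΘ] with x h1 h2 using h1 _ h2.1 h2.2
  filter_upwards [hval.eventually_nhds, hcont.eventually h.hasFDerivAt, hrr.eventually_nhds,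
    hσ.eventually (by simp)] with x e1 e2 e3 e4
  have hr0 := e3.self_of_nhds
  have d1 : HasFDerivAt (fun x : Coord => (x 1, σ x))
      ((ContinuousLinearMap.proj (R := ℝ) (φ := fun _ : Fin 4 => ℝ) 1).prod (fderiv ℝ σ x)) x :=
    (hasFDerivAt_apply (𝕜 := ℝ) 1 x).prodMk (e4.differentiableAt one_ne_zero).hasFDerivAt
  have dU := ((hasFDerivAt_apply (𝕜 := ℝ) (0 : Fin 4) x).add (e2.comp x d1)).congr_of_eventuallyEq
    (f₁ := fun x => ubZero a m (x 0) (x 1) (Θ x)) (by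
      filter_upwards [e1] with y hy
      simp only [ubZero, hy, Pi.add_apply, Function.comp_apply])
  have dR := ((hasFDerivAt_rHat ham c (q := (x 1, σ x)) hr0 e2).comp x d1).congr_of_eventuallyEq
    (f₁ := fun x => rTilde a m c (x 1) (Θ x)) (by
      filter_upwards [e1, e3] with y hy hy'
      simp only [rTilde_eq ham hy', hy, Function.comp_apply])
  refine ⟨⟨dU.differentiableAt, dR.differentiableAt⟩, fun w => ?_,
    horizonFactor a m c (x 1) (f (x 1, σ x)) * kerrKappa a m / (x 1 - rMinus a m), ?_,
    fun w => ?_⟩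
  · rw [dU.fderiv]
    simp [add_assoc]
  · have := horizonFactor_pos a m c (x 1) (f (x 1, σ x))
    have := kerrKappa_pos ham
    have : x 1 - rMinus a m ≠ 0 := by linarith
    positivity
  · rw [dR.fderiv]
    simp

/-! ### The expansions off the axis -/

theorem kerrQ_eq (a r θ : ℝ) : kerrQ a r θ = r ^ 2 + a ^ 2 * (1 - Real.sin θ ^ 2) := by
  rw [kerrQ, Real.cos_sq']

theorem kerrQ_pos {r : ℝ} (hr : 0 < r) (a θ : ℝ) : 0 < kerrQ a r θ := by
  unfold kerrQ; positivity

/-- The Kerr–Schild form of the metric: the last term is the square of a null covector. -/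
def kerrSchild (a m r s : ℝ) (v w : Coord) : ℝ :=
  -(v 0 * w 0) + (v 0 * w 1 + v 1 * w 0) - a * s * (v 1 * w 3 + v 3 * w 1)
    + s * (r ^ 2 + a ^ 2) * (v 3 * w 3) + (r ^ 2 + a ^ 2 * (1 - s)) * (v 2 * w 2)
    + 2 * m * r / (r ^ 2 + a ^ 2 * (1 - s)) * ((v 0 - a * s * v 3) * (w 0 - a * s * w 3))

theorem kerrEF_inner {a m : ℝ} {x : Coord} (hr : 0 < x 1)
    (hR : 0 ≤ radPoly a m (x 1) (Real.sin (x 2) ^ 2)) (v w : Coord) :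
    (kerrEF a m).inner x v w = kerrSchild a m (x 1) (Real.sin (x 2) ^ 2) v w := by
  have h1 : kerrSigma a m (x 1) (x 2) ^ 2 = radPoly a m (x 1) (Real.sin (x 2) ^ 2) := by
    rw [kerrSigma_eq]; exact Real.sq_sqrt hR
  have hQ := kerrQ_pos hr a (x 2)
  simp only [ChartMetric.inner, kerrEF, h1]
  rw [kerrSchild, ← kerrQ_eq]
  simp only [Matrix.mulVec, dotProduct, Fin.sum_univ_four, Matrix.of_apply, Matrix.cons_val',
    Matrix.cons_val_zero, Matrix.cons_val_one, Matrix.cons_val, Matrix.cons_val_fin_one]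
  have h2 : radPoly a m (x 1) (Real.sin (x 2) ^ 2) =
      (x 1 ^ 2 + a ^ 2) * kerrQ a (x 1) (x 2) + 2 * m * x 1 * a ^ 2 * Real.sin (x 2) ^ 2 := by
    rw [kerrQ_eq]; unfold radPoly kerrDelta; ring
  rw [h2]
  field_simp
  ring

theorem kerrEF_isSymm (a m : ℝ) (x : Coord) : (kerrEF a m x).IsSymm := by
  ext i j
  fin_cases i <;> fin_cases j <;> simp [kerrEF]

theorem kerrEF_contDiffAt {a m : ℝ} {p : Coord} (hr : 0 < p 1)
    (hR : 0 < radPoly a m (p 1) (Real.sin (p 2) ^ 2)) (i j : Fin 4) :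
    ContDiffAt ℝ 1 (fun x => kerrEF a m x i j) p := by
  have hQ := (kerrQ_pos hr a (p 2)).ne'
  have c1 : ContDiffAt ℝ 1 (fun x : Coord => x 1) p := by fun_prop
  have cs : ContDiffAt ℝ 1 (fun x : Coord => Real.sin (x 2) ^ 2) p := by fun_prop
  have cQ : ContDiffAt ℝ 1 (fun x : Coord => kerrQ a (x 1) (x 2)) p := by unfold kerrQ; fun_prop
  have cS : ContDiffAt ℝ 1 (fun x : Coord => kerrSigma a m (x 1) (x 2)) p := by
    refine ContDiffAt.sqrt ?_ hR.ne'
    unfold kerrDelta; fun_prop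
  have c03 : ContDiffAt ℝ 1
      (fun x : Coord => -(2 * m * x 1 * a * Real.sin (x 2) ^ 2 / kerrQ a (x 1) (x 2))) p :=
    ((contDiffAt_const.mul c1).mul contDiffAt_const |>.mul cs |>.div cQ hQ).neg
  have c00 : ContDiffAt ℝ 1 (fun x : Coord => -(1 - 2 * m * x 1 / kerrQ a (x 1) (x 2))) p :=
    (contDiffAt_const.sub ((contDiffAt_const.mul c1).div cQ hQ)).neg
  have c13 : ContDiffAt ℝ 1 (fun x : Coord => -(a * Real.sin (x 2) ^ 2)) p := by fun_prop
  have c33 : ContDiffAt ℝ 1 (fun x : Coord =>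
      kerrSigma a m (x 1) (x 2) ^ 2 * Real.sin (x 2) ^ 2 / kerrQ a (x 1) (x 2)) p :=
    ((cS.pow 2).mul cs).div cQ hQ
  fin_cases i <;> fin_cases j <;>
    simp only [kerrEF, Fin.zero_eta, Fin.mk_one, Fin.reduceFinMk, Matrix.of_apply, Matrix.cons_val',
      Matrix.cons_val_zero, Matrix.cons_val_one, Matrix.cons_val, Matrix.cons_val_fin_one] <;>
    first
      | exact contDiffAt_const
      | assumption

/-- The derivative of `g(v, v)` for a constant coordinate vector `v`. -/
theorem kerrEF_dInner {a m : ℝ} {p : Coord} (hr : 0 < p 1)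
    (hR : 0 < radPoly a m (p 1) (Real.sin (p 2) ^ 2)) (z v : Coord) :
    (kerrEF a m).dInner p z v v =
      (2 * p 1 * Real.sin (p 2) ^ 2 * v 3 ^ 2 + 2 * p 1 * v 2 ^ 2
        + 2 * m * (kerrQ a (p 1) (p 2) - 2 * p 1 ^ 2) / kerrQ a (p 1) (p 2) ^ 2 *
          (v 0 - a * Real.sin (p 2) ^ 2 * v 3) ^ 2) * z 1
      + (-(2 * a * v 1 * v 3) + (p 1 ^ 2 + a ^ 2) * v 3 ^ 2 - a ^ 2 * v 2 ^ 2
        + 2 * m * p 1 * a ^ 2 / kerrQ a (p 1) (p 2) ^ 2 *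
          (v 0 - a * Real.sin (p 2) ^ 2 * v 3) ^ 2
        - 4 * m * p 1 * a * v 3 / kerrQ a (p 1) (p 2) * (v 0 - a * Real.sin (p 2) ^ 2 * v 3))
        * (2 * Real.sin (p 2) * Real.cos (p 2) * z 2) := by
  have hQ := (kerrQ_pos hr a (p 2)).ne'
  rw [kerrQ_eq] at hQ ⊢
  have e : (fun y => (kerrEF a m).inner y v v) =ᶠ[𝓝 p]
      fun y => kerrSchild a m (y 1) (Real.sin (y 2) ^ 2) v v := by
    have c : ContinuousAt (fun y : Coord => radPoly a m (y 1) (Real.sin (y 2) ^ 2)) p := by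
      unfold radPoly kerrDelta; fun_prop
    filter_upwards [(continuous_apply (1 : Fin 4)).continuousAt.eventually (lt_mem_nhds hr),
      c.eventually (lt_mem_nhds hR)] with y h1 h2
    exact kerrEF_inner h1 h2.le v v
  have d1 := hasFDerivAt_apply (𝕜 := ℝ) (1 : Fin 4) p
  have d2 := hasFDerivAt_apply (𝕜 := ℝ) (2 : Fin 4) p
  have ds := d2.sin.pow 2
  have dQ := (d1.pow 2).add ((ds.const_sub 1).const_mul (a ^ 2))
  have dk := (((ds.mul ((d1.pow 2).add_const (a ^ 2))).mul_const (v 3 * v 3)).add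
    (dQ.mul_const (v 2 * v 2))).add (((d1.const_mul (2 * m)).mul ((hasDerivAt_inv hQ).comp_hasFDerivAt p dQ)).mul
      (((ds.const_mul a).mul_const (v 3)).const_sub (v 0) |>.pow 2))
  have dl := (ds.const_mul (-(a * (v 1 * v 3 + v 3 * v 1)))).const_add
    (-(v 0 * v 0) + (v 0 * v 1 + v 1 * v 0))
  have dE := (dl.add dk).congr_of_eventuallyEq
    (f₁ := fun y : Coord => kerrSchild a m (y 1) (Real.sin (y 2) ^ 2) v v)
    (Eventually.of_forall fun y => by
      simp only [kerrSchild, Pi.add_apply, Pi.mul_apply, Function.comp_apply]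
      ring)
  rw [ChartMetric.dInner, e.fderiv_eq, dE.fderiv]
  simp only [_root_.add_apply, _root_.smul_apply, _root_.neg_apply, smul_eq_mul,
    ContinuousLinearMap.proj_apply, Pi.add_apply, Pi.mul_apply, Function.comp_apply,
    nsmul_eq_mul, Nat.cast_ofNat, Nat.add_one_sub_one, pow_one]
  field_simp
  ring

/-- Used for the invariance of the null fields under rotations, in the coordinate direction `∂_φ`.
-/
theorem fderiv_apply_eq_zero_of_const {L : Coord → Coord} {p v : Coord}
    (hL : DifferentiableAt ℝ L p) (h : ∀ t : ℝ, L (p + t • v) = L p) : fderiv ℝ L p v = 0 := by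
  have h1 : HasDerivAt (fun t : ℝ => p + t • v) v 0 := by
    simpa using ((hasDerivAt_id (0 : ℝ)).smul_const v).const_add p
  have h2 := HasFDerivAt.comp_hasDerivAt (x := (0 : ℝ)) (f := fun t : ℝ => p + t • v)
    (l := L) (l' := fderiv ℝ L p) (by simpa using hL.hasFDerivAt) h1
  have h3 : L ∘ (fun t : ℝ => p + t • v) = fun _ => L p := funext h
  rw [h3] at h2
  exact h2.unique (hasDerivAt_const _ _)

theorem fderiv_coord {L : Coord → Coord} {p : Coord} (hL : DifferentiableAt ℝ L p) (i : Fin 4)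
    (v : Coord) : fderiv ℝ L p v i = fderiv ℝ (fun y => L y i) p v := by
  rw [((hasFDerivAt_pi'.1 hL.hasFDerivAt) i).fderiv]
  rfl

/-- The linear form on coordinate vectors with components `b`, `c` in the second and third
coordinate. -/
def coordForm (b c : ℝ) : Coord →L[ℝ] ℝ :=
  b • ContinuousLinearMap.proj (R := ℝ) (φ := fun _ : Fin 4 => ℝ) 1
    + c • ContinuousLinearMap.proj (R := ℝ) (φ := fun _ : Fin 4 => ℝ) 2

@[simp]
theorem coordForm_apply (b c : ℝ) (w : Coord) : coordForm b c w = b * w 1 + c * w 2 := by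
  simp [coordForm]

/-- The algebraic identity behind `kerrEF_expansion`, in which `Q`, `R`, `s`, `k` stand for `|q|²`,
`Σ(r, θ)²`, `sin θ`, `cos θ`, `S` and `P` for `Σ̂` and `P̂`, and `b` for `a²`. The quotients on the
left are the contributions of the two tangent vectors; `A₁` and `A₂` are the derivatives of `g(∂_φ,
∂_φ)`, up to the factor `2 sin θ cos θ` in the second. -/
theorem expansion_algebra {Q R s k S P Sr Pr Pt Δ Δ' r lam A₁ A₂ b : ℝ} (hQ : Q ≠ 0) (hR : R ≠ 0)
    (hs : s ≠ 0) (he : S ^ 2 + Δ * P ^ 2 = R) (heθ : S * Pr + P * Pt + b * s * k = 0)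
    (h₁ : A₁ = s ^ 2 * ((2 * S * Sr + Δ' * P ^ 2 + 2 * Δ * P * Pr) * Q - 2 * r * R) / Q ^ 2)
    (h₂ : A₂ = (R * Q + b * s ^ 2 * (R - Δ * Q)) / Q ^ 2) :
    lam * (Q * (S * (S * Pt - P * Δ * Pr) - P * (S * (Δ * Pr) - P * Δ * Sr))
        + (S * (2 * r * R - Δ' * Q * P ^ 2) - 2 * s * k * P * b * R) / 2) / (Q * R)
      + lam / 2 * (S * A₁ + 2 * s * k * P * A₂) / (s ^ 2 * R / Q)
    = lam * (Sr + Pt + k / s * P) := by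
  have hb : b * s * k = -(S * Pr + P * Pt) := by linarith
  have e1 : 2 * s * k * P * b * R = -2 * (S * Pr + P * Pt) * P * R := by
    linear_combination 2 * P * R * hb
  have e2 : 2 * s * k * P * A₂ =
      (2 * s * k * P * R * Q - 2 * s ^ 2 * (S * Pr + P * Pt) * P * (R - Δ * Q)) / Q ^ 2 := by
    rw [h₂]; field_simp; linear_combination P * s * (R - Δ * Q) * hb
  rw [e1, e2, h₁]
  field_simp
  rw [← he]
  ring

/-- The expansion of a field `L` with `(r, θ)`-components `λ (Σ̂, P̂)` along the tangent vectors
`Σ̂ ∂_θ - P̂ (Δ ∂_r + (r² + a²) ∂_u + a ∂_φ)` and `∂_φ`. Here `Σ̂` and `P̂` stand for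
`r² + a² + Δ ∂_r f` and `∂_θ f`; the hypotheses are the eikonal equation, its derivatives, and the
equality of the mixed derivatives of `f`. -/
theorem kerrEF_expansion {a m : ℝ} {p : Coord} (hr : 0 < p 1) (hsin : Real.sin (p 2) ≠ 0)
    (hR : 0 < radPoly a m (p 1) (Real.sin (p 2) ^ 2)) {L : Coord → Coord}
    (hL : DifferentiableAt ℝ L p) {lam Sg P : Coord → ℝ} {Sr St Pr Pt : ℝ}
    (h1 : ∀ y, L y 1 = lam y * Sg y) (h2 : ∀ y, L y 2 = lam y * P y)
    (hlam : DifferentiableAt ℝ lam p)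
    (hSg : HasFDerivAt Sg (coordForm Sr St) p)
    (hP : HasFDerivAt P (coordForm Pr Pt) p)
    (hinv : ∀ t : ℝ, L (p + t • ![0, 0, 0, 1]) = L p)
    (he : Sg p ^ 2 + kerrDelta a m (p 1) * P p ^ 2 = radPoly a m (p 1) (Real.sin (p 2) ^ 2))
    (heθ : Sg p * Pr + P p * Pt + a ^ 2 * Real.sin (p 2) * Real.cos (p 2) = 0)
    (her : 2 * Sg p * Sr + (2 * p 1 - 2 * m) * P p ^ 2 + 2 * kerrDelta a m (p 1) * P p * Pr =
      4 * p 1 * (p 1 ^ 2 + a ^ 2) - a ^ 2 * Real.sin (p 2) ^ 2 * (2 * p 1 - 2 * m))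
    (hSt : St = kerrDelta a m (p 1) * Pr) {X : Coord}
    (hX : X = ![-(P p * (p 1 ^ 2 + a ^ 2)), -(P p * kerrDelta a m (p 1)), Sg p, -(a * P p)]) :
    (kerrEF a m).inner p X X =
      kerrQ a (p 1) (p 2) * radPoly a m (p 1) (Real.sin (p 2) ^ 2) ∧
    (kerrEF a m).inner p ![0, 0, 0, 1] ![0, 0, 0, 1] =
      Real.sin (p 2) ^ 2 * radPoly a m (p 1) (Real.sin (p 2) ^ 2) / kerrQ a (p 1) (p 2) ∧
    (kerrEF a m).inner p X ![0, 0, 0, 1] = 0 ∧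
    expTerm (kerrEF a m) L p X / (kerrEF a m).inner p X X +
      expTerm (kerrEF a m) L p ![0, 0, 0, 1] /
        (kerrEF a m).inner p ![0, 0, 0, 1] ![0, 0, 0, 1] =
      lam p * (Sr + Pt + Real.cos (p 2) / Real.sin (p 2) * P p) := by
  have hQ := kerrQ_pos hr a (p 2)
  have hQe := kerrQ_eq a (p 1) (p 2)
  have hQ' := hQ.ne'
  have hc := Real.cos_sq' (p 2)
  have f1 : ∀ w, fderiv ℝ L p w 1 = fderiv ℝ lam p w * Sg p + lam p * (Sr * w 1 + St * w 2) := by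
    intro w
    rw [fderiv_coord hL, funext h1, (hlam.hasFDerivAt.fun_mul hSg).fderiv]
    simp; ring
  have f2 : ∀ w, fderiv ℝ L p w 2 = fderiv ℝ lam p w * P p + lam p * (Pr * w 1 + Pt * w 2) := by
    intro w
    rw [fderiv_coord hL, funext h2, (hlam.hasFDerivAt.fun_mul hP).fderiv]
    simp; ring
  have hΔ : kerrDelta a m (p 1) = p 1 ^ 2 + a ^ 2 - 2 * m * p 1 := by unfold kerrDelta; ring
  have iX : ∀ w, (kerrEF a m).inner p w X =
      kerrQ a (p 1) (p 2) * (Sg p * w 2 - P p * w 1) := by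
    intro w
    rw [kerrEF_inner hr hR.le, kerrSchild, ← kerrQ_eq, hX]
    simp only [Matrix.cons_val_zero, Matrix.cons_val_one, Matrix.cons_val]
    rw [hΔ]
    field_simp
    rw [hQe]
    ring
  have hXX : (kerrEF a m).inner p X X =
      kerrQ a (p 1) (p 2) * radPoly a m (p 1) (Real.sin (p 2) ^ 2) := by
    rw [iX, ← he, hX]
    simp only [Matrix.cons_val_zero, Matrix.cons_val_one, Matrix.cons_val]
    ring
  have hpp : (kerrEF a m).inner p ![0, 0, 0, 1] ![0, 0, 0, 1] =
      Real.sin (p 2) ^ 2 * radPoly a m (p 1) (Real.sin (p 2) ^ 2) / kerrQ a (p 1) (p 2) := by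
    rw [kerrEF_inner hr hR.le, kerrSchild, ← kerrQ_eq]
    simp only [Matrix.cons_val_zero, Matrix.cons_val_one, Matrix.cons_val]
    field_simp
    unfold radPoly
    rw [hΔ, hQe]
    ring
  refine ⟨hXX, hpp, ?_, ?_⟩
  · rw [inner_comm (kerrEF_isSymm a m p), iX]
    simp
  have tX : expTerm (kerrEF a m) L p X = lam p * (kerrQ a (p 1) (p 2) *
        (Sg p * (Sg p * Pt - P p * kerrDelta a m (p 1) * Pr)
          - P p * (Sg p * St - P p * kerrDelta a m (p 1) * Sr))
      + (Sg p * (2 * p 1 * radPoly a m (p 1) (Real.sin (p 2) ^ 2)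
          - (2 * p 1 - 2 * m) * kerrQ a (p 1) (p 2) * P p ^ 2)
        - 2 * Real.sin (p 2) * Real.cos (p 2) * P p * a ^ 2
          * radPoly a m (p 1) (Real.sin (p 2) ^ 2)) / 2) := by
    rw [expTerm, iX, kerrEF_dInner hr hR, f1, f2, h1, h2, ← he, hX]
    simp only [Matrix.cons_val_zero, Matrix.cons_val_one, Matrix.cons_val]
    have e : -(P p * (p 1 ^ 2 + a ^ 2)) - a * Real.sin (p 2) ^ 2 * -(a * P p)
        = -(P p * kerrQ a (p 1) (p 2)) := by rw [hQe]; ring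
    rw [e]
    field_simp
    rw [hΔ, hQe]
    ring
  have tφ : expTerm (kerrEF a m) L p ![0, 0, 0, 1] = lam p / 2 *
      (Sg p * (2 * p 1 * Real.sin (p 2) ^ 2 + 2 * m * (kerrQ a (p 1) (p 2) - 2 * p 1 ^ 2)
          / kerrQ a (p 1) (p 2) ^ 2 * (a * Real.sin (p 2) ^ 2) ^ 2)
        + 2 * Real.sin (p 2) * Real.cos (p 2) * P p * ((p 1 ^ 2 + a ^ 2)
          + 2 * m * p 1 * a ^ 2 / kerrQ a (p 1) (p 2) ^ 2 * (a * Real.sin (p 2) ^ 2) ^ 2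
          + 4 * m * p 1 * a / kerrQ a (p 1) (p 2) * (a * Real.sin (p 2) ^ 2))) := by
    rw [expTerm, fderiv_apply_eq_zero_of_const hL hinv, kerrEF_dInner hr hR, h1, h2]
    have : (kerrEF a m).inner p 0 ![0, 0, 0, 1] = 0 := by simp [ChartMetric.inner]
    rw [this]
    simp only [Matrix.cons_val_zero, Matrix.cons_val_one, Matrix.cons_val]
    ring
  rw [hXX, hpp, tX, tφ, hSt]
  have hRe : radPoly a m (p 1) (Real.sin (p 2) ^ 2) = (p 1 ^ 2 + a ^ 2) * kerrQ a (p 1) (p 2) +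
      2 * m * p 1 * a ^ 2 * Real.sin (p 2) ^ 2 := by
    rw [kerrQ_eq]; unfold radPoly kerrDelta; ring
  refine expansion_algebra hQ' hR.ne' hsin he heθ ?_ ?_
  · have : 2 * Sg p * Sr + (2 * p 1 - 2 * m) * P p ^ 2 + 2 * kerrDelta a m (p 1) * P p * Pr =
        4 * p 1 * (p 1 ^ 2 + a ^ 2) - a ^ 2 * Real.sin (p 2) ^ 2 * (2 * p 1 - 2 * m) := her
    rw [this, hRe]
    field_simp
    rw [hQe]
    ring
  · rw [hRe, hΔ]
    field_simp
    rw [hQe]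
    ring

/-- `-D U` for `U = u̲ + f`, with `U`, `P` the partial derivatives `∂_r f`, `∂_θ f` and
`s = sin² θ`. -/
theorem kerrSchild_incoming {a m r s U P : ℝ} (hQ : r ^ 2 + a ^ 2 * (1 - s) ≠ 0) {L : Coord}
    (h0 : L 0 = -(r ^ 2 + a ^ 2 * (1 - s))⁻¹ * ((r ^ 2 + a ^ 2) * U + a ^ 2 * s))
    (h1 : L 1 = -(r ^ 2 + a ^ 2 * (1 - s))⁻¹ * (r ^ 2 + a ^ 2 + kerrDelta a m r * U))
    (h2 : L 2 = -(r ^ 2 + a ^ 2 * (1 - s))⁻¹ * P)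
    (h3 : L 3 = -(r ^ 2 + a ^ 2 * (1 - s))⁻¹ * (a * (1 + U))) (w : Coord) :
    kerrSchild a m r s L w = -(w 0 + U * w 1 + P * w 2) := by
  rw [kerrSchild, h0, h1, h2, h3, kerrDelta]
  field_simp
  ring

/-- The outgoing null field is the metric dual of a combination of the differentials of the two
functions defining the spheres. -/
theorem kerrSchild_outgoing {a m r s U P R : ℝ} (hQ : r ^ 2 + a ^ 2 * (1 - s) ≠ 0) (hR : R ≠ 0)
    {L : Coord}
    (h0 : L 0 = (2 * (r ^ 2 + a ^ 2) * (r ^ 2 + a ^ 2 + kerrDelta a m r * U)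
      - kerrDelta a m r * ((r ^ 2 + a ^ 2) * U + a ^ 2 * s)) / R)
    (h1 : L 1 = kerrDelta a m r / R * (r ^ 2 + a ^ 2 + kerrDelta a m r * U))
    (h2 : L 2 = kerrDelta a m r / R * P)
    (h3 : L 3 = (2 * a * (r ^ 2 + a ^ 2 + kerrDelta a m r * U)
      - kerrDelta a m r * (a * (1 + U))) / R) (w : Coord) :
    kerrSchild a m r s L w = -((r ^ 2 + a ^ 2 * (1 - s)) / R) *
      (kerrDelta a m r * (w 0 + U * w 1 + P * w 2) - 2 *
        ((r ^ 2 + a ^ 2 + kerrDelta a m r * U) * w 1 + kerrDelta a m r * P * w 2)) := by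
  rw [kerrSchild, h0, h1, h2, h3, kerrDelta]
  field_simp
  ring

/-- Off the axis the null fields `L₃ = -D(u̲ + f)` and `L₄` have `(r, θ)`-components `λ (Σ̂, P̂)`
with `λ = -1/|q|²` and `λ = Δ/Σ²`, so that both expansions follow from `kerrEF_expansion`. -/
theorem LocalOptical.hasNullExpansions_off_axis {a m r θ B ur uς vς : ℝ} {f u v : ℝ × ℝ → ℝ}
    (ham : |a| < m) (hr : rMinus a m < r) (hθ : θ ∈ Ioo 0 Real.pi)
    (h : LocalOptical a m r (Real.sin θ ^ 2) B f u v ur uς vς)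
    (hf : ∀ᶠ q : ℝ × ℝ in 𝓝 (r, Real.sin θ ^ 2), ∀ θ ∈ Icc 0 Real.pi, Real.sin θ ^ 2 = q.2 →
        fStar a m q.1 θ = f q) (c u₀ φ : ℝ) :
    HasNullExpansions (kerrEF a m) (fun x => ubZero a m (x 0) (x 1) (x 2))
        (fun x => rTilde a m c (x 1) (x 2)) ![u₀, r, θ, φ]
      (kerrDelta a m r * B / radPoly a m r (Real.sin θ ^ 2)) (-(B / kerrQ a r θ)) := by
  set p : Coord := ![u₀, r, θ, φ] with hp
  have p1 : p 1 = r := rfl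
  have p2 : p 2 = θ := rfl
  have hr0 : 0 < r := (rMinus_nonneg ham).trans_lt hr
  have hsin : 0 < Real.sin θ := Real.sin_pos_of_mem_Ioo hθ
  have hς : Real.sin θ ^ 2 ∈ Icc (0 : ℝ) 1 := ⟨sq_nonneg _, Real.sin_sq_le_one θ⟩
  have hRp : 0 < radPoly a m r (Real.sin θ ^ 2) :=
    radDom_radPoly_pos (mem_radDom ham hr0 hς)
  have cσ : ContDiffAt ℝ 1 (fun x : Coord => Real.sin (x 2) ^ 2) p := by fun_prop
  have hcont : Tendsto (fun x : Coord => (x 1, Real.sin (x 2) ^ 2)) (𝓝 p)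
      (𝓝 (r, Real.sin θ ^ 2)) :=
    (continuous_apply (1 : Fin 4)).continuousAt.prodMk cσ.continuousAt
  have hΘ : ∀ᶠ x : Coord in 𝓝 p, x 2 ∈ Icc 0 Real.pi ∧
      Real.sin (x 2) ^ 2 = (fun x : Coord => Real.sin (x 2) ^ 2) x := by
    filter_upwards [(continuous_apply (2 : Fin 4)).continuousAt.eventually
      (Ioo_mem_nhds (show 0 < p 2 from hθ.1) (show p 2 < Real.pi from hθ.2))] with x hx
    exact ⟨Ioo_subset_Icc_self hx, rfl⟩
  have hd := h.eventually_fderiv ham hr hf c (p := p) (Θ := fun x => x 2) p1 cσ rfl hΘ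
  -- the functions of the coordinates entering the frame
  set U : Coord → ℝ := fun y => u (y 1, Real.sin (y 2) ^ 2) with hU
  set V : Coord → ℝ := fun y => v (y 1, Real.sin (y 2) ^ 2) with hV
  have cU : ContDiffAt ℝ 1 U p := ContDiffAt.comp (g := u) p h.u_contDiff (by fun_prop)
  have cV : ContDiffAt ℝ 1 V p := ContDiffAt.comp (g := v) p h.v_contDiff (by fun_prop)
  set D : Coord → ℝ := fun y => kerrDelta a m (y 1) with hD
  have cD : ContDiffAt ℝ 1 D p := by simp only [hD]; unfold kerrDelta; fun_prop
  set Sg : Coord → ℝ := fun y => y 1 ^ 2 + a ^ 2 + D y * U y with hSg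
  set P : Coord → ℝ := fun y => 2 * Real.sin (y 2) * Real.cos (y 2) * V y with hP
  have cSg : ContDiffAt ℝ 1 Sg p := by fun_prop
  have cP : ContDiffAt ℝ 1 P p := by fun_prop
  set q₃ : Coord → ℝ := fun y => -(y 1 ^ 2 + a ^ 2 * (1 - Real.sin (y 2) ^ 2))⁻¹ with hq₃
  have hQ0 : p 1 ^ 2 + a ^ 2 * (1 - Real.sin (p 2) ^ 2) ≠ 0 := by
    rw [← kerrQ_eq]; exact (kerrQ_pos hr0 a θ).ne'
  have cQ : ContDiffAt ℝ 1 (fun y : Coord => y 1 ^ 2 + a ^ 2 * (1 - Real.sin (y 2) ^ 2)) p := by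
    fun_prop
  have cq₃ : ContDiffAt ℝ 1 q₃ p := (cQ.inv hQ0).neg
  set R : Coord → ℝ := fun y => radPoly a m (y 1) (Real.sin (y 2) ^ 2) with hR
  have cR : ContDiffAt ℝ 1 R p := by simp only [hR]; unfold radPoly kerrDelta; fun_prop
  set q₄ : Coord → ℝ := fun y => D y / R y with hq₄
  have cq₄ : ContDiffAt ℝ 1 q₄ p := cD.div cR hRp.ne'
  set L₃ : Coord → Coord := fun y => ![q₃ y * ((y 1 ^ 2 + a ^ 2) * U y + a ^ 2 * Real.sin (y 2) ^ 2),
    q₃ y * Sg y, q₃ y * P y, q₃ y * (a * (1 + U y))] with hL₃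
  set L₄ : Coord → Coord := fun y => ![(2 * (y 1 ^ 2 + a ^ 2) * Sg y
      - D y * ((y 1 ^ 2 + a ^ 2) * U y + a ^ 2 * Real.sin (y 2) ^ 2)) / R y,
    q₄ y * Sg y, q₄ y * P y, (2 * a * Sg y - D y * (a * (1 + U y))) / R y] with hL₄
  set X : Coord → Coord := fun y => ![-(P y * (y 1 ^ 2 + a ^ 2)), -(P y * D y), Sg y, -(a * P y)]
    with hX
  have cL₃ : ContDiffAt ℝ 1 L₃ p := by
    refine contDiffAt_pi.2 fun i => ?_
    fin_cases i <;> simp only [hL₃, Fin.zero_eta, Fin.mk_one, Fin.reduceFinMk,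
      Matrix.cons_val_zero, Matrix.cons_val_one, Matrix.cons_val] <;> fun_prop
  have cL₄ : ContDiffAt ℝ 1 L₄ p := by
    refine contDiffAt_pi.2 fun i => ?_
    fin_cases i <;> simp only [hL₄, Fin.zero_eta, Fin.mk_one, Fin.reduceFinMk,
      Matrix.cons_val_zero, Matrix.cons_val_one, Matrix.cons_val]
    · exact ContDiffAt.div (by fun_prop) cR hRp.ne'
    · fun_prop
    · fun_prop
    · exact ContDiffAt.div (by fun_prop) cR hRp.ne'
  have cX : ContDiffAt ℝ 1 X p := by
    refine contDiffAt_pi.2 fun i => ?_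
    fin_cases i <;> simp only [hX, Fin.zero_eta, Fin.mk_one, Fin.reduceFinMk,
      Matrix.cons_val_zero, Matrix.cons_val_one, Matrix.cons_val] <;> fun_prop
  have dσ : ∀ x w : Coord, fderiv ℝ (fun x : Coord => Real.sin (x 2) ^ 2) x w =
      2 * Real.sin (x 2) * Real.cos (x 2) * w 2 := by
    intro x w
    rw [((hasFDerivAt_apply (𝕜 := ℝ) (2 : Fin 4) x).sin.pow 2).fderiv]
    simp; ring
  have hpos : ∀ᶠ x in 𝓝 p, 0 < x 1 ∧ 0 < R x := by
    filter_upwards [(continuous_apply (1 : Fin 4)).continuousAt.eventually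
      (lt_mem_nhds (show 0 < p 1 from hr0)), cR.continuousAt.eventually (lt_mem_nhds hRp)] with x
      h1 h2 using ⟨h1, h2⟩
  have hdU : ∀ᶠ x in 𝓝 p, ∀ w, fderiv ℝ (fun x : Coord => ubZero a m (x 0) (x 1) (x 2)) x w =
      w 0 + U x * w 1 + P x * w 2 := by
    filter_upwards [hd] with x hx w
    rw [hx.2.1, dσ]
    simp only [hU, hP, hV]; ring
  have hdR : ∀ᶠ x in 𝓝 p, ∃ C ≠ 0, ∀ w, fderiv ℝ (fun x : Coord => rTilde a m c (x 1) (x 2)) x w =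
      C * (Sg x * w 1 + D x * P x * w 2) := by
    filter_upwards [hd] with x ⟨_, _, C, hC, hx⟩
    refine ⟨C, hC, fun w => ?_⟩
    rw [hx, dσ]
    simp only [hSg, hU, hP, hV, hD]; ring
  have hg₃ : ∀ᶠ x in 𝓝 p, ∀ w, (kerrEF a m).inner x (L₃ x) w = -(w 0 + U x * w 1 + P x * w 2) := by
    filter_upwards [hpos] with x ⟨x1, x2⟩ w
    rw [kerrEF_inner x1 x2.le]
    exact kerrSchild_incoming (by rw [← kerrQ_eq]; exact (kerrQ_pos x1 _ _).ne') rfl rfl rfl rfl w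
  have hg₄ : ∀ᶠ x in 𝓝 p, ∀ w, (kerrEF a m).inner x (L₄ x) w =
      -((x 1 ^ 2 + a ^ 2 * (1 - Real.sin (x 2) ^ 2)) / R x) *
        (D x * (w 0 + U x * w 1 + P x * w 2) - 2 * (Sg x * w 1 + D x * P x * w 2)) := by
    filter_upwards [hpos] with x ⟨x1, x2⟩ w
    rw [kerrEF_inner x1 x2.le]
    exact kerrSchild_outgoing (by rw [← kerrQ_eq]; exact (kerrQ_pos x1 _ _).ne') x2.ne' rfl rfl
      rfl rfl w
  have heik : ∀ᶠ x in 𝓝 p, D x * U x ^ 2 + 2 * (x 1 ^ 2 + a ^ 2) * U x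
      + a ^ 2 * Real.sin (x 2) ^ 2 + P x ^ 2 = 0 := by
    filter_upwards [hcont.eventually h.eikonal] with x hx
    have : P x ^ 2 = 4 * Real.sin (x 2) ^ 2 * (1 - Real.sin (x 2) ^ 2) * V x ^ 2 := by
      simp only [hP]; rw [← Real.cos_sq']; ring
    rw [this]; exact hx
  -- the eikonal equation multiplied by `Δ`, with the square completed
  have hsq : ∀ᶠ x in 𝓝 p, Sg x ^ 2 + D x * P x ^ 2 = R x := by
    filter_upwards [heik] with x hx
    simp only [hSg, hR, radPoly]
    change _ = _ - a ^ 2 * _ * D x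
    linear_combination D x * hx
  have hnull : ∀ᶠ x in 𝓝 p, (kerrEF a m).inner x (L₃ x) (L₃ x) = 0 ∧
      (kerrEF a m).inner x (L₄ x) (L₄ x) = 0 ∧ (kerrEF a m).inner x (L₃ x) (L₄ x) = -2 := by
    filter_upwards [hg₃, hg₄, heik, hsq, hpos] with x k3 k4 k5 k6 k7
    have hR0 : R x ≠ 0 := k7.2.ne'
    have e4 : L₄ x 0 + U x * L₄ x 1 + P x * L₄ x 2 = 2 := by
      simp only [hL₄, hq₄, Matrix.cons_val_zero, Matrix.cons_val_one, Matrix.cons_val]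
      field_simp
      simp only [hSg] at k6 ⊢
      linear_combination (-(D x)) * k5 + 2 * k6
    have e4' : Sg x * L₄ x 1 + D x * P x * L₄ x 2 = D x := by
      simp only [hL₄, hq₄, Matrix.cons_val_zero, Matrix.cons_val_one, Matrix.cons_val]
      field_simp
      linear_combination D x * k6
    refine ⟨?_, ?_, ?_⟩
    · rw [k3]
      simp only [hL₃, Matrix.cons_val_zero, Matrix.cons_val_one, Matrix.cons_val, hSg]
      linear_combination (-(q₃ x)) * k5
    · rw [k4, e4, e4']; ring
    · rw [k3, e4]
  have hspos : 0 < Sg p := h.pos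
  -- derivatives at the point
  have d1 : HasFDerivAt (fun y : Coord => y 1) (coordForm 1 0) p :=
    (hasFDerivAt_apply (𝕜 := ℝ) (1 : Fin 4) p).congr_fderiv (by ext; simp)
  have dς : HasFDerivAt (fun y : Coord => Real.sin (y 2) ^ 2)
      (coordForm 0 (2 * Real.sin θ * Real.cos θ)) p :=
    (cσ.differentiableAt one_ne_zero).hasFDerivAt.congr_fderiv
      (ContinuousLinearMap.ext fun w => by rw [dσ]; simp [p2])
  have dU : HasFDerivAt U (coordForm ur (2 * Real.sin θ * Real.cos θ * uς)) p :=
    (HasFDerivAt.comp (g := u) p h.u_deriv (d1.prodMk dς)).congr_fderiv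
      (ContinuousLinearMap.ext fun w => by simp; ring)
  have dV : HasFDerivAt V (coordForm uς (2 * Real.sin θ * Real.cos θ * vς)) p :=
    (HasFDerivAt.comp (g := v) p h.v_deriv (d1.prodMk dς)).congr_fderiv
      (ContinuousLinearMap.ext fun w => by simp; ring)
  have dD : HasFDerivAt D (coordForm (2 * r - 2 * m) 0) p := by
    have := ((d1.pow 2).sub (d1.const_mul (2 * m))).add_const (a ^ 2)
    refine this.congr_fderiv (ContinuousLinearMap.ext fun w => ?_)
    simp [p1]; ring
  have dSg : HasFDerivAt Sg (coordForm (2 * r + (2 * r - 2 * m) * U p + D p * ur)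
      (D p * (2 * Real.sin θ * Real.cos θ * uς))) p := by
    have := ((d1.pow 2).add_const (a ^ 2)).add (dD.mul dU)
    refine this.congr_fderiv (ContinuousLinearMap.ext fun w => ?_)
    simp [p1]; ring
  have dP : HasFDerivAt P (coordForm (2 * Real.sin θ * Real.cos θ * uς)
      (2 * (1 - 2 * Real.sin θ ^ 2) * V p
        + 4 * Real.sin θ ^ 2 * (1 - Real.sin θ ^ 2) * vς)) p := by
    have d2 := hasFDerivAt_apply (𝕜 := ℝ) (2 : Fin 4) p
    have := ((d2.sin.const_mul 2).mul d2.cos).mul dV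
    refine this.congr_fderiv (ContinuousLinearMap.ext fun w => ?_)
    simp [p2]
    linear_combination (w 2 * (2 * V p + 4 * Real.sin θ ^ 2 * vς)) * Real.cos_sq' θ
  -- the derivatives of the eikonal equation in the directions `∂_r` and `∂_θ`
  have dE : HasFDerivAt (fun x => D x * U x ^ 2 + 2 * (x 1 ^ 2 + a ^ 2) * U x
      + a ^ 2 * Real.sin (x 2) ^ 2 + P x ^ 2) (0 : Coord →L[ℝ] ℝ) p :=
    (hasFDerivAt_const (0 : ℝ) p).congr_of_eventuallyEq heik
  have dE' := (((dD.mul (dU.pow 2)).add ((((d1.pow 2).add_const (a ^ 2)).const_mul 2).mul dU)).add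
    (dς.const_mul (a ^ 2))).add (dP.pow 2)
  have eE := dE'.unique dE
  have eEr := congrArg (fun L : Coord →L[ℝ] ℝ => L ![0, 1, 0, 0]) eE
  have eEθ := congrArg (fun L : Coord →L[ℝ] ℝ => L ![0, 0, 1, 0]) eE
  simp [p1] at eEr eEθ
  have hE0 := heik.self_of_nhds
  -- both null fields satisfy the hypotheses of `kerrEF_expansion`
  have key : ∀ {L : Coord → Coord} {lam : Coord → ℝ}, DifferentiableAt ℝ L p →
      (∀ y, L y 1 = lam y * Sg y) → (∀ y, L y 2 = lam y * P y) → DifferentiableAt ℝ lam p →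
      (∀ t : ℝ, L (p + t • ![0, 0, 0, 1]) = L p) → _ := fun hL h1 h2 h3 h4 =>
    kerrEF_expansion (a := a) (m := m) (p := p) hr0 hsin.ne' hRp hL h1 h2 h3 dSg dP h4
      hsq.self_of_nhds
      (by
        change (p 1 ^ 2 + a ^ 2 + D p * U p) * _ + _ + a ^ 2 * Real.sin θ * Real.cos θ = 0
        rw [p1]
        linear_combination eEθ / 2)
      (by
        change 2 * (p 1 ^ 2 + a ^ 2 + D p * U p) * _ + _ + 2 * D p * _ * _ = _
        rw [p1] at hE0 ⊢
        linear_combination D p * eEr + (2 * r - 2 * m) * hE0)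
      rfl (X := X p) rfl
  have shift : ∀ (t : ℝ) (i : Fin 4), i ≠ 3 → (p + t • ![0, 0, 0, 1] : Coord) i = p i := by
    intro t i hi
    fin_cases i <;> simp at hi ⊢
  have s1 : ∀ t : ℝ, (p + t • ![0, 0, 0, 1] : Coord) 1 = p 1 := fun t => shift t 1 (by decide)
  have s2 : ∀ t : ℝ, (p + t • ![0, 0, 0, 1] : Coord) 2 = p 2 := fun t => shift t 2 (by decide)
  obtain ⟨n1, n2, n3, k3⟩ := key (L := L₃) (lam := q₃) (cL₃.differentiableAt one_ne_zero)
    (fun y => rfl) (fun y => rfl) (cq₃.differentiableAt one_ne_zero)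
    (fun t => by simp only [hL₃, hq₃, hSg, hP, hU, hV, hD, s1, s2])
  obtain ⟨-, -, -, k4⟩ := key (L := L₄) (lam := q₄) (cL₄.differentiableAt one_ne_zero)
    (fun y => rfl) (fun y => rfl) (cq₄.differentiableAt one_ne_zero)
    (fun t => by simp only [hL₄, hq₄, hR, hSg, hP, hU, hV, hD, s1, s2])
  have hB : 2 * r + (2 * r - 2 * m) * U p + D p * ur + (2 * (1 - 2 * Real.sin θ ^ 2) * V p
        + 4 * Real.sin θ ^ 2 * (1 - Real.sin θ ^ 2) * vς)
        + Real.cos θ / Real.sin θ * P p = B := by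
    rw [← h.eq_B]
    have : Real.cos θ / Real.sin θ * P p = 2 * (1 - Real.sin θ ^ 2) * V p := by
      rw [← Real.cos_sq']
      change _ * (2 * Real.sin θ * Real.cos θ * V p) = _
      field_simp
    rw [this]
    change _ = 2 * r + (2 * r - 2 * m) * U p + D p * ur + 2 * (2 - 3 * Real.sin θ ^ 2) * V p + _
    ring
  have hQp := kerrQ_pos hr0 a θ
  have final := hasNullExpansions_of_fields (fun i j => kerrEF_contDiffAt hr0 hRp i j)
    (kerrEF_isSymm a m) cL₃ cL₄ cX (contDiffAt_const (c := (![0, 0, 0, 1] : Coord)))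
    (hd.mono fun x hx => hx.1)
    (by filter_upwards [hdU, hg₃] with x h1 h2 w; rw [h1, h2])
    (by
      filter_upwards [hdU, hdR, hg₄] with x h1 ⟨C, hC, h2⟩ h3 w h4 h5
      rw [h1] at h4
      rw [h2] at h5
      rw [h3, h4, (mul_eq_zero.1 h5).resolve_left hC]
      ring)
    hnull
    (by
      filter_upwards [hdU, hdR] with x h1 ⟨C, hC, h2⟩
      rw [h1, h1, h2, h2]
      simp only [hX, hSg, Matrix.cons_val_zero, Matrix.cons_val_one, Matrix.cons_val]
      refine ⟨by ring, by ring, by ring, by ring⟩)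
    (by rw [n1]; exact mul_pos hQp hRp) (by rw [n2]; exact div_pos (mul_pos (by positivity) hRp) hQp)
    n3
  rw [k3, k4] at final
  change HasNullExpansions _ _ _ p (D p / R p * (2 * r + (2 * r - 2 * m) * U p + D p * ur
    + (2 * (1 - 2 * Real.sin θ ^ 2) * V p + 4 * Real.sin θ ^ 2 * (1 - Real.sin θ ^ 2) * vς)
        + Real.cos θ / Real.sin θ * P p))
    (-(r ^ 2 + a ^ 2 * (1 - Real.sin θ ^ 2))⁻¹ * (2 * r + (2 * r - 2 * m) * U p + D p * ur
    + (2 * (1 - 2 * Real.sin θ ^ 2) * V p + 4 * Real.sin θ ^ 2 * (1 - Real.sin θ ^ 2) * vς)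
        + Real.cos θ / Real.sin θ * P p)) at final
  rw [hB, ← kerrQ_eq] at final
  convert final using 1
  · change D p * B / R p = _
    ring
  · ring

/-! ### The expansions on the axis -/

/-- The Kerr–Schild form of the metric in the axis coordinates. -/
theorem kerrAxis_inner {a m : ℝ} {z : Coord}
    (hQ : z 1 ^ 2 + a ^ 2 * (1 - (z 2 ^ 2 + z 3 ^ 2)) ≠ 0) (v w : Coord) :
    (kerrAxis a m).inner z v w =
      -(v 0 * w 0) + (v 0 * w 1 + v 1 * w 0)
        - a * (v 1 * (z 2 * w 3 - z 3 * w 2) + (z 2 * v 3 - z 3 * v 2) * w 1)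
        + a ^ 2 * ((z 2 * v 3 - z 3 * v 2) * (z 2 * w 3 - z 3 * w 2))
        + (z 1 ^ 2 + a ^ 2 * (1 - (z 2 ^ 2 + z 3 ^ 2))) * (v 2 * w 2 + v 3 * w 3
          + (z 2 * v 2 + z 3 * v 3) * (z 2 * w 2 + z 3 * w 3) / (1 - (z 2 ^ 2 + z 3 ^ 2)))
        + 2 * m * z 1 / (z 1 ^ 2 + a ^ 2 * (1 - (z 2 ^ 2 + z 3 ^ 2))) *
          ((v 0 - a * (z 2 * v 3 - z 3 * v 2)) * (w 0 - a * (z 2 * w 3 - z 3 * w 2))) := by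
  simp only [ChartMetric.inner, kerrAxis]
  simp only [Matrix.mulVec, dotProduct, Fin.sum_univ_four, Matrix.of_apply, Matrix.cons_val',
    Matrix.cons_val_zero, Matrix.cons_val_one, Matrix.cons_val, Matrix.cons_val_fin_one]
  simp only [div_eq_mul_inv _ (1 - (z 2 ^ 2 + z 3 ^ 2))]
  generalize (1 - (z 2 ^ 2 + z 3 ^ 2))⁻¹ = k
  generalize z 1 ^ 2 + a ^ 2 * (1 - (z 2 ^ 2 + z 3 ^ 2)) = Q at *
  field_simp
  ring

theorem kerrAxis_isSymm (a m : ℝ) (z : Coord) : (kerrAxis a m z).IsSymm := by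
  ext i j
  fin_cases i <;> fin_cases j <;> simp [kerrAxis]

theorem kerrAxis_contDiffAt {a m : ℝ} {p : Coord} (hr : 0 < p 1) (h2 : p 2 = 0) (h3 : p 3 = 0)
    (i j : Fin 4) : ContDiffAt ℝ 1 (fun z => kerrAxis a m z i j) p := by
  have c1 : ContDiffAt ℝ 1 (fun x : Coord => x 1) p := by fun_prop
  have cQ : ContDiffAt ℝ 1 (fun z : Coord => z 1 ^ 2 + a ^ 2 * (1 - (z 2 ^ 2 + z 3 ^ 2))) p := by
    fun_prop
  have hQ : p 1 ^ 2 + a ^ 2 * (1 - (p 2 ^ 2 + p 3 ^ 2)) ≠ 0 := by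
    rw [h2, h3]; simp; positivity
  have ck : ContDiffAt ℝ 1 (fun z : Coord => (1 - (z 2 ^ 2 + z 3 ^ 2))⁻¹) p :=
    ContDiffAt.inv (by fun_prop) (by simp [h2, h3])
  have cQi := cQ.inv hQ
  fin_cases i <;> fin_cases j <;>
    simp only [kerrAxis, Fin.zero_eta, Fin.mk_one, Fin.reduceFinMk, Matrix.of_apply,
      Matrix.cons_val', Matrix.cons_val_zero, Matrix.cons_val_one, Matrix.cons_val,
      Matrix.cons_val_fin_one, div_eq_mul_inv] <;>
    fun_prop

/-- `-D U` for `U = u̲ + f`, with `U`, `V` the partial derivatives `∂_r f`, `∂_ς f`, `ς = x² + y²`.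
The last two components are `h (x, y) + k (-y, x)` with `h` the `ς`-part and `k` the `φ`-component.
-/
theorem kerrAxis_incoming {a m U V : ℝ} {z : Coord}
    (hQ : z 1 ^ 2 + a ^ 2 * (1 - (z 2 ^ 2 + z 3 ^ 2)) ≠ 0) (hs : 1 - (z 2 ^ 2 + z 3 ^ 2) ≠ 0)
    {q : ℝ} (hq : q = -(z 1 ^ 2 + a ^ 2 * (1 - (z 2 ^ 2 + z 3 ^ 2)))⁻¹) {L : Coord}
    (h0 : L 0 = q * ((z 1 ^ 2 + a ^ 2) * U + a ^ 2 * (z 2 ^ 2 + z 3 ^ 2)))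
    (h1 : L 1 = q * (z 1 ^ 2 + a ^ 2 + kerrDelta a m (z 1) * U))
    (h2 : L 2 = z 2 * (q * (2 * (1 - (z 2 ^ 2 + z 3 ^ 2)) * V)) - z 3 * (q * (a * (1 + U))))
    (h3 : L 3 = z 3 * (q * (2 * (1 - (z 2 ^ 2 + z 3 ^ 2)) * V)) + z 2 * (q * (a * (1 + U))))
    (w : Coord) :
    (kerrAxis a m).inner z L w = -(w 0 + U * w 1 + 2 * V * (z 2 * w 2 + z 3 * w 3)) := by
  rw [kerrAxis_inner hQ, h0, h1, h2, h3, hq, kerrDelta]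
  field_simp
  ring

/-- The analogue of `kerrSchild_outgoing` in the axis coordinates. -/
theorem kerrAxis_outgoing {a m U V R : ℝ} {z : Coord}
    (hQ : z 1 ^ 2 + a ^ 2 * (1 - (z 2 ^ 2 + z 3 ^ 2)) ≠ 0) (hs : 1 - (z 2 ^ 2 + z 3 ^ 2) ≠ 0)
    (hR : R ≠ 0) {L : Coord}
    (h0 : L 0 = (2 * (z 1 ^ 2 + a ^ 2) * (z 1 ^ 2 + a ^ 2 + kerrDelta a m (z 1) * U)
      - kerrDelta a m (z 1) * ((z 1 ^ 2 + a ^ 2) * U + a ^ 2 * (z 2 ^ 2 + z 3 ^ 2))) / R)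
    (h1 : L 1 = kerrDelta a m (z 1) / R * (z 1 ^ 2 + a ^ 2 + kerrDelta a m (z 1) * U))
    (h2 : L 2 = z 2 * (kerrDelta a m (z 1) / R * (2 * (1 - (z 2 ^ 2 + z 3 ^ 2)) * V))
      - z 3 * ((2 * a * (z 1 ^ 2 + a ^ 2 + kerrDelta a m (z 1) * U)
        - kerrDelta a m (z 1) * (a * (1 + U))) / R))
    (h3 : L 3 = z 3 * (kerrDelta a m (z 1) / R * (2 * (1 - (z 2 ^ 2 + z 3 ^ 2)) * V))
      + z 2 * ((2 * a * (z 1 ^ 2 + a ^ 2 + kerrDelta a m (z 1) * U)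
        - kerrDelta a m (z 1) * (a * (1 + U))) / R)) (w : Coord) :
    (kerrAxis a m).inner z L w = -((z 1 ^ 2 + a ^ 2 * (1 - (z 2 ^ 2 + z 3 ^ 2))) / R) *
      (kerrDelta a m (z 1) * (w 0 + U * w 1 + 2 * V * (z 2 * w 2 + z 3 * w 3)) - 2 *
        ((z 1 ^ 2 + a ^ 2 + kerrDelta a m (z 1) * U) * w 1
          + kerrDelta a m (z 1) * (2 * V * (z 2 * w 2 + z 3 * w 3)))) := by
  rw [kerrAxis_inner hQ, h0, h1, h2, h3, kerrDelta]
  field_simp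
  ring

/-- A function of the form `r² + b + x² H₁ + y² H₂` has derivative `2 r dr` on the axis. -/
theorem fderiv_axis_quadratic {p : Coord} (h2 : p 2 = 0) (h3 : p 3 = 0) (b : ℝ) {H₁ H₂ : Coord → ℝ}
    (hH₁ : DifferentiableAt ℝ H₁ p) (hH₂ : DifferentiableAt ℝ H₂ p) (w : Coord) :
    fderiv ℝ (fun z : Coord => z 1 ^ 2 + b + z 2 ^ 2 * H₁ z + z 3 ^ 2 * H₂ z) p w =
      2 * p 1 * w 1 := by
  have a1 := hasFDerivAt_apply (𝕜 := ℝ) (1 : Fin 4) p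
  have a2 := hasFDerivAt_apply (𝕜 := ℝ) (2 : Fin 4) p
  have a3 := hasFDerivAt_apply (𝕜 := ℝ) (3 : Fin 4) p
  have := ((((a1.pow 2).add_const b).fun_add ((a2.pow 2).fun_mul hH₁.hasFDerivAt))).fun_add
    ((a3.pow 2).fun_mul hH₂.hasFDerivAt)
  rw [this.fderiv]
  simp [h2, h3]

/-- On the axis, the expansion terms of a field invariant under rotations. -/
theorem kerrAxis_expTerm {a m : ℝ} {p : Coord} (hr : 0 < p 1) (h2 : p 2 = 0) (h3 : p 3 = 0)
    {L : Coord → Coord} (hL : DifferentiableAt ℝ L p) {h k : Coord → ℝ}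
    (hh : DifferentiableAt ℝ h p) (hk : DifferentiableAt ℝ k p)
    (e2 : ∀ z, L z 2 = z 2 * h z - z 3 * k z) (e3 : ∀ z, L z 3 = z 3 * h z + z 2 * k z) :
    expTerm (kerrAxis a m) L p ![0, 0, 1, 0] = (p 1 ^ 2 + a ^ 2) * h p + p 1 * L p 1 ∧
    expTerm (kerrAxis a m) L p ![0, 0, 0, 1] = (p 1 ^ 2 + a ^ 2) * h p + p 1 * L p 1 := by
  have cQ : DifferentiableAt ℝ (fun z : Coord => z 1 ^ 2 + a ^ 2 * (1 - (z 2 ^ 2 + z 3 ^ 2))) p := by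
    fun_prop
  have hQ : p 1 ^ 2 + a ^ 2 * (1 - (p 2 ^ 2 + p 3 ^ 2)) ≠ 0 := by
    rw [h2, h3]; simp; positivity
  have hd : 1 - (p 2 ^ 2 + p 3 ^ 2) ≠ 0 := by simp [h2, h3]
  have c0 : DifferentiableAt ℝ (fun z : Coord =>
      (z 1 ^ 2 + a ^ 2 * (1 - (z 2 ^ 2 + z 3 ^ 2))) / (1 - (z 2 ^ 2 + z 3 ^ 2))) p :=
    by fun_prop (disch := exact hd)
  have ck := c0.const_add (-a ^ 2)
  have cB : DifferentiableAt ℝ (fun z : Coord =>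
      2 * m * z 1 * a ^ 2 / (z 1 ^ 2 + a ^ 2 * (1 - (z 2 ^ 2 + z 3 ^ 2)))) p :=
    by fun_prop (disch := exact hQ)
  have hQe : ∀ᶠ z : Coord in 𝓝 p, z 1 ^ 2 + a ^ 2 * (1 - (z 2 ^ 2 + z 3 ^ 2)) ≠ 0 :=
    cQ.continuousAt.eventually_ne hQ
  have d2 : ∀ w, (kerrAxis a m).dInner p w ![0, 0, 1, 0] ![0, 0, 1, 0] = 2 * p 1 * w 1 := by
    intro w
    rw [ChartMetric.dInner, ← fderiv_axis_quadratic h2 h3 (a ^ 2) ck cB]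
    refine congrArg (fun D : Coord →L[ℝ] ℝ => D w) (Filter.EventuallyEq.fderiv_eq ?_)
    filter_upwards [hQe] with z hz
    rw [kerrAxis_inner hz]
    simp
    ring
  have d3 : ∀ w, (kerrAxis a m).dInner p w ![0, 0, 0, 1] ![0, 0, 0, 1] = 2 * p 1 * w 1 := by
    intro w
    rw [ChartMetric.dInner, ← fderiv_axis_quadratic h2 h3 (a ^ 2) cB ck]
    refine congrArg (fun D : Coord →L[ℝ] ℝ => D w) (Filter.EventuallyEq.fderiv_eq ?_)
    filter_upwards [hQe] with z hz
    rw [kerrAxis_inner hz]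
    simp
    ring
  have a2 := hasFDerivAt_apply (𝕜 := ℝ) (2 : Fin 4) p
  have a3 := hasFDerivAt_apply (𝕜 := ℝ) (3 : Fin 4) p
  have f2 := (a2.fun_mul hh.hasFDerivAt).fun_sub (a3.fun_mul hk.hasFDerivAt)
  have f3 := (a3.fun_mul hh.hasFDerivAt).fun_add (a2.fun_mul hk.hasFDerivAt)
  constructor
  · rw [expTerm, d2, kerrAxis_inner hQ]
    simp only [Matrix.cons_val_zero, Matrix.cons_val_one, Matrix.cons_val, h2, h3]
    rw [fderiv_coord hL 2, funext e2, f2.fderiv]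
    simp [h2, h3]
    ring
  · rw [expTerm, d3, kerrAxis_inner hQ]
    simp only [Matrix.cons_val_zero, Matrix.cons_val_one, Matrix.cons_val, h2, h3]
    rw [fderiv_coord hL 3, funext e3, f3.fderiv]
    simp [h2, h3]
    ring

/-- On the axis the same null fields are used, written in the regular coordinates. The tangent
fields `X₁`, `X₂` reduce to multiples of `∂_x`, `∂_y` there. The hypothesis on `Θ` covers both
hemispheres. -/
theorem LocalOptical.hasNullExpansions_axis {a m r B ur uς vς : ℝ} {f u v : ℝ × ℝ → ℝ}
    (ham : |a| < m) (hr : rMinus a m < r) (h : LocalOptical a m r 0 B f u v ur uς vς)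
    (hf : ∀ᶠ q : ℝ × ℝ in 𝓝 (r, (0 : ℝ)), ∀ θ ∈ Icc 0 Real.pi, Real.sin θ ^ 2 = q.2 →
        fStar a m q.1 θ = f q) (c u₀ : ℝ) {Θ : Coord → ℝ}
    (hΘ : ∀ᶠ z : Coord in 𝓝 ![u₀, r, 0, 0], Θ z ∈ Icc 0 Real.pi ∧
      Real.sin (Θ z) ^ 2 = z 2 ^ 2 + z 3 ^ 2) :
    HasNullExpansions (kerrAxis a m) (fun z => ubZero a m (z 0) (z 1) (Θ z))
        (fun z => rTilde a m c (z 1) (Θ z)) ![u₀, r, 0, 0]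
      (kerrDelta a m r * B / radPoly a m r 0) (-(B / (r ^ 2 + a ^ 2))) := by
  set p : Coord := ![u₀, r, 0, 0] with hp
  have p1 : p 1 = r := rfl
  have p2 : p 2 = 0 := rfl
  have p3 : p 3 = 0 := rfl
  have hr0 : 0 < r := (rMinus_nonneg ham).trans_lt hr
  have hN : 0 < r ^ 2 + a ^ 2 := by positivity
  have hRN : radPoly a m r 0 = (r ^ 2 + a ^ 2) ^ 2 := by simp [radPoly]
  have hRp : 0 < radPoly a m r 0 := by rw [hRN]; positivity
  have cσ : ContDiffAt ℝ 1 (fun z : Coord => z 2 ^ 2 + z 3 ^ 2) p := by fun_prop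
  have hσ0 : p 2 ^ 2 + p 3 ^ 2 = 0 := by rw [p2, p3]; norm_num
  have hcont : Tendsto (fun z : Coord => (z 1, z 2 ^ 2 + z 3 ^ 2)) (𝓝 p) (𝓝 (r, 0)) := by
    have := (continuous_apply (1 : Fin 4)).continuousAt.prodMk cσ.continuousAt
    rw [ContinuousAt, hσ0] at this
    exact this
  have hd := h.eventually_fderiv ham hr hf c (p := p) (σ := fun z : Coord => z 2 ^ 2 + z 3 ^ 2) p1
    cσ hσ0 hΘ
  set U : Coord → ℝ := fun z => u (z 1, z 2 ^ 2 + z 3 ^ 2) with hU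
  set V : Coord → ℝ := fun z => v (z 1, z 2 ^ 2 + z 3 ^ 2) with hV
  have hpt : (p 1, p 2 ^ 2 + p 3 ^ 2) = (r, (0 : ℝ)) := by rw [hσ0, p1]
  have cU : ContDiffAt ℝ 1 U p :=
    ContDiffAt.comp (g := u) p (by rw [hpt]; exact h.u_contDiff) (by fun_prop)
  have cV : ContDiffAt ℝ 1 V p :=
    ContDiffAt.comp (g := v) p (by rw [hpt]; exact h.v_contDiff) (by fun_prop)
  set D : Coord → ℝ := fun y => kerrDelta a m (y 1) with hD
  have cD : ContDiffAt ℝ 1 D p := by simp only [hD]; unfold kerrDelta; fun_prop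
  set Sg : Coord → ℝ := fun y => y 1 ^ 2 + a ^ 2 + D y * U y with hSg
  have cSg : ContDiffAt ℝ 1 Sg p := by fun_prop
  set q₃ : Coord → ℝ := fun z => -(z 1 ^ 2 + a ^ 2 * (1 - (z 2 ^ 2 + z 3 ^ 2)))⁻¹ with hq₃
  have cQ : ContDiffAt ℝ 1 (fun z : Coord => z 1 ^ 2 + a ^ 2 * (1 - (z 2 ^ 2 + z 3 ^ 2))) p := by
    fun_prop
  have hQ0 : p 1 ^ 2 + a ^ 2 * (1 - (p 2 ^ 2 + p 3 ^ 2)) = r ^ 2 + a ^ 2 := by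
    rw [hσ0, p1]; ring
  have cq₃ : ContDiffAt ℝ 1 q₃ p := (cQ.inv (by rw [hQ0]; exact hN.ne')).neg
  set R : Coord → ℝ := fun z => radPoly a m (z 1) (z 2 ^ 2 + z 3 ^ 2) with hR
  have hRp0 : R p = radPoly a m r 0 := by simp only [hR]; rw [hσ0, p1]
  have cR : ContDiffAt ℝ 1 R p := by simp only [hR]; unfold radPoly kerrDelta; fun_prop
  have hRp' : R p ≠ 0 := by rw [hRp0]; exact hRp.ne'
  set q₄ : Coord → ℝ := fun y => D y / R y with hq₄
  have cq₄ : ContDiffAt ℝ 1 q₄ p := cD.div cR hRp'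
  set h₃ : Coord → ℝ := fun z => q₃ z * (2 * (1 - (z 2 ^ 2 + z 3 ^ 2)) * V z) with hh₃
  set k₃ : Coord → ℝ := fun z => q₃ z * (a * (1 + U z)) with hk₃
  set h₄ : Coord → ℝ := fun z => q₄ z * (2 * (1 - (z 2 ^ 2 + z 3 ^ 2)) * V z) with hh₄
  set k₄ : Coord → ℝ := fun z => (2 * a * Sg z - D z * (a * (1 + U z))) / R z with hk₄
  have ch₃ : ContDiffAt ℝ 1 h₃ p := by fun_prop
  have ck₃ : ContDiffAt ℝ 1 k₃ p := by fun_prop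
  have ch₄ : ContDiffAt ℝ 1 h₄ p := by fun_prop
  have ck₄ : ContDiffAt ℝ 1 k₄ p := ContDiffAt.div (by fun_prop) cR hRp'
  set L₃ : Coord → Coord := fun z =>
    ![q₃ z * ((z 1 ^ 2 + a ^ 2) * U z + a ^ 2 * (z 2 ^ 2 + z 3 ^ 2)), q₃ z * Sg z,
      z 2 * h₃ z - z 3 * k₃ z, z 3 * h₃ z + z 2 * k₃ z] with hL₃
  set L₄ : Coord → Coord := fun z =>
    ![(2 * (z 1 ^ 2 + a ^ 2) * Sg z
      - D z * ((z 1 ^ 2 + a ^ 2) * U z + a ^ 2 * (z 2 ^ 2 + z 3 ^ 2))) / R z, q₄ z * Sg z,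
      z 2 * h₄ z - z 3 * k₄ z, z 3 * h₄ z + z 2 * k₄ z] with hL₄
  set X₁ : Coord → Coord := fun z => ![-(2 * z 2 * V z * (z 1 ^ 2 + a ^ 2)), -(2 * z 2 * V z * D z),
    Sg z, 0] with hX₁
  set X₂ : Coord → Coord := fun z => ![-(2 * z 3 * V z * (z 1 ^ 2 + a ^ 2)), -(2 * z 3 * V z * D z),
    0, Sg z] with hX₂
  have cL₃ : ContDiffAt ℝ 1 L₃ p := by
    refine contDiffAt_pi.2 fun i => ?_
    fin_cases i <;> simp only [hL₃, Fin.zero_eta, Fin.mk_one, Fin.reduceFinMk,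
      Matrix.cons_val_zero, Matrix.cons_val_one, Matrix.cons_val] <;> fun_prop
  have cL₄ : ContDiffAt ℝ 1 L₄ p := by
    refine contDiffAt_pi.2 fun i => ?_
    fin_cases i <;> simp only [hL₄, Fin.zero_eta, Fin.mk_one, Fin.reduceFinMk,
      Matrix.cons_val_zero, Matrix.cons_val_one, Matrix.cons_val]
    · exact ContDiffAt.div (by fun_prop) cR hRp'
    all_goals fun_prop
  have cX₁ : ContDiffAt ℝ 1 X₁ p := by
    refine contDiffAt_pi.2 fun i => ?_
    fin_cases i <;> simp only [hX₁, Fin.zero_eta, Fin.mk_one, Fin.reduceFinMk,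
      Matrix.cons_val_zero, Matrix.cons_val_one, Matrix.cons_val] <;> fun_prop
  have cX₂ : ContDiffAt ℝ 1 X₂ p := by
    refine contDiffAt_pi.2 fun i => ?_
    fin_cases i <;> simp only [hX₂, Fin.zero_eta, Fin.mk_one, Fin.reduceFinMk,
      Matrix.cons_val_zero, Matrix.cons_val_one, Matrix.cons_val] <;> fun_prop
  have dσ : ∀ z w : Coord, fderiv ℝ (fun z : Coord => z 2 ^ 2 + z 3 ^ 2) z w =
      2 * (z 2 * w 2 + z 3 * w 3) := by
    intro z w
    rw [(((hasFDerivAt_apply (𝕜 := ℝ) (2 : Fin 4) z).pow 2).fun_add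
      ((hasFDerivAt_apply (𝕜 := ℝ) (3 : Fin 4) z).pow 2)).fderiv]
    simp; ring
  have hpos : ∀ᶠ z in 𝓝 p, z 1 ^ 2 + a ^ 2 * (1 - (z 2 ^ 2 + z 3 ^ 2)) ≠ 0 ∧
      1 - (z 2 ^ 2 + z 3 ^ 2) ≠ 0 ∧ R z ≠ 0 := by
    filter_upwards [cQ.continuousAt.eventually_ne (by rw [hQ0]; exact hN.ne'),
      (cσ.continuousAt.const_sub 1).eventually_ne
        (show 1 - (p 2 ^ 2 + p 3 ^ 2) ≠ 0 by rw [hσ0]; norm_num),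
      cR.continuousAt.eventually_ne hRp'] with z h1 h2 h3 using ⟨h1, h2, h3⟩
  have hdU : ∀ᶠ z in 𝓝 p, ∀ w, fderiv ℝ (fun z : Coord => ubZero a m (z 0) (z 1) (Θ z)) z w =
      w 0 + U z * w 1 + 2 * V z * (z 2 * w 2 + z 3 * w 3) := by
    filter_upwards [hd] with z hz w
    rw [hz.2.1, dσ]
    simp only [hU, hV]; ring
  have hdR : ∀ᶠ z in 𝓝 p, ∃ C ≠ 0, ∀ w, fderiv ℝ (fun z : Coord => rTilde a m c (z 1) (Θ z)) z w =
      C * (Sg z * w 1 + D z * (2 * V z * (z 2 * w 2 + z 3 * w 3))) := by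
    filter_upwards [hd] with z ⟨_, _, C, hC, hz⟩
    refine ⟨C, hC, fun w => ?_⟩
    rw [hz, dσ]
    simp only [hSg, hU, hV, hD]; ring
  have hg₃ : ∀ᶠ z in 𝓝 p, ∀ w, (kerrAxis a m).inner z (L₃ z) w =
      -(w 0 + U z * w 1 + 2 * V z * (z 2 * w 2 + z 3 * w 3)) := by
    filter_upwards [hpos] with z ⟨z1, z2, z3⟩ w
    exact kerrAxis_incoming z1 z2 (q := q₃ z) rfl rfl rfl rfl rfl w
  have hg₄ : ∀ᶠ z in 𝓝 p, ∀ w, (kerrAxis a m).inner z (L₄ z) w =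
      -((z 1 ^ 2 + a ^ 2 * (1 - (z 2 ^ 2 + z 3 ^ 2))) / R z) *
        (D z * (w 0 + U z * w 1 + 2 * V z * (z 2 * w 2 + z 3 * w 3))
          - 2 * (Sg z * w 1 + D z * (2 * V z * (z 2 * w 2 + z 3 * w 3)))) := by
    filter_upwards [hpos] with z ⟨z1, z2, z3⟩ w
    exact kerrAxis_outgoing z1 z2 z3 rfl rfl rfl rfl w
  have heik : ∀ᶠ z in 𝓝 p, D z * U z ^ 2 + 2 * (z 1 ^ 2 + a ^ 2) * U z + a ^ 2 * (z 2 ^ 2 + z 3 ^ 2)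
      + 4 * (z 2 ^ 2 + z 3 ^ 2) * (1 - (z 2 ^ 2 + z 3 ^ 2)) * V z ^ 2 = 0 :=
    hcont.eventually h.eikonal
  have hnull : ∀ᶠ z in 𝓝 p, (kerrAxis a m).inner z (L₃ z) (L₃ z) = 0 ∧
      (kerrAxis a m).inner z (L₄ z) (L₄ z) = 0 ∧ (kerrAxis a m).inner z (L₃ z) (L₄ z) = -2 := by
    filter_upwards [hg₃, hg₄, heik, hpos] with z k3 k4 k5 k7
    have hR0 : R z ≠ 0 := k7.2.2
    have k6 : Sg z ^ 2 + D z * (4 * (z 2 ^ 2 + z 3 ^ 2) * (1 - (z 2 ^ 2 + z 3 ^ 2)) * V z ^ 2)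
        = R z := by
      simp only [hSg, hR, radPoly]
      change _ = _ - a ^ 2 * _ * D z
      linear_combination D z * k5
    have e4 : L₄ z 0 + U z * L₄ z 1 + 2 * V z * (z 2 * L₄ z 2 + z 3 * L₄ z 3) = 2 := by
      simp only [hL₄, hh₄, hq₄, Matrix.cons_val_zero, Matrix.cons_val_one, Matrix.cons_val]
      field_simp
      simp only [hSg] at k6 ⊢
      linear_combination (-(D z)) * k5 + 2 * k6
    have e4' : Sg z * L₄ z 1 + D z * (2 * V z * (z 2 * L₄ z 2 + z 3 * L₄ z 3)) = D z := by
      simp only [hL₄, hh₄, hq₄, Matrix.cons_val_zero, Matrix.cons_val_one, Matrix.cons_val]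
      field_simp
      linear_combination D z * k6
    refine ⟨?_, ?_, ?_⟩
    · rw [k3]
      simp only [hL₃, hh₃, Matrix.cons_val_zero, Matrix.cons_val_one, Matrix.cons_val, hSg]
      linear_combination (-(q₃ z)) * k5
    · rw [k4, e4, e4']; ring
    · rw [k3, e4]
  -- the optical function is stationary in the radial direction along the axis
  have hu0 : u (r, 0) = 0 := by
    have h1 := h.eikonal.self_of_nhds
    have h2 : kerrDelta a m r * u (r, 0) + 2 * (r ^ 2 + a ^ 2) ≠ 0 := by linarith [h.pos]
    have h3 : u (r, 0) * (kerrDelta a m r * u (r, 0) + 2 * (r ^ 2 + a ^ 2)) = 0 := by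
      simp only at h1; linear_combination h1
    exact (mul_eq_zero.1 h3).resolve_right h2
  have hur : ur = 0 := by
    have d1 : HasDerivAt (fun t : ℝ => u (t, 0)) ur r :=
      (h.u_deriv.comp_hasDerivAt r ((hasDerivAt_id r).prodMk (hasDerivAt_const r (0 : ℝ)))).congr_deriv
        (by simp)
    have d2 : HasDerivAt (fun t : ℝ => kerrDelta a m t) (2 * r - 2 * m) r := by
      unfold kerrDelta
      refine (((hasDerivAt_pow 2 r).sub ((hasDerivAt_id r).const_mul (2 * m))).add_const
        (a ^ 2)).congr_deriv ?_
      push_cast; ring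
    have d3 := (d2.fun_mul (d1.fun_pow 2)).fun_add
      (((((hasDerivAt_id r).fun_pow 2).add_const (a ^ 2)).const_mul 2).fun_mul d1)
    have hc : Tendsto (fun t : ℝ => (t, (0 : ℝ))) (𝓝 r) (𝓝 (r, 0)) :=
      (continuousAt_id.prodMk continuousAt_const)
    have d4 := d3.unique ((hasDerivAt_const r (0 : ℝ)).congr_of_eventuallyEq (by
      filter_upwards [hc.eventually h.eikonal] with t ht
      simp only [id] at ht ⊢
      linear_combination ht))
    simp [hu0] at d4
    rcases d4 with d4 | d4
    · linarith
    · exact d4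
  have hB : B = 2 * r + 4 * v (r, 0) := by
    rw [← h.eq_B, hu0, hur]; ring
  have hVp : V p = v (r, 0) := by simp only [hV]; rw [hpt]
  have hSp : Sg p = r ^ 2 + a ^ 2 := by
    have : U p = 0 := by simp only [hU]; rw [hpt, hu0]
    simp only [hSg, this, p1, mul_zero, add_zero]
  have hX₁p : X₁ p = (r ^ 2 + a ^ 2) • ![0, 0, 1, 0] := by
    simp only [hX₁, hSp, p2]; ext i; fin_cases i <;> simp
  have hX₂p : X₂ p = (r ^ 2 + a ^ 2) • ![0, 0, 0, 1] := by
    simp only [hX₂, hSp, p3]; ext i; fin_cases i <;> simp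
  have i₁₁ : (kerrAxis a m).inner p ![0, 0, 1, 0] ![0, 0, 1, 0] = r ^ 2 + a ^ 2 := by
    rw [kerrAxis_inner (by rw [hQ0]; exact hN.ne'), hQ0]; simp [p2, p3]
  have i₂₂ : (kerrAxis a m).inner p ![0, 0, 0, 1] ![0, 0, 0, 1] = r ^ 2 + a ^ 2 := by
    rw [kerrAxis_inner (by rw [hQ0]; exact hN.ne'), hQ0]; simp [p2, p3]
  have i₁₂ : (kerrAxis a m).inner p ![0, 0, 1, 0] ![0, 0, 0, 1] = 0 := by
    rw [kerrAxis_inner (by rw [hQ0]; exact hN.ne'), hQ0]; simp [p2, p3]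
  have hgc := fun i j => kerrAxis_contDiffAt (a := a) (m := m) (p := p) hr0 p2 p3 i j
  obtain ⟨t3, t3'⟩ := kerrAxis_expTerm (a := a) (m := m) (p := p) hr0 p2 p3
    (cL₃.differentiableAt one_ne_zero) (ch₃.differentiableAt one_ne_zero)
    (ck₃.differentiableAt one_ne_zero) (fun z => rfl) (fun z => rfl)
  obtain ⟨t4, t4'⟩ := kerrAxis_expTerm (a := a) (m := m) (p := p) hr0 p2 p3
    (cL₄.differentiableAt one_ne_zero) (ch₄.differentiableAt one_ne_zero)
    (ck₄.differentiableAt one_ne_zero) (fun z => rfl) (fun z => rfl)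
  have final := hasNullExpansions_of_fields hgc (kerrAxis_isSymm a m) cL₃ cL₄ cX₁ cX₂
    (hd.mono fun x hx => hx.1)
    (by filter_upwards [hdU, hg₃] with x h1 h2 w; rw [h1, h2])
    (by
      filter_upwards [hdU, hdR, hg₄] with x h1 ⟨C, hC, h2⟩ h3 w h4 h5
      rw [h1] at h4
      rw [h2] at h5
      rw [h3, h4, (mul_eq_zero.1 h5).resolve_left hC]
      ring)
    hnull
    (by
      filter_upwards [hdU, hdR] with x h1 ⟨C, hC, h2⟩
      rw [h1, h1, h2, h2]
      simp only [hX₁, hX₂, hSg, Matrix.cons_val_zero, Matrix.cons_val_one, Matrix.cons_val]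
      refine ⟨by ring, by ring, by ring, by ring⟩)
    (by rw [hX₁p, inner_smul_left, inner_smul_right, i₁₁]; positivity)
    (by rw [hX₂p, inner_smul_left, inner_smul_right, i₂₂]; positivity)
    (by rw [hX₁p, hX₂p, inner_smul_left, inner_smul_right, i₁₂]; ring)
  have l3 : L₃ p 1 = -1 := by
    change q₃ p * Sg p = -1
    simp only [hq₃]
    rw [hQ0, hSp]; field_simp
  have l4 : L₄ p 1 = kerrDelta a m r / (r ^ 2 + a ^ 2) := by
    change D p / R p * Sg p = _
    rw [hRp0, hRN, hSp]
    change kerrDelta a m r / _ * _ = _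
    field_simp
  have m3 : h₃ p = -(2 * v (r, 0)) / (r ^ 2 + a ^ 2) := by
    simp only [hh₃, hq₃]
    rw [hQ0, hσ0, hVp]; field_simp; ring
  have m4 : h₄ p = kerrDelta a m r * (2 * v (r, 0)) / (r ^ 2 + a ^ 2) ^ 2 := by
    change D p / R p * _ = _
    rw [hσ0, hVp, hRp0, hRN]
    change kerrDelta a m r / _ * _ = _
    ring
  rw [hX₁p, hX₂p, expTerm_smul hgc, expTerm_smul hgc, expTerm_smul hgc, expTerm_smul hgc,
    inner_smul_left, inner_smul_right, inner_smul_left, inner_smul_right, i₁₁, i₂₂, t3, t3', t4, t4',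
    l3, l4, m3, m4, p1] at final
  convert final using 1
  · rw [hB, hRN]; field_simp; ring
  · rw [hB]; field_simp; ring

/-! ### Uniform bounds -/

theorem continuousAt_ellHς {q : ℝ × ℝ} (hq : q ∈ ellDom) :
    ContinuousAt (fun q : ℝ × ℝ => ellHς q.1 q.2) q := by
  have h := ((contDiffAt_ellH hq).fderiv_right (m := 0) (by norm_num)).continuousAt.clm_apply
    (continuousAt_const (y := ((1, 0) : ℝ × ℝ)))
  refine h.congr ?_
  filter_upwards [isOpen_ellDom.mem_nhds hq] with x hx
  rw [(hasFDerivAt_ellH (ς := x.1) (W := x.2) hx).fderiv]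
  simp

theorem continuousAt_ellHW {q : ℝ × ℝ} (hq : q ∈ ellDom) :
    ContinuousAt (fun q : ℝ × ℝ => ellHW q.1 q.2) q := by
  have h := ((contDiffAt_ellH hq).fderiv_right (m := 0) (by norm_num)).continuousAt.clm_apply
    (continuousAt_const (y := ((0, 1) : ℝ × ℝ)))
  refine h.congr ?_
  filter_upwards [isOpen_ellDom.mem_nhds hq] with x hx
  rw [(hasFDerivAt_ellH (ς := x.1) (W := x.2) hx).fderiv]
  simp

theorem continuousAt_radHκ {a m : ℝ} {q : ℝ × ℝ} (hq : q ∈ radDom a m) :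
    ContinuousAt (fun q : ℝ × ℝ => radHκ a m q.1 q.2) q := by
  have h := ((contDiffAt_radH (r := q.1) (κ := q.2) hq).1.fderiv_right (m := 0)
    (by norm_num)).continuousAt.clm_apply (continuousAt_const (y := ((0, 1) : ℝ × ℝ)))
  refine h.congr ?_
  filter_upwards [(isOpen_radDom a m).mem_nhds hq] with x hx
  rw [(contDiffAt_radH (r := x.1) (κ := x.2) hx).2.fderiv]
  simp

/-- `expB` depends continuously on `(r, ς)` along a continuous family of solutions. -/
theorem continuousAt_expB {a m : ℝ} {q : ℝ × ℝ} {g : ℝ × ℝ → ℝ} (hg : ContinuousAt g q)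
    (h1 : (q.2, g q) ∈ ellDom) (h2 : (q.1, kap q.2 (g q)) ∈ radDom a m)
    (h3 : solW a m q.1 q.2 (g q) ≠ 0) :
    ContinuousAt (fun q : ℝ × ℝ => expB a m q.1 q.2 (g q)) q := by
  have hR := radDom_radPoly_pos h2
  have ck : ContinuousAt (fun q : ℝ × ℝ => (q.1, kap q.2 (g q))) q := by
    unfold kap; fun_prop
  have cg : ContinuousAt (fun q : ℝ × ℝ => (q.2, g q)) q := by fun_prop
  have e1 : ContinuousAt (fun q : ℝ × ℝ => ellHς q.2 (g q)) q :=
    ContinuousAt.comp (f := fun q : ℝ × ℝ => (q.2, g q))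
      (g := fun q : ℝ × ℝ => ellHς q.1 q.2) (continuousAt_ellHς h1) cg
  have e2 : ContinuousAt (fun q : ℝ × ℝ => ellHW q.2 (g q)) q :=
    ContinuousAt.comp (f := fun q : ℝ × ℝ => (q.2, g q))
      (g := fun q : ℝ × ℝ => ellHW q.1 q.2) (continuousAt_ellHW h1) cg
  have e3 : ContinuousAt (fun q : ℝ × ℝ => radHκ a m q.1 (kap q.2 (g q))) q :=
    ContinuousAt.comp (f := fun q : ℝ × ℝ => (q.1, kap q.2 (g q)))
      (g := fun q : ℝ × ℝ => radHκ a m q.1 q.2) (continuousAt_radHκ h2) ck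
  have e4 : ContinuousAt (fun q : ℝ × ℝ => radPoly a m q.1 (kap q.2 (g q))) q :=
    ContinuousAt.comp (f := fun q : ℝ × ℝ => (q.1, kap q.2 (g q)))
      (g := fun q : ℝ × ℝ => radPoly a m q.1 q.2)
      (contDiff_radPoly a m).continuous.continuousAt ck
  have e5 : ContinuousAt (fun q : ℝ × ℝ => radS a m q.1 (kap q.2 (g q))) q :=
    ContinuousAt.comp (f := fun q : ℝ × ℝ => (q.1, kap q.2 (g q)))
      (g := fun q : ℝ × ℝ => radS a m q.1 q.2)
      (contDiffAt_radS (q := (q.1, kap q.2 (g q))) hR).continuousAt ck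
  have e6 : ContinuousAt (fun q : ℝ × ℝ => kap q.2 (g q)) q := by unfold kap; fun_prop
  have e7 : ContinuousAt (fun q : ℝ × ℝ => kerrDelta a m q.1) q := by unfold kerrDelta; fun_prop
  have e8 : ContinuousAt (fun q : ℝ × ℝ => solW a m q.1 q.2 (g q)) q := by unfold solW; fun_prop
  have e9 : ContinuousAt (fun q : ℝ × ℝ => radSr a m q.1 (kap q.2 (g q))) q := by
    unfold radSr
    exact ContinuousAt.div (by fun_prop) e5 (radS_pos hR).ne'
  unfold expB
  refine ContinuousAt.add (ContinuousAt.sub (ContinuousAt.sub e9 (ContinuousAt.div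
    (ContinuousAt.mul (ContinuousAt.div (by fun_prop) e4 hR.ne') (by fun_prop)) e8 h3))
    (by fun_prop)) (ContinuousAt.div (by fun_prop) e8 h3)

/-- The solution `W` of the equation for `θ_*` at `(r, ς)`. -/
def optW (a m r ς : ℝ) : ℝ :=
  open Classical in if h : ∃ W, IsSol a m r ς W then h.choose else 0

theorem isSol_optW {a m r ς : ℝ} (ham : |a| < m) (hς : ς ∈ Icc (0 : ℝ) 1) (hr : m ≤ r) :
    IsSol a m r ς (optW a m r ς) := by
  have h := exists_isSol ham hς hr
  rw [optW, dif_pos h]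
  exact h.choose_spec

theorem continuousWithinAt_expB_optW {a m : ℝ} (ham : |a| < m) {q : ℝ × ℝ}
    (hq : q ∈ Ici m ×ˢ Icc (0 : ℝ) 1) :
    ContinuousWithinAt (fun q : ℝ × ℝ => expB a m q.1 q.2 (optW a m q.1 q.2))
      (Ici m ×ˢ Icc 0 1) q := by
  have hr : ∀ {r}, m ≤ r → rMinus a m < r := fun h => (rMinus_lt ham).trans_le h
  have hs := isSol_optW ham hq.2 hq.1
  obtain ⟨g, g1, g2, g3⟩ := hs.exists_contDiffAt ham hq.2 (hr hq.1)
  have c : ContinuousAt (fun q : ℝ × ℝ => expB a m q.1 q.2 (g q)) q := by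
    obtain ⟨k1, k2, -⟩ := g3.self_of_nhds
    refine continuousAt_expB g1.continuousAt k1 k2 ?_
    change solW a m q.1 q.2 (g (q.1, q.2)) ≠ 0
    rw [g2]
    exact (hs.solW_pos ham hq.2 (hr hq.1)).ne'
  have e : ∀ x ∈ Ici m ×ˢ Icc (0 : ℝ) 1, (x.2, g x) ∈ ellDom →
      ellH (x.2, g x) = radH a m (x.1, kap x.2 (g x)) →
      expB a m x.1 x.2 (optW a m x.1 x.2) = expB a m x.1 x.2 (g x) := by
    intro x hx k1 k3
    rw [(isSol_optW ham hx.2 hx.1).unique ham hx.2 (hr hx.1) ⟨k1.1, k3⟩]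
  refine c.continuousWithinAt.congr_of_eventuallyEq ?_ ?_
  · filter_upwards [self_mem_nhdsWithin, nhdsWithin_le_nhds g3] with x hx hx'
    exact e x hx hx'.1 hx'.2.2
  · obtain ⟨k1, -, k3⟩ := g3.self_of_nhds
    exact e q hq k1 k3

theorem continuousWithinAt_fStar {a m : ℝ} (ham : |a| < m) {q : ℝ × ℝ}
    (hq : q ∈ Ici m ×ˢ Icc 0 Real.pi) :
    ContinuousWithinAt (fun q : ℝ × ℝ => fStar a m q.1 q.2) (Ici m ×ˢ Icc 0 Real.pi) q := by
  have hς : Real.sin q.2 ^ 2 ∈ Icc (0 : ℝ) 1 := ⟨sq_nonneg _, Real.sin_sq_le_one _⟩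
  obtain ⟨f, u, v, ur, uς, vς, h, hf⟩ :=
    (isSol_optW ham hς hq.1).exists_localOptical ham hς ((rMinus_lt ham).trans_le hq.1)
  have hc : ContinuousAt (fun q : ℝ × ℝ => (q.1, Real.sin q.2 ^ 2)) q := by fun_prop
  have c : ContinuousAt (fun q : ℝ × ℝ => f (q.1, Real.sin q.2 ^ 2)) q :=
    ContinuousAt.comp (g := f) h.hasFDerivAt.self_of_nhds.continuousAt hc
  refine c.continuousWithinAt.congr_of_eventuallyEq ?_ ?_
  · filter_upwards [self_mem_nhdsWithin, nhdsWithin_le_nhds (hc.eventually hf)] with x hx hx'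
    exact hx' _ hx.2 rfl
  · exact hf.self_of_nhds _ hq.2 rfl

/-- The factor of proportionality between the outgoing expansion and `r̃ - r₊`. -/
def expansionFactor (a m c r θ : ℝ) : ℝ :=
  (r - rMinus a m) * expB a m r (Real.sin θ ^ 2) (optW a m r (Real.sin θ ^ 2)) /
    (horizonFactor a m c r (fStar a m r θ) * radPoly a m r (Real.sin θ ^ 2))

theorem continuousOn_expB {a m r₀ : ℝ} (ham : |a| < m) :
    ContinuousOn (fun q : ℝ × ℝ => expB a m q.1 (Real.sin q.2 ^ 2)
      (optW a m q.1 (Real.sin q.2 ^ 2))) (Icc m r₀ ×ˢ Icc 0 Real.pi) := by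
  intro q hq
  have hmap : MapsTo (fun q : ℝ × ℝ => (q.1, Real.sin q.2 ^ 2)) (Icc m r₀ ×ˢ Icc 0 Real.pi)
      (Ici m ×ˢ Icc (0 : ℝ) 1) := fun x hx => ⟨hx.1.1, sq_nonneg _, Real.sin_sq_le_one _⟩
  have hc : ContinuousWithinAt (fun q : ℝ × ℝ => (q.1, Real.sin q.2 ^ 2))
      (Icc m r₀ ×ˢ Icc 0 Real.pi) q := by fun_prop
  exact ContinuousWithinAt.comp (f := fun q : ℝ × ℝ => (q.1, Real.sin q.2 ^ 2))
    (g := fun q : ℝ × ℝ => expB a m q.1 q.2 (optW a m q.1 q.2))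
    (continuousWithinAt_expB_optW ham (hmap hq)) hc hmap

theorem radPoly_sin_pos {a m r : ℝ} (ham : |a| < m) (hr : m ≤ r) (θ : ℝ) :
    0 < radPoly a m r (Real.sin θ ^ 2) :=
  radDom_radPoly_pos (mem_radDom ham (((abs_nonneg a).trans_lt ham).trans_le hr)
    ⟨sq_nonneg _, Real.sin_sq_le_one _⟩)

theorem continuousOn_expansionFactor {a m r₀ : ℝ} (ham : |a| < m) (c : ℝ) :
    ContinuousOn (fun q : ℝ × ℝ => expansionFactor a m c q.1 q.2)
      (Icc m r₀ ×ˢ Icc 0 Real.pi) := by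
  have hB := continuousOn_expB (r₀ := r₀) ham
  have hf : ContinuousOn (fun q : ℝ × ℝ => fStar a m q.1 q.2) (Icc m r₀ ×ˢ Icc 0 Real.pi) :=
    fun q hq => (continuousWithinAt_fStar ham ⟨hq.1.1, hq.2⟩).mono
      (prod_mono Icc_subset_Ici_self subset_rfl)
  have hlog : ContinuousOn (fun q : ℝ × ℝ => Real.log (q.1 - rMinus a m))
      (Icc m r₀ ×ˢ Icc 0 Real.pi) :=
    ContinuousOn.log (by fun_prop) fun q hq => by
      have := (rMinus_lt ham).trans_le hq.1.1
      linarith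
  have hE : ContinuousOn (fun q : ℝ × ℝ => horizonFactor a m c q.1 (fStar a m q.1 q.2))
      (Icc m r₀ ×ˢ Icc 0 Real.pi) := by
    unfold horizonFactor; fun_prop
  have hR : Continuous (fun q : ℝ × ℝ => radPoly a m q.1 (Real.sin q.2 ^ 2)) := by
    unfold radPoly kerrDelta; fun_prop
  unfold expansionFactor
  refine ContinuousOn.div (by fun_prop) (hE.mul hR.continuousOn) fun q hq => ?_
  exact (mul_pos (horizonFactor_pos _ _ _ _ _) (radPoly_sin_pos ham hq.1.1 _)).ne'

theorem expB_optW_pos {a m r : ℝ} (ham : |a| < m) (hr : m ≤ r) (θ : ℝ) :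
    0 < expB a m r (Real.sin θ ^ 2) (optW a m r (Real.sin θ ^ 2)) :=
  have hς : Real.sin θ ^ 2 ∈ Icc (0 : ℝ) 1 := ⟨sq_nonneg _, Real.sin_sq_le_one _⟩
  (isSol_optW ham hς hr).expB_pos ham hς hr

theorem expansionFactor_pos {a m r : ℝ} (ham : |a| < m) (hr : m ≤ r) (c θ : ℝ) :
    0 < expansionFactor a m c r θ :=
  div_pos (mul_pos (sub_pos.2 ((rMinus_lt ham).trans_le hr)) (expB_optW_pos ham hr θ))
    (mul_pos (horizonFactor_pos _ _ _ _ _) (radPoly_sin_pos ham hr _))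

/-- The outgoing expansion `Δ B / Σ²` is a multiple of `r̃ - r₊` by `rTilde_eq` and `Δ = (r - r₊) (r
- r₋)`; the incoming expansion is `-B / |q|²`. -/
theorem kerrSphereExpansions_of_le {a m r θ : ℝ} (ham : |a| < m) (hr : m ≤ r)
    (c : ℝ) :
    KerrSphereExpansions a m c r θ (expansionFactor a m c r θ * (rTilde a m c r θ - rPlus a m))
      (-(expB a m r (Real.sin θ ^ 2) (optW a m r (Real.sin θ ^ 2)) / kerrQ a r θ)) := by
  have hr' := (rMinus_lt ham).trans_le hr
  have hς : Real.sin θ ^ 2 ∈ Icc (0 : ℝ) 1 := ⟨sq_nonneg _, Real.sin_sq_le_one _⟩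
  obtain ⟨f, u, v, ur, uς, vς, h, hf⟩ :=
    (isSol_optW ham hς hr).exists_localOptical ham hς hr'
  have hk : expansionFactor a m c r θ * (rTilde a m c r θ - rPlus a m) =
      kerrDelta a m r * expB a m r (Real.sin θ ^ 2) (optW a m r (Real.sin θ ^ 2)) /
        radPoly a m r (Real.sin θ ^ 2) := by
    have h1 := horizonFactor_pos a m c r (fStar a m r θ)
    have h2 := radPoly_sin_pos ham hr θ
    rw [rTilde_eq ham hr', expansionFactor, kerrDelta_eq ham]
    field_simp
    ring
  rw [hk]
  have axis : Real.sin θ = 0 → ∀ (u₀ : ℝ) (Θ : Coord → ℝ),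
      (∀ᶠ z : Coord in 𝓝 ![u₀, r, 0, 0], Θ z ∈ Icc 0 Real.pi ∧
        Real.sin (Θ z) ^ 2 = z 2 ^ 2 + z 3 ^ 2) →
      HasNullExpansions (kerrAxis a m) (fun z => ubZero a m (z 0) (z 1) (Θ z))
        (fun z => rTilde a m c (z 1) (Θ z)) ![u₀, r, 0, 0]
        (kerrDelta a m r * expB a m r (Real.sin θ ^ 2) (optW a m r (Real.sin θ ^ 2)) /
          radPoly a m r (Real.sin θ ^ 2))
        (-(expB a m r (Real.sin θ ^ 2) (optW a m r (Real.sin θ ^ 2)) / kerrQ a r θ)) := by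
    intro hsin u₀ Θ hΘ
    have h0 : Real.sin θ ^ 2 = 0 := by rw [hsin]; norm_num
    rw [kerrQ_eq, h0, sub_zero, mul_one]
    rw [h0] at h hf
    exact h.hasNullExpansions_axis ham hr' hf c u₀ hΘ
  have north : ∀ u₀ : ℝ, ∀ᶠ z : Coord in 𝓝 ![u₀, r, 0, 0], z 2 ^ 2 + z 3 ^ 2 ≤ 1 := by
    intro u₀
    have hc : ContinuousAt (fun z : Coord => z 2 ^ 2 + z 3 ^ 2) ![u₀, r, 0, 0] := by fun_prop
    exact (hc.eventually (gt_mem_nhds (by simp : _ < (1 : ℝ)))).mono fun z hz => hz.le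
  have harc : ∀ s : ℝ, 0 ≤ s → s ≤ 1 → Real.arcsin √s ∈ Icc 0 Real.pi ∧
      Real.sin (Real.arcsin √s) ^ 2 = s := by
    intro s h0 h1
    have h2 : √s ≤ 1 := Real.sqrt_le_one.2 h1
    refine ⟨⟨Real.arcsin_nonneg.2 (Real.sqrt_nonneg s), ?_⟩, ?_⟩
    · linarith [Real.arcsin_le_pi_div_two √s, Real.pi_pos]
    · rw [Real.sin_arcsin (by linarith [Real.sqrt_nonneg s]) h2, Real.sq_sqrt h0]
  refine fun u₀ => ⟨fun hθ' φ => h.hasNullExpansions_off_axis ham hr' hθ' hf c u₀ φ,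
    fun h0 => axis (by rw [h0, Real.sin_zero]) u₀ _ ?_,
    fun h0 => axis (by rw [h0, Real.sin_pi]) u₀ _ ?_⟩
  · filter_upwards [north u₀] with z hz
    exact harc _ (by positivity) hz
  · filter_upwards [north u₀] with z hz
    obtain ⟨k1, k2⟩ := harc _ (by positivity : 0 ≤ z 2 ^ 2 + z 3 ^ 2) hz
    refine ⟨⟨?_, ?_⟩, ?_⟩
    · unfold southTheta; linarith [k1.2]
    · unfold southTheta; linarith [k1.1]
    · rw [southTheta, Real.sin_pi_sub, k2]

end PretoriusIsrael

end

open PretoriusIsrael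

theorem mainTheorem9 (a m c r₀ : ℝ) (ham : |a| < m) (hr₀ : rPlus a m < r₀) :
    ∃ C c₀ : ℝ, 1 ≤ C ∧ 0 < c₀ ∧ ∃ F : ℝ → ℝ → ℝ,
      ∀ r ∈ Set.Icc m r₀, ∀ θ ∈ Set.Icc 0 Real.pi,
        C⁻¹ ≤ F r θ ∧ F r θ ≤ C ∧
        ∃ kb : ℝ, kb ≤ -c₀ ∧
          KerrSphereExpansions a m c r θ (F r θ * (rTilde a m c r θ - rPlus a m)) kb := by
  have hm : 0 < m := (abs_nonneg a).trans_lt ham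
  -- both bounds follow from continuity and positivity on the compact set `[m, r₀] × [0, π]`
  have hK : IsCompact (Icc m r₀ ×ˢ Icc 0 Real.pi) := isCompact_Icc.prod isCompact_Icc
  have hne : (Icc m r₀ ×ˢ Icc 0 Real.pi).Nonempty :=
    ⟨(m, 0), ⟨le_rfl, ((lt_rPlus ham).trans hr₀).le⟩, le_rfl, Real.pi_pos.le⟩
  have hF := continuousOn_expansionFactor (r₀ := r₀) ham c
  obtain ⟨q₁, hq₁, h₁⟩ := hK.exists_isMinOn hne hF
  obtain ⟨q₂, hq₂, h₂⟩ := hK.exists_isMaxOn hne hF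
  have hQc : Continuous (fun q : ℝ × ℝ => kerrQ a q.1 q.2) := by unfold kerrQ; fun_prop
  obtain ⟨q₃, hq₃, h₃⟩ := hK.exists_isMinOn hne ((continuousOn_expB (r₀ := r₀) ham).div
    hQc.continuousOn fun q hq => (kerrQ_pos (hm.trans_le hq.1.1) a q.2).ne')
  have hmin := expansionFactor_pos ham hq₁.1.1 c q₁.2
  refine ⟨max 1 (max (expansionFactor a m c q₂.1 q₂.2) (expansionFactor a m c q₁.1 q₁.2)⁻¹), _,
    le_max_left _ _, div_pos (expB_optW_pos ham hq₃.1.1 q₃.2)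
      (kerrQ_pos (hm.trans_le hq₃.1.1) a q₃.2), expansionFactor a m c, fun r hr θ hθ => ?_⟩
  have hmem : (r, θ) ∈ Icc m r₀ ×ˢ Icc 0 Real.pi := ⟨hr, hθ⟩
  refine ⟨?_, ?_, _, ?_, kerrSphereExpansions_of_le ham hr.1 c⟩
  · refine (inv_le_of_inv_le₀ hmin ((le_max_right _ _).trans (le_max_right _ _))).trans ?_
    exact isMinOn_iff.1 h₁ _ hmem
  · exact (isMaxOn_iff.1 h₂ _ hmem).trans ((le_max_left _ _).trans (le_max_right _ _))
  · exact neg_le_neg (isMinOn_iff.1 h₃ _ hmem)
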